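/- **Conventions.** For a matroid $M$ on a finite set $E$, $P(M)\subset\mathbb R^E$ is its base polytope, the convex hull of the indicator vectors $v_B$ of its bases $B$. Let $\mathcal M$ be the category whose objects are pairs $(E,M)$ with $E$ a finite set and $M$ a matroid on $E$, and whose morphisms $(E,M)\to(E',M')$ are the bijections $\varphi:E\to E'$ with $P(M')\subset\varphi(P(M))$. Let $\mathcal M_{\mathrm{id}}(E)$ be the subcategory with objects the matroids on $E$ and with only the morphisms $\iota_{M,M'}:M\to M'$ given by $\mathrm{id}_E$ (there is one if and only if $P(M')\subset P(M)$), and let $\mathcal M_{\mathrm{id}}^+(E)$ be its $\mathbb Q$-linear additive closure. *Decompositions.* A decomposition of a matroid $M$ on $E$ is a collection $\mathcal N$ of matroids on $E$ such that every nonempty face of $P(N)$, $N\in\mathcal N$, is again $P(N')$ for some $N'\in\mathcal N$; for $N,N'\in\mathcal N$ the intersection $P(N)\cap P(N')$ is a (possibly empty) face of both; and $P(M)=\bigcup_{N\in\mathcal N}P(N)$. Put $d=\dim P(M)$. For $k\le d$ let $\mathcal N_k$ be the set of $N\in\mathcal N$ with $\dim P(N)=k$ and $P(N)\not\subset\partial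 P(M)$ (relative boundary), and let $\mathcal N_{d+1}=\{M\}$. An orientation $\Omega$ of $\mathcal N$ is an arbitrary choice of an orientation of $P(N)$ for every $N\in\mathcal N$, together with an orientation of $P(M)$; an orientation of a polytope $P$ is a ray in the top exterior power of the span of $\{x-y\mid x,y\in P\}$. Let $C^\Omega_\bullet(\mathcal N)$ be the chain complex in $\mathcal M_{\mathrm{id}}^+(E)$ with $C^\Omega_k=\bigoplus_{N\in\mathcal N_k}N$ and the following differential. For $k\le d$, the component from $N\in\mathcal N_k$ to $N'\in\mathcal N_{k-1}$ is $0$ unless $P(N')$ is a facet of $P(N)$, in which case it is $\iota_{N,N'}$ or $-\iota_{N,N'}$ depending on whether or not the orientation of $P(N')$ is the one induced from $P(N)$ by contraction with an outward normal vector. The component from $M\in\mathcal N_{d+1}$ to $N\in\mathcal N_d$ is $\iota_{M,N}$ or $-\iota_{M,N}$ depending on whether or not the orientations of $P(M)$ and $P(N)$ agree. *Valuative invariants.* Fix an abelian group $A$ and let $\mathcal A$ be the category of finite dimensional $A$-graded vector spaces over $\mathbb Q$. A functor $\Phi:\mathcal M\to\mathcal A$ is a valuative categorical invariant if, for every finite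 set $E$, every matroid $M$ on $E$, every decomposition $\mathcal N$ of $M$ and every orientation $\Omega$ of $\mathcal N$, the complex $\Phi(C^\Omega_\bullet(\mathcal N))$ in $\mathcal A$ is contractible. *Relaxation.* Let $M$ be a matroid of rank $k$ on a finite set $E$. A flat $F$ of $M$ is stressed if the restriction of $M$ to $F$ and the contraction of $M$ by $F$ are both uniform matroids. If $F$ is a stressed flat of rank $r$, let $\operatorname{cusp}(F)$ be the set of $k$-element subsets $S\subset E$ with $|S\cap F|=r+1$. The relaxation of $M$ with respect to a set $\mathcal F$ of stressed flats is the matroid whose bases are the bases of $M$ and the elements of $\bigcup_{G\in\mathcal F}\operatorname{cusp}(G)$. Write $U_{d,S}$ for the uniform matroid of rank $d$ on $S$, let $\Pi_{r,k,F,E}$ be the direct sum of $U_{k-r,E\setminus F}$ and $U_{r,F}$, of which $F$ is a stressed flat, and let $\Lambda_{r,k,F,E}$ be the relaxation of $\Pi_{r,k,F,E}$ with respect to $F$. **Proposition 9.4.** Let $\Gamma$ be a finite group acting on a finite set $E$ and preserving a matroid $M$ of rank $k$ on $E$. Let $F$ be a stressed flat of $M$ of rank $r$, let $\Gamma_F\subset\Gamma$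 be the stabilizer of $F$, and let $\tilde M$ be the relaxation of $M$ with respect to $\{\gamma F\mid\gamma\in\Gamma\}$. Then $\Gamma$ preserves $\tilde M$, $\Gamma_F$ preserves $\Pi_{r,k,F,E}$ and $\Lambda_{r,k,F,E}$, and for every valuative categorical invariant $\Phi:\mathcal M\to\mathcal A$ we have $$\Phi(\tilde M)=\Phi(M)+\operatorname{Ind}_{\Gamma_F}^{\Gamma}\Phi(\Lambda_{r,k,F,E})-\operatorname{Ind}_{\Gamma_F}^{\Gamma}\Phi(\Pi_{r,k,F,E})$$ as virtual graded representations of $\Gamma$, that is, in the Grothendieck group of the category of finite dimensional $A$-graded representations of $\Gamma$ over $\mathbb Q$. -/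

import Mathlib

open CategoryTheory CategoryTheory.Limits Module
open scoped Pointwise

noncomputable section

namespace RelaxValuative

/-- A matroid with ground set `E`. -/
structure MatroidOn (E : Type) where
  toMatroid : Matroid E
  ground_eq : toMatroid.E = Set.univ

/-- The uniform matroid `U_{d,S}` of rank `d` on the set `S` (for `d ≤ |S|`). -/
def uniform {E : Type} [Finite E] (d : ℕ) (S : Set E) : Matroid E :=
  (IndepMatroid.ofFinite (E := S) S.toFinite (fun I => I ⊆ S ∧ I.ncard ≤ d)
    ⟨Set.empty_subset S, by simp⟩
    (fun I J hJ hIJ => ⟨hIJ.trans hJ.1, (Set.ncard_le_ncard hIJ J.toFinite).trans hJ.2⟩)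
    (fun I J hI hJ h => by
      obtain ⟨e, he, heI⟩ := Set.exists_mem_notMem_of_ncard_lt_ncard h I.toFinite
      refine ⟨e, he, heI, Set.insert_subset (hJ.1 he) hI.1, ?_⟩
      rw [Set.ncard_insert_of_notMem heI I.toFinite]
      have := hJ.2
      omega)
    (fun I hI => hI.1)).matroid

/-- A matroid is uniform if it is `U_{d,S}`, where `S` is its ground set, for some `d`. -/
def IsUniform {E : Type} [Finite E] (M : Matroid E) : Prop := ∃ d : ℕ, M = uniform d M.E

/-- A stressed flat: the restriction to `F` and the contraction by `F` are both uniform. -/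
structure IsStressedFlat {E : Type} [Finite E] (M : MatroidOn E) (F : Set E) : Prop where
  isFlat : M.toMatroid.IsFlat F
  restrict_uniform : IsUniform (M.toMatroid.restrict F)
  contract_uniform : IsUniform (M.toMatroid.contract F)

/-- For a matroid of rank `k` and a flat `F` of rank `r`, the set of all `k`-element subsets
`S` of the ground set with `|S ∩ F| = r + 1`. -/
def cusp {E : Type} (M : MatroidOn E) (F : Set E) : Set (Set E) :=
  {S | S.encard = M.toMatroid.eRank ∧ (S ∩ F).encard = M.toMatroid.eRk F + 1}

section lemmas

variable {E : Type}

/-- Membership in the family obtained from the bases of `M` by adding all cusps. -/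
def RelaxBase (M : MatroidOn E) (𝓕 : Set (Set E)) (B : Set E) : Prop :=
  M.toMatroid.IsBase B ∨ ∃ F ∈ 𝓕, B ∈ cusp M F

theorem RelaxBase.ncard_eq {M : MatroidOn E} {𝓕 : Set (Set E)} {B B' : Set E}
    (hB : RelaxBase M 𝓕 B) (hB' : RelaxBase M 𝓕 B') : B.ncard = B'.ncard := by
  have : ∀ {C}, RelaxBase M 𝓕 C → C.encard = M.toMatroid.eRank := by
    rintro C (h | ⟨F, -, h⟩)
    · exact h.encard_eq_eRank
    · exact h.1
  rw [Set.ncard, Set.ncard, this hB, this hB']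

variable [Finite E]

theorem uniform_indep {d : ℕ} {S I : Set E} :
    (uniform d S).Indep I ↔ I ⊆ S ∧ I.ncard ≤ d := Iff.rfl

theorem uniform_ground {d : ℕ} {S : Set E} : (uniform d S).E = S := rfl

theorem IsStressedFlat.indep_of_subset {M : MatroidOn E} {F : Set E} (h : IsStressedFlat M F)
    {X : Set E} (hX : X ⊆ F) (hc : X.encard ≤ M.toMatroid.eRk F) : M.toMatroid.Indep X := by
  obtain ⟨d, hd⟩ := h.restrict_uniform
  obtain ⟨I, hI⟩ := M.toMatroid.exists_isBasis F (by rw [M.ground_eq]; exact Set.subset_univ F)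
  have h1 : (M.toMatroid.restrict F).Indep I := by
    rw [Matroid.restrict_indep_iff]; exact ⟨hI.indep, hI.subset⟩
  rw [hd, uniform_indep] at h1
  have h2 : X.ncard ≤ I.ncard := by
    rw [← hI.encard_eq_eRk, ← X.toFinite.cast_ncard_eq, ← I.toFinite.cast_ncard_eq] at hc
    exact_mod_cast hc
  have h3 : (M.toMatroid.restrict F).Indep X := by
    rw [hd, uniform_indep]; exact ⟨by simpa using hX, h2.trans h1.2⟩
  exact (Matroid.restrict_indep_iff.1 h3).1

theorem IsStressedFlat.indep_union {M : MatroidOn E} {F : Set E} (h : IsStressedFlat M F)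
    {I J : Set E} (hI : M.toMatroid.IsBasis I F) (hJ : Disjoint F J)
    (hc : J.encard + M.toMatroid.eRk F ≤ M.toMatroid.eRank) : M.toMatroid.Indep (J ∪ I) := by
  obtain ⟨d, hd⟩ := h.contract_uniform
  obtain ⟨B, hB⟩ := (M.toMatroid.contract F).exists_isBase
  have hBi := hB.indep
  have hBI : M.toMatroid.IsBase (B ∪ I) := by
    have := (hI.contract_indep_iff (J := B)).1 hBi
    obtain ⟨B', hB', hBB'⟩ := this.1.exists_isBase_superset
    have h4 : B' ∩ F = I := by
      refine (hI.eq_of_subset_indep (hB'.indep.inter_right F) ?_ Set.inter_subset_right).symm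
      exact Set.subset_inter (Set.subset_union_right.trans hBB') hI.subset
    have h5 : (M.toMatroid.contract F).Indep (B' \ F) := by
      rw [hI.contract_indep_iff]
      refine ⟨hB'.indep.subset ?_, Set.disjoint_sdiff_right⟩
      exact Set.union_subset Set.sdiff_subset (Set.subset_union_right.trans hBB')
    have h6 : B = B' \ F := hB.eq_of_subset_indep h5
      (Set.subset_sdiff.2 ⟨Set.subset_union_left.trans hBB', this.2.symm⟩)
    have : B ∪ I = B' := by rw [h6, ← h4, Set.sdiff_union_inter]
    rwa [this]
  have hdj := ((hI.contract_indep_iff (J := B)).1 hBi).2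
  have h7 : M.toMatroid.eRank = B.encard + I.encard := by
    rw [← hBI.encard_eq_eRank, Set.encard_union_eq (hdj.mono_left hI.subset).symm]
  rw [h7, ← hI.encard_eq_eRk, ← J.toFinite.cast_ncard_eq, ← I.toFinite.cast_ncard_eq,
    ← B.toFinite.cast_ncard_eq] at hc
  have hc' : J.ncard + I.ncard ≤ B.ncard + I.ncard := by exact_mod_cast hc
  have hJi : (M.toMatroid.contract F).Indep J := by
    rw [hd, uniform_indep] at hBi ⊢
    refine ⟨?_, by omega⟩
    rw [Matroid.contract_ground, M.ground_eq, Set.subset_sdiff]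
    exact ⟨Set.subset_univ J, hJ.symm⟩
  exact ((hI.contract_indep_iff (J := J)).1 hJi).1

theorem IsStressedFlat.indep_of_ssubset {M : MatroidOn E} {G F : Set E} (hG : IsStressedFlat M G)
    (hF : M.toMatroid.IsFlat F) (hFG : F ⊆ G) (hne : F ≠ G) : M.toMatroid.Indep F := by
  rcases le_total F.encard (M.toMatroid.eRk G) with h | h
  · exact hG.indep_of_subset hFG h
  · exfalso
    obtain ⟨X, hXF, hX⟩ := Set.exists_subset_encard_eq h
    have hXi := hG.indep_of_subset (hXF.trans hFG) hX.le
    have hXb : M.toMatroid.IsBasis X G := by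
      refine hXi.isBasis_of_eRk_ge X.toFinite (hXF.trans hFG) ?_
        (by rw [M.ground_eq]; exact Set.subset_univ G)
      rw [hXi.eRk_eq_encard, hX]
    have : G ⊆ F := by
      rw [← hF.closure]
      exact hXb.subset_closure.trans (M.toMatroid.closure_subset_closure hXF)
    exact hne (hFG.antisymm this)

theorem IsStressedFlat.eq_of_cusp {M : MatroidOn E} {F G S : Set E} (hF : IsStressedFlat M F)
    (hG : IsStressedFlat M G) (hS : S.encard = M.toMatroid.eRank)
    (hSF : M.toMatroid.eRk F + 1 ≤ (S ∩ F).encard)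
    (hSG : M.toMatroid.eRk G + 1 ≤ (S ∩ G).encard) : F = G := by
  by_contra hne
  have key : ∀ {H X : Set E}, M.toMatroid.eRk H + 1 ≤ X.encard → X ⊆ H →
      M.toMatroid.Indep X → False := by
    intro H X h1 h2 h3
    have h4 := h1.trans (h3.encard_le_eRk_of_subset h2)
    have h5 : M.toMatroid.eRk H ≠ ⊤ :=
      ((M.toMatroid.eRk_le_encard H).trans_lt H.toFinite.encard_lt_top).ne
    exact absurd h4 (not_le.2 ((ENat.lt_add_one_iff h5).2 le_rfl))
  by_cases hsub : F ⊆ G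
  · exact key hSF Set.inter_subset_right
      ((hG.indep_of_ssubset hF.isFlat hsub hne).inter_left S)
  · have hfl : M.toMatroid.IsFlat (F ∩ G) := by
      rw [Set.inter_eq_iInter]
      refine Matroid.IsFlat.iInter fun b => ?_
      cases b
      · exact hG.isFlat
      · exact hF.isFlat
    have hi : M.toMatroid.Indep (F ∩ G) :=
      hF.indep_of_ssubset hfl Set.inter_subset_left
        (fun h => hsub (Set.inter_eq_left.1 h))
    obtain ⟨I, hI, hFGI⟩ := hi.subset_isBasis_of_subset Set.inter_subset_left
      (by rw [M.ground_eq]; exact Set.subset_univ F)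
    have hJ : M.toMatroid.Indep (((S ∩ G) \ F) ∪ I) := by
      refine hF.indep_union hI Set.disjoint_sdiff_right ?_
      rw [← hS]
      have h1 : (S \ F).encard + (S ∩ F).encard = S.encard := Set.encard_sdiff_add_encard_inter S F
      have h2 : ((S ∩ G) \ F).encard ≤ (S \ F).encard :=
        Set.encard_le_encard (Set.sdiff_subset_sdiff_left Set.inter_subset_left)
      calc ((S ∩ G) \ F).encard + M.toMatroid.eRk F
          ≤ (S \ F).encard + (S ∩ F).encard :=
            add_le_add h2 (le_self_add.trans hSF)
        _ = S.encard := h1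
    refine key hSG Set.inter_subset_right (hJ.subset ?_)
    intro x hx
    by_cases hxF : x ∈ F
    · exact Or.inr (hFGI ⟨hxF, hx.2⟩)
    · exact Or.inl ⟨hx, hxF⟩

theorem relaxBase_exchange {M : MatroidOn E} {𝓕 : Set (Set E)}
    (h𝓕 : ∀ F ∈ 𝓕, IsStressedFlat M F) : Matroid.ExchangeProperty (RelaxBase M 𝓕) := by
  classical
  intro B₁ B₂ h₁ h₂ e he
  have hcard := h₁.ncard_eq h₂
  obtain ⟨B₀, hB₀⟩ := M.toMatroid.exists_isBase
  have hk : ∀ C : Set E, C.encard = M.toMatroid.eRank ↔ C.ncard = B₀.ncard := by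
    intro C
    rw [← hB₀.encard_eq_eRank, ← C.toFinite.cast_ncard_eq, ← B₀.toFinite.cast_ncard_eq]
    exact_mod_cast Iff.rfl
  have hB₁k : B₁.ncard = B₀.ncard := h₁.ncard_eq (Or.inl hB₀)
  have hB₂k : B₂.ncard = B₀.ncard := h₂.ncard_eq (Or.inl hB₀)
  have hins : ∀ f ∈ B₂ \ B₁, (insert f (B₁ \ {e})).ncard = B₀.ncard := by
    intro f hf
    rw [Set.ncard_insert_of_notMem (fun h => hf.2 h.1) (Set.toFinite _),
      Set.ncard_sdiff_singleton_of_mem he.1]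
    have := (Set.ncard_pos B₁.toFinite).2 ⟨e, he.1⟩
    omega
  have hsplit : ∀ X F : Set E, (X \ F).ncard + (X ∩ F).ncard = X.ncard := by
    intro X F
    rw [add_comm]; exact Set.ncard_inter_add_ncard_sdiff_eq_ncard X F X.toFinite
  have hbasis : ∀ F, ∃ I, M.toMatroid.IsBasis I F := fun F =>
    M.toMatroid.exists_isBasis F (by rw [M.ground_eq]; exact Set.subset_univ F)
  have hbase : ∀ {C : Set E}, M.toMatroid.Indep C → C.ncard = B₀.ncard → M.toMatroid.IsBase C := by
    intro C hC h
    refine hC.isBase_of_eRk_ge C.toFinite ?_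
    rw [hC.eRk_eq_encard, (hk C).2 h]
  have hcusp : ∀ {F I}, M.toMatroid.IsBasis I F → ∀ C, C ∈ cusp M F ↔
      C.ncard = B₀.ncard ∧ (C ∩ F).ncard = I.ncard + 1 := by
    intro F I hI C
    rw [cusp, Set.mem_ofPred_eq, hk, ← hI.encard_eq_eRk, ← (C ∩ F).toFinite.cast_ncard_eq,
      ← I.toFinite.cast_ncard_eq]
    exact_mod_cast Iff.rfl
  have hle : ∀ {F I}, F ∈ 𝓕 → M.toMatroid.IsBasis I F → ∀ C, RelaxBase M 𝓕 C →
      (C ∩ F).ncard ≤ I.ncard + 1 := by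
    intro F I hF hI C hC
    by_contra hlt
    push Not at hlt
    have hlt' : M.toMatroid.eRk F + 1 ≤ (C ∩ F).encard := by
      rw [← hI.encard_eq_eRk, ← (C ∩ F).toFinite.cast_ncard_eq, ← I.toFinite.cast_ncard_eq]
      exact_mod_cast hlt.le
    rcases hC with hC | ⟨G, hG, hC⟩
    · have h3 := (hC.indep.inter_right F).encard_le_eRk_of_subset Set.inter_subset_right
      rw [← hI.encard_eq_eRk, ← (C ∩ F).toFinite.cast_ncard_eq,
        ← I.toFinite.cast_ncard_eq] at h3
      have h4 : (C ∩ F).ncard ≤ I.ncard := by exact_mod_cast h3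
      omega
    · have := (h𝓕 F hF).eq_of_cusp (h𝓕 G hG) hC.1 hlt' hC.2.ge
      subst this
      have := ((hcusp hI C).1 hC).2
      omega
  -- a set of the right size meeting `F` in a set of size `r` is a basis of `M`
  have hPi : ∀ {F I}, F ∈ 𝓕 → M.toMatroid.IsBasis I F → ∀ C : Set E, C.ncard = B₀.ncard →
      (C ∩ F).ncard = I.ncard → M.toMatroid.IsBase C := by
    intro F I hF hI C hC hCF
    have hS := h𝓕 F hF
    have hi : M.toMatroid.Indep (C ∩ F) := by
      refine hS.indep_of_subset Set.inter_subset_right ?_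
      rw [← hI.encard_eq_eRk, ← (C ∩ F).toFinite.cast_ncard_eq, ← I.toFinite.cast_ncard_eq, hCF]
    have hb : M.toMatroid.IsBasis (C ∩ F) F := by
      refine hi.isBasis_of_eRk_ge (Set.toFinite _) Set.inter_subset_right ?_
      rw [hi.eRk_eq_encard, ← hI.encard_eq_eRk, ← (C ∩ F).toFinite.cast_ncard_eq,
        ← I.toFinite.cast_ncard_eq, hCF]
    have hu := hS.indep_union (J := C \ F) hb Set.disjoint_sdiff_right (by
      rw [← hb.encard_eq_eRk, Set.encard_sdiff_add_encard_inter, (hk C).2 hC])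
    rw [Set.sdiff_union_inter] at hu
    exact hbase hu hC
  have hne : ∃ f, f ∈ B₂ \ B₁ := by
    by_contra hcon
    push Not at hcon
    have hs : B₂ ⊆ B₁ := fun x hx => by
      by_contra hx1
      exact hcon x ⟨hx, hx1⟩
    have := Set.eq_of_subset_of_ncard_le hs (by omega) B₁.toFinite
    exact he.2 (this ▸ he.1)
  have hins_notMem : ∀ (F : Set E) f, f ∉ F →
      insert f (B₁ \ {e}) ∩ F = (B₁ \ {e}) ∩ F := by
    intro F f hf
    rw [Set.insert_inter_of_notMem hf]
  have hins_mem : ∀ (F : Set E) f, f ∈ B₂ \ B₁ → f ∈ F →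
      (insert f (B₁ \ {e}) ∩ F).ncard = ((B₁ \ {e}) ∩ F).ncard + 1 := by
    intro F f hf hfF
    rw [Set.insert_inter_of_mem hfF, Set.ncard_insert_of_notMem (fun h => hf.2 h.1.1) (Set.toFinite _)]
  have hdel_mem : ∀ F : Set E, e ∈ F → ((B₁ \ {e}) ∩ F).ncard + 1 = (B₁ ∩ F).ncard := by
    intro F heF
    have : (B₁ \ {e}) ∩ F = (B₁ ∩ F) \ {e} := by ext; simp; tauto
    rw [this]
    exact Set.ncard_sdiff_singleton_add_one ⟨he.1, heF⟩ (Set.toFinite _)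
  have hdel_notMem : ∀ F : Set E, e ∉ F → (B₁ \ {e}) ∩ F = B₁ ∩ F := by
    intro F heF
    ext x
    simp only [Set.mem_inter_iff, Set.mem_sdiff, Set.mem_singleton_iff]
    constructor
    · tauto
    · rintro ⟨h1, h2⟩
      exact ⟨⟨h1, fun h => heF (h ▸ h2)⟩, h2⟩
  rcases h₁ with h₁ | ⟨F, hF, h₁⟩
  · rcases h₂ with h₂ | ⟨F, hF, h₂⟩
    · obtain ⟨f, hf, hfB⟩ := h₁.exchange h₂ he
      exact ⟨f, hf, Or.inl hfB⟩
    · -- `B₁` is a basis of `M` and `B₂` lies in the cusp of `F`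
      obtain ⟨I, hI⟩ := hbasis F
      have hS := h𝓕 F hF
      have h₂' := (hcusp hI B₂).1 h₂
      by_contra hcon
      push Not at hcon
      set H := M.toMatroid.closure (B₁ \ {e}) with hH
      have hCi : M.toMatroid.Indep (B₁ \ {e}) := h₁.indep.subset Set.sdiff_subset
      have hsub : B₂ ⊆ H := by
        intro f hf
        by_cases hfB : f ∈ B₁
        · exact M.toMatroid.subset_closure _ (by rw [M.ground_eq]; exact Set.subset_univ _)
            ⟨hfB, fun h => he.2 (h ▸ hf)⟩
        · by_contra hfH
          apply hcon f ⟨hf, hfB⟩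
          left
          have : M.toMatroid.Indep (insert f (B₁ \ {e})) := by
            rw [hCi.insert_indep_iff]
            exact Or.inl ⟨by rw [M.ground_eq]; exact Set.mem_univ f, hfH⟩
          exact hbase this (hins f ⟨hf, hfB⟩)
      obtain ⟨X, hXB, hX⟩ := Set.exists_subset_card_eq (s := B₂ ∩ F) (n := I.ncard) (by omega)
      have hXe : X.encard = M.toMatroid.eRk F := by
        rw [← hI.encard_eq_eRk, ← X.toFinite.cast_ncard_eq, ← I.toFinite.cast_ncard_eq, hX]
      have hXi := hS.indep_of_subset (hXB.trans Set.inter_subset_right) hXe.le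
      have hXb : M.toMatroid.IsBasis X F := by
        refine hXi.isBasis_of_eRk_ge X.toFinite (hXB.trans Set.inter_subset_right) ?_
        rw [hXi.eRk_eq_encard, hXe]
      have hFH : F ⊆ H := by
        refine hXb.subset_closure.trans ?_
        rw [hH, ← M.toMatroid.closure_closure (B₁ \ {e})]
        exact M.toMatroid.closure_subset_closure ((hXB.trans Set.inter_subset_left).trans hsub)
      have hCF : ((B₁ \ {e}) ∩ F).ncard ≤ I.ncard := by
        have h3 := (hCi.inter_right F).encard_le_eRk_of_subset Set.inter_subset_right
        rw [← hI.encard_eq_eRk, ← (B₁ \ {e} ∩ F).toFinite.cast_ncard_eq,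
          ← I.toFinite.cast_ncard_eq] at h3
        exact_mod_cast h3
      have hBpos := (Set.ncard_pos B₁.toFinite).2 ⟨e, he.1⟩
      have hCcard : (B₁ \ {e}).ncard + 1 = B₀.ncard := by
        rw [Set.ncard_sdiff_singleton_add_one he.1 B₁.toFinite]; omega
      rcases hCF.eq_or_lt with hCF | hCF
      · have hlt : ((B₁ \ {e}) ∩ F).ncard < (B₂ ∩ F).ncard := by omega
        obtain ⟨f, hf, hfC⟩ := Set.exists_mem_notMem_of_ncard_lt_ncard hlt (Set.toFinite _)
        have hfB : f ∉ B₁ := fun h => hfC ⟨⟨h, fun h' => he.2 (h' ▸ hf.1)⟩, hf.2⟩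
        apply hcon f ⟨hf.1, hfB⟩
        refine Or.inr ⟨F, hF, (hcusp hI _).2 ⟨hins f ⟨hf.1, hfB⟩, ?_⟩⟩
        rw [hins_mem F f ⟨hf.1, hfB⟩ hf.2, hCF]
      · -- there is a set `J ⊆ (B₁ \ {e}) \ F` of size `k - r`, which together with a basis of `F`
        -- is a basis of `M` contained in the hyperplane `H`
        have h5 := hsplit (B₁ \ {e}) F
        have h6 : I.ncard ≤ B₀.ncard := by
          rw [← h₂'.1]
          have := Set.ncard_le_ncard (Set.inter_subset_left : B₂ ∩ F ⊆ B₂) B₂.toFinite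
          omega
        obtain ⟨J, hJC, hJ⟩ := Set.exists_subset_card_eq (s := (B₁ \ {e}) \ F)
          (n := B₀.ncard - I.ncard) (by omega)
        have hdj : Disjoint F J := (Set.subset_sdiff.1 hJC).2.symm
        have hJI := hS.indep_union hI hdj (by
          rw [← hI.encard_eq_eRk, ← hB₀.encard_eq_eRank, ← J.toFinite.cast_ncard_eq,
            ← I.toFinite.cast_ncard_eq, ← B₀.toFinite.cast_ncard_eq]
          exact_mod_cast (by omega : J.ncard + I.ncard ≤ B₀.ncard))
        have h7 : (J ∪ I).ncard = B₀.ncard := by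
          rw [Set.ncard_union_eq (hdj.mono_left hI.subset).symm J.toFinite I.toFinite]
          omega
        have h8 : J ∪ I ⊆ H := by
          refine Set.union_subset ?_ (hI.subset.trans hFH)
          exact (hJC.trans Set.sdiff_subset).trans
            (M.toMatroid.subset_closure _ (by rw [M.ground_eq]; exact Set.subset_univ _))
        have h9 := hJI.encard_le_eRk_of_subset h8
        rw [hH, M.toMatroid.eRk_closure_eq, hCi.eRk_eq_encard, ← (J ∪ I).toFinite.cast_ncard_eq,
          ← (B₁ \ {e}).toFinite.cast_ncard_eq] at h9
        have h10 : (J ∪ I).ncard ≤ (B₁ \ {e}).ncard := by exact_mod_cast h9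
        omega
  · -- `B₁` lies in the cusp of `F`
    obtain ⟨I, hI⟩ := hbasis F
    have h₁' := (hcusp hI B₁).1 h₁
    by_cases heF : e ∈ F
    · obtain ⟨f, hf⟩ := hne
      refine ⟨f, hf, ?_⟩
      have h3 := hdel_mem F heF
      by_cases hfF : f ∈ F
      · refine Or.inr ⟨F, hF, (hcusp hI _).2 ⟨hins f hf, ?_⟩⟩
        rw [hins_mem F f hf hfF]; omega
      · refine Or.inl (hPi hF hI _ (hins f hf) ?_)
        rw [hins_notMem F f hfF]; omega
    · have : ∃ f ∈ B₂ \ B₁, f ∉ F := by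
        by_contra hcon
        push Not at hcon
        have hsub : B₂ \ F ⊆ (B₁ \ F) \ {e} := by
          intro x hx
          refine ⟨⟨?_, hx.2⟩, fun h => he.2 (h ▸ hx.1)⟩
          by_contra hx1
          exact hx.2 (hcon x ⟨hx.1, hx1⟩)
        have h3 := Set.ncard_le_ncard hsub (Set.toFinite _)
        have h4 := Set.ncard_sdiff_singleton_add_one (s := B₁ \ F) ⟨he.1, heF⟩ (Set.toFinite _)
        have h5 := hsplit B₁ F
        have h6 := hsplit B₂ F
        have h7 := hle hF hI B₂ h₂
        omega
      obtain ⟨f, hf, hfF⟩ := this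
      refine ⟨f, hf, Or.inr ⟨F, hF, (hcusp hI _).2 ⟨hins f hf, ?_⟩⟩⟩
      rw [hins_notMem F f hfF, hdel_notMem F heF]
      exact h₁'.2

end lemmas


/-! ### Group actions -/

section action

variable {E : Type}

/-- The group `Γ` acting on `E` preserves the matroid `M`. -/
def IsInvariant (Γ : Type) [Group Γ] [MulAction Γ E] (M : MatroidOn E) : Prop :=
  ∀ (γ : Γ) (B : Set E), M.toMatroid.IsBase B → M.toMatroid.IsBase (γ • B)

variable {Γ : Type} [Group Γ] [MulAction Γ E]

theorem IsInvariant.indep {M : MatroidOn E} (hM : IsInvariant Γ M) (γ : Γ) {I : Set E}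
    (hI : M.toMatroid.Indep I) : M.toMatroid.Indep (γ • I) := by
  obtain ⟨B, hB, hIB⟩ := hI.exists_isBase_superset
  exact (hM γ B hB).indep.subset (Set.smul_set_mono hIB)

theorem IsInvariant.indep_iff {M : MatroidOn E} (hM : IsInvariant Γ M) (γ : Γ) {I : Set E} :
    M.toMatroid.Indep (γ • I) ↔ M.toMatroid.Indep I :=
  ⟨fun h => by simpa using hM.indep γ⁻¹ h, hM.indep γ⟩

theorem isInvariant_of_indep {M : MatroidOn E}
    (h : ∀ (γ : Γ) (I : Set E), M.toMatroid.Indep I → M.toMatroid.Indep (γ • I)) :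
    IsInvariant Γ M := by
  intro γ B hB
  obtain ⟨B', hB', hsub⟩ := (h γ B hB.indep).exists_isBase_superset
  have h1 : B = γ⁻¹ • B' := hB.eq_of_subset_indep (h γ⁻¹ B' hB'.indep)
    (Set.subset_smul_set_iff.2 (by simpa using hsub))
  have h2 : γ • B = B' := by rw [h1]; simp
  rwa [h2]

theorem IsInvariant.isBasis {M : MatroidOn E} (hM : IsInvariant Γ M) (γ : Γ) {I X : Set E}
    (h : M.toMatroid.IsBasis I X) : M.toMatroid.IsBasis (γ • I) (γ • X) := by
  refine (hM.indep γ h.indep).isBasis_of_forall_insert (Set.smul_set_mono h.subset) ?_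
  rintro e ⟨he, heI⟩
  obtain ⟨x, hx, rfl⟩ := he
  have hxI : x ∉ I := fun hxI => heI (Set.smul_mem_smul_set hxI)
  have hd := h.insert_dep ⟨hx, hxI⟩
  rw [← Matroid.not_indep_iff (by rw [M.ground_eq]; exact Set.subset_univ _)] at hd ⊢
  have : insert (γ • x) (γ • I) = γ • insert x I := by
    ext y
    simp [Set.mem_smul_set_iff_inv_smul_mem, inv_smul_eq_iff]
  intro hcon
  exact hd ((hM.indep_iff γ).1 (this ▸ hcon))

theorem IsInvariant.eRk_smul {M : MatroidOn E} (hM : IsInvariant Γ M) (γ : Γ) (X : Set E) :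
    M.toMatroid.eRk (γ • X) = M.toMatroid.eRk X := by
  obtain ⟨I, hI⟩ := M.toMatroid.exists_isBasis X (by rw [M.ground_eq]; exact Set.subset_univ X)
  rw [← hI.encard_eq_eRk, ← (hM.isBasis γ hI).encard_eq_eRk, Set.encard_smul_set]

theorem IsInvariant.smul_mem_cusp {M : MatroidOn E} (hM : IsInvariant Γ M) (γ : Γ) {F S : Set E}
    (hS : S ∈ cusp M F) : γ • S ∈ cusp M (γ • F) := by
  refine ⟨?_, ?_⟩
  · rw [Set.encard_smul_set]; exact hS.1
  · rw [← Set.smul_set_inter, Set.encard_smul_set, hM.eRk_smul]; exact hS.2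

theorem uniform_smul_indep [Finite E] {d : ℕ} {S I : Set E} (γ : Γ) :
    (uniform d (γ • S)).Indep I ↔ (uniform d S).Indep (γ⁻¹ • I) := by
  rw [uniform_indep, uniform_indep, Set.ncard_smul_set]
  refine and_congr_left' ?_
  rw [Set.subset_smul_set_iff]

/-- Translates of a stressed flat of an invariant matroid are stressed flats. -/
theorem IsStressedFlat.smul [Finite E] {M : MatroidOn E} (hM : IsInvariant Γ M) {F : Set E}
    (hF : IsStressedFlat M F) (γ : Γ) : IsStressedFlat M (γ • F) := by
  have hg : ∀ X : Set E, X ⊆ M.toMatroid.E := fun X => by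
    rw [M.ground_eq]; exact Set.subset_univ X
  refine ⟨⟨?_, hg _⟩, ?_, ?_⟩
  · intro I X hI hX
    have h1 := hM.isBasis γ⁻¹ hI
    rw [inv_smul_smul] at h1
    exact Set.subset_smul_set_iff.2
      (hF.isFlat.subset_of_isBasis_of_isBasis h1 (hM.isBasis γ⁻¹ hX))
  · obtain ⟨d, hd⟩ := hF.restrict_uniform
    refine ⟨d, Matroid.ext_indep rfl fun I _ => ?_⟩
    rw [Matroid.restrict_ground_eq] at hd ⊢
    rw [uniform_smul_indep, ← hd, Matroid.restrict_indep_iff, Matroid.restrict_indep_iff,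
      hM.indep_iff, Set.subset_smul_set_iff]
  · obtain ⟨d, hd⟩ := hF.contract_uniform
    obtain ⟨I, hI⟩ := M.toMatroid.exists_isBasis F (hg F)
    have hgr : (M.toMatroid.contract (γ • F)).E = γ • (M.toMatroid.contract F).E := by
      rw [Matroid.contract_ground, Matroid.contract_ground, M.ground_eq, Set.smul_set_sdiff,
        Set.smul_set_univ]
    refine ⟨d, Matroid.ext_indep rfl fun J _ => ?_⟩
    rw [hgr, uniform_smul_indep, ← hd, (hM.isBasis γ hI).contract_indep_iff,
      hI.contract_indep_iff, ← hM.indep_iff γ⁻¹, Set.smul_set_union, inv_smul_smul]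
    refine and_congr_right' ?_
    rw [← Set.disjoint_smul_set (a := γ⁻¹), inv_smul_smul]

end action

/-! ### Relaxation -/

section relaxation

variable {E : Type} [Finite E]

/-- The relaxation of `M` with respect to a family `𝓕` of stressed flats: its bases are the bases
of `M` together with the elements of the cusps of the members of `𝓕`. -/
def relax (M : MatroidOn E) (𝓕 : Set (Set E)) (h𝓕 : ∀ F ∈ 𝓕, IsStressedFlat M F) :
    MatroidOn E where
  toMatroid := Matroid.ofIsBaseOfFinite (E := Set.univ) Set.finite_univ (RelaxBase M 𝓕)
    (M.toMatroid.exists_isBase.imp fun _ hB => Or.inl hB) (relaxBase_exchange h𝓕)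
    (fun _ _ => Set.subset_univ _)
  ground_eq := rfl

theorem uniform_disjoint (d r : ℕ) (F : Set E) :
    Disjoint (uniform d Fᶜ).E (uniform r F).E := by
  rw [uniform_ground, uniform_ground]
  exact disjoint_compl_left

/-- `Π_{r,k,F,E}`, the direct sum of `U_{k-r,E∖F}` and `U_{r,F}`. -/
def piMatroid (r k : ℕ) (F : Set E) : MatroidOn E where
  toMatroid := (uniform (k - r) Fᶜ).disjointSum (uniform r F) (uniform_disjoint _ _ _)
  ground_eq := by
    rw [Matroid.disjointSum_ground_eq, uniform_ground, uniform_ground, Set.compl_union_self]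

/-- `Λ_{r,k,F,E}`, the relaxation of `Π_{r,k,F,E}` with respect to its stressed flat `F`. -/
def lambdaMatroid (r k : ℕ) (F : Set E) (hF : IsStressedFlat (piMatroid r k F) F) :
    MatroidOn E :=
  relax (piMatroid r k F) {F} (by rintro _ rfl; exact hF)

theorem piMatroid_indep {r k : ℕ} {F I : Set E} : (piMatroid r k F).toMatroid.Indep I ↔
    (I ∩ Fᶜ).ncard ≤ k - r ∧ (I ∩ F).ncard ≤ r := by
  rw [piMatroid, Matroid.disjointSum_indep_iff, uniform_ground, uniform_ground, uniform_indep,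
    uniform_indep, Set.compl_union_self]
  simp

/-- If `F` is a stressed flat of rank `r` of some matroid of rank `k` on `E`,
then `F` is a stressed flat of `Π_{r,k,F,E}`. -/
theorem IsStressedFlat.piMatroid {M : MatroidOn E} {F : Set E} (hF : IsStressedFlat M F)
    {r k : ℕ} (hr : M.toMatroid.eRk F = r) (hk : M.toMatroid.eRank = k) :
    IsStressedFlat (piMatroid r k F) F := by
  have hg : ∀ X : Set E, X ⊆ (RelaxValuative.piMatroid r k F).toMatroid.E := fun X => by
    rw [MatroidOn.ground_eq]; exact Set.subset_univ X
  have hfin : ∀ X : Set E, (X.ncard : ℕ∞) = X.encard := fun X => X.toFinite.cast_ncard_eq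
  have hFr : r ≤ F.ncard := by
    have := M.toMatroid.eRk_le_encard F
    rw [hr, ← hfin] at this
    exact_mod_cast this
  have hbasis : ∀ I, (RelaxValuative.piMatroid r k F).toMatroid.IsBasis I F → I.ncard = r := by
    intro I hI
    have h1 := (piMatroid_indep.1 hI.indep).2
    rw [Set.inter_eq_left.2 hI.subset] at h1
    obtain ⟨X, hIX, hXF, hX⟩ := Set.exists_subsuperset_card_eq hI.subset h1 hFr
    have h2 : (RelaxValuative.piMatroid r k F).toMatroid.Indep X := by
      rw [piMatroid_indep, Set.inter_eq_left.2 hXF, hX]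
      refine ⟨?_, le_rfl⟩
      rw [(Set.disjoint_compl_right_iff_subset.2 hXF).inter_eq]
      simp
    rw [hI.eq_of_subset_indep h2 hIX hXF, hX]
  have hlt : ∀ e, e ∉ F → r < k := by
    intro e he
    obtain ⟨I, hI⟩ := M.toMatroid.exists_isBasis F (by rw [M.ground_eq]; exact Set.subset_univ F)
    have hei : M.toMatroid.Indep (insert e I) := by
      rw [hI.indep.insert_indep_iff]
      refine Or.inl ⟨by rw [M.ground_eq]; exact Set.mem_univ e, ?_⟩
      rw [hI.closure_eq_closure, hF.isFlat.closure]
      exact he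
    have h1 := hei.encard_le_eRank
    rw [Set.encard_insert_of_notMem (fun h => he (hI.subset h)), hI.encard_eq_eRk, hr, hk] at h1
    have h2 : r + 1 ≤ k := by exact_mod_cast h1
    omega
  refine ⟨⟨?_, hg F⟩, ⟨r, ?_⟩, ⟨k - r, ?_⟩⟩
  · intro I X hI hX e heX
    by_contra he
    have h1 : (RelaxValuative.piMatroid r k F).toMatroid.Indep (insert e I) := by
      rw [piMatroid_indep, Set.insert_inter_of_notMem he, Set.inter_eq_left.2 hI.subset,
        hbasis I hI]
      refine ⟨?_, le_rfl⟩
      have : insert e I ∩ Fᶜ ⊆ {e} := by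
        rintro x ⟨hx | hx, hxF⟩
        · exact hx
        · exact absurd (hI.subset hx) hxF
      have h3 := Set.ncard_le_ncard this
      rw [Set.ncard_singleton] at h3
      have := hlt e he
      omega
    exact he (hI.subset (hX.mem_of_insert_indep heX h1))
  · refine Matroid.ext_indep rfl fun I hI => ?_
    rw [Matroid.restrict_ground_eq] at hI ⊢
    rw [Matroid.restrict_indep_iff, uniform_indep, piMatroid_indep, Set.inter_eq_left.2 hI,
      (Set.disjoint_compl_right_iff_subset.2 hI).inter_eq]
    simp [hI]
  · refine Matroid.ext_indep rfl fun J hJ => ?_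
    obtain ⟨I, hI⟩ := (RelaxValuative.piMatroid r k F).toMatroid.exists_isBasis F (hg F)
    have hJF : Disjoint F J := (Set.subset_sdiff.1 hJ).2.symm
    rw [hI.contract_indep_iff, and_iff_left hJF, uniform_indep, and_iff_right hJ,
      piMatroid_indep, Set.union_inter_distrib_right, Set.union_inter_distrib_right,
      hJF.symm.inter_eq, Set.inter_eq_left.2 hI.subset,
      (Set.disjoint_compl_right_iff_subset.2 hI.subset).inter_eq, Set.union_empty,
      Set.empty_union, hbasis I hI, Set.inter_eq_left.2 (Set.subset_compl_iff_disjoint_left.2 hJF)]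
    simp

variable {Γ : Type} [Group Γ] [MulAction Γ E]

theorem IsInvariant.relax {M : MatroidOn E} (hM : IsInvariant Γ M) {𝓕 : Set (Set E)}
    (h𝓕 : ∀ F ∈ 𝓕, IsStressedFlat M F) (hΓ : ∀ (γ : Γ), ∀ F ∈ 𝓕, γ • F ∈ 𝓕) :
    IsInvariant Γ (relax M 𝓕 h𝓕) := by
  rintro γ B (hB | ⟨F, hF, hB⟩)
  · exact Or.inl (hM γ B hB)
  · exact Or.inr ⟨γ • F, hΓ γ F hF, hM.smul_mem_cusp γ hB⟩

theorem isInvariant_piMatroid (r k : ℕ) (F : Set E) :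
    IsInvariant (MulAction.stabilizer Γ F) (piMatroid r k F) := by
  refine isInvariant_of_indep fun γ I hI => ?_
  have hγ : γ • F = F := γ.2
  have hγc : γ • Fᶜ = Fᶜ := by rw [Set.smul_set_compl, hγ]
  rw [piMatroid_indep] at hI ⊢
  have h1 : γ • I ∩ Fᶜ = γ • (I ∩ Fᶜ) := by rw [Set.smul_set_inter, hγc]
  have h2 : γ • I ∩ F = γ • (I ∩ F) := by rw [Set.smul_set_inter, hγ]
  rwa [h1, h2, Set.ncard_smul_set, Set.ncard_smul_set]

theorem isInvariant_lambdaMatroid {r k : ℕ} {F : Set E}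
    (hF : IsStressedFlat (piMatroid r k F) F) :
    IsInvariant (MulAction.stabilizer Γ F) (lambdaMatroid r k F hF) :=
  (isInvariant_piMatroid r k F).relax _ (by
    rintro γ _ rfl
    exact γ.2)

/-- The relaxation of a `Γ`-invariant matroid `M` with respect to all the translates `γF` of a
stressed flat `F`. -/
def relaxOrbit {M : MatroidOn E} (hM : IsInvariant Γ M) {F : Set E}
    (hF : IsStressedFlat M F) : MatroidOn E :=
  relax M (MulAction.orbit Γ F) (by rintro _ ⟨γ, rfl⟩; exact hF.smul hM γ)

theorem isInvariant_relaxOrbit {M : MatroidOn E} (hM : IsInvariant Γ M) {F : Set E}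
    (hF : IsStressedFlat M F) : IsInvariant Γ (relaxOrbit hM hF) :=
  hM.relax _ (by
    rintro γ _ ⟨δ, rfl⟩
    exact ⟨γ * δ, mul_smul γ δ F⟩)

end relaxation

/-! ### Base polytopes and categories of matroids -/

section categories

/-- The base polytope of `M`: the convex hull in `ℝ^E` of the vectors `v_B`, `B` a basis. -/
def basePolytope {E : Type} (M : MatroidOn E) : Set (E → ℝ) :=
  convexHull ℝ {v | ∃ B, M.toMatroid.IsBase B ∧ v = B.indicator 1}

/-- The linear map `ℝ^E → ℝ^E'` induced by a bijection `φ : E → E'`; it sends the basis vector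
`v_e` to `v_{φ(e)}`. -/
def permute {E E' : Type} (φ : E ≃ E') : (E → ℝ) →ₗ[ℝ] (E' → ℝ) :=
  LinearMap.funLeft ℝ ℝ φ.symm

/-- The objects of the category `𝓜` of matroids: finite sets with a matroid on them. -/
structure MatroidCat : Type 1 where
  carrier : Type
  [finite : Finite carrier]
  matroid : MatroidOn carrier

attribute [instance] MatroidCat.finite

namespace MatroidCat

/-- The morphisms of `𝓜` (weak maps): bijections `φ` with `P(M') ⊆ φ(P(M))`. -/
@[ext]
structure Hom (M M' : MatroidCat) where
  toEquiv : M.carrier ≃ M'.carrier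
  subset : basePolytope M'.matroid ⊆ permute toEquiv '' basePolytope M.matroid

instance : Category MatroidCat where
  Hom := Hom
  id M := ⟨Equiv.refl _, fun x hx => ⟨x, hx, rfl⟩⟩
  comp f g := ⟨f.toEquiv.trans g.toEquiv, fun x hx => by
    obtain ⟨y, hy, rfl⟩ := g.subset hx
    obtain ⟨z, hz, rfl⟩ := f.subset hy
    exact ⟨z, hz, rfl⟩⟩

end MatroidCat

/-- The objects of the category `𝓜_id(E)`: matroids on `E`. -/
structure MatroidId (E : Type) : Type 1 where
  matroid : MatroidOn E

/-- In `𝓜_id(E)` there is exactly one morphism `M → M'` if `P(M') ⊆ P(M)`, and none otherwise. -/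
instance {E : Type} : Category (MatroidId E) where
  Hom M M' := PLift (basePolytope M'.matroid ⊆ basePolytope M.matroid)
  id _ := ⟨subset_rfl⟩
  comp f g := ⟨g.down.trans f.down⟩

/-- The inclusion of `𝓜_id(E)` in `𝓜`. -/
def MatroidId.inclusion (E : Type) [Finite E] : MatroidId E ⥤ MatroidCat where
  obj M := ⟨E, M.matroid⟩
  map f := ⟨Equiv.refl E, fun x hx => ⟨x, f.down hx, rfl⟩⟩

variable {E Γ : Type} [Group Γ] [MulAction Γ E]

theorem IsInvariant.subset_permute {M : MatroidOn E} (hM : IsInvariant Γ M) (γ : Γ) :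
    basePolytope M ⊆ permute (MulAction.toPerm γ) '' basePolytope M := by
  rw [basePolytope, LinearMap.image_convexHull]
  refine convexHull_mono ?_
  rintro _ ⟨B, hB, rfl⟩
  refine ⟨(γ⁻¹ • B).indicator 1, ⟨γ⁻¹ • B, hM γ⁻¹ B hB, rfl⟩, ?_⟩
  funext x
  change (γ⁻¹ • B).indicator 1 (γ⁻¹ • x) = B.indicator 1 x
  by_cases hx : x ∈ B
  · rw [Set.indicator_of_mem hx, Set.indicator_of_mem (Set.smul_mem_smul_set hx)]
    rfl
  · rw [Set.indicator_of_notMem hx, Set.indicator_of_notMem]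
    rwa [Set.smul_mem_smul_set_iff]

variable [Finite E]

/-- The automorphism of `(E, M)` in `𝓜` given by a group element preserving `M`. -/
def IsInvariant.aut {M : MatroidOn E} (hM : IsInvariant Γ M) (γ : Γ) :
    MatroidCat.mk E M ⟶ MatroidCat.mk E M :=
  ⟨MulAction.toPerm γ, hM.subset_permute γ⟩

theorem IsInvariant.aut_one {M : MatroidOn E} (hM : IsInvariant Γ M) :
    hM.aut 1 = 𝟙 (MatroidCat.mk E M) :=
  MatroidCat.Hom.ext (Equiv.ext fun x => one_smul Γ x)

theorem IsInvariant.aut_mul {M : MatroidOn E} (hM : IsInvariant Γ M) (γ δ : Γ) :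
    hM.aut (γ * δ) = hM.aut δ ≫ hM.aut γ :=
  MatroidCat.Hom.ext (Equiv.ext fun x => mul_smul γ δ x)

end categories

/-! ### Decompositions -/

section decompositions

variable {E : Type} [Finite E]

/-- A decomposition of a polyhedron `P`: a collection of polyhedra that contains the nonempty
faces of its members, such that any two members meet in a (possibly empty) common face, and whose
union is `P`.  The nonempty faces of a polyhedron `Q` are the loci where linear functionals
attain their maximum on `Q`, as expressed by `IsExposed ℝ Q`. -/
structure IsPolyhedralDecomposition (𝒬 : Set (Set (E → ℝ))) (P : Set (E → ℝ)) : Prop where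
  face_mem : ∀ Q ∈ 𝒬, ∀ R : Set (E → ℝ), R.Nonempty → IsExposed ℝ Q R → R ∈ 𝒬
  inter_face : ∀ Q ∈ 𝒬, ∀ R ∈ 𝒬, IsExposed ℝ Q (Q ∩ R) ∧ IsExposed ℝ R (Q ∩ R)
  cover : P = ⋃₀ 𝒬

/-- A decomposition of a matroid `M`: a collection of matroids whose base polytopes decompose the
base polytope of `M`. -/
def IsDecomposition (𝒩 : Set (MatroidOn E)) (M : MatroidOn E) : Prop :=
  IsPolyhedralDecomposition (basePolytope '' 𝒩) (basePolytope M)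

/-- The dimension of a polytope. -/
def dimension (P : Set (E → ℝ)) : ℕ := finrank ℝ (vectorSpan ℝ P)

/-- The set `𝒩_k`.  For `k ≤ d = dim P(M)` it consists of the internal faces `N ∈ 𝒩` (those with
`P(N)` not contained in the boundary of `P(M)`) of dimension `k`, and `𝒩_{d+1} = {M}`. -/
def cells (𝒩 : Set (MatroidOn E)) (M : MatroidOn E) (k : ℕ) : Set (MatroidOn E) :=
  {N | (N ∈ 𝒩 ∧ ¬ basePolytope N ⊆ intrinsicFrontier ℝ (basePolytope M) ∧
    dimension (basePolytope N) = k) ∨ (N = M ∧ k = dimension (basePolytope M) + 1)}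

/-- The top exterior power of a subspace `W` of `ℝ^E`, as a line in the exterior algebra
of `ℝ^E`. -/
def topPower (W : Submodule ℝ (E → ℝ)) : Submodule ℝ (ExteriorAlgebra ℝ (E → ℝ)) :=
  (⋀[ℝ]^(finrank ℝ W) W).map (ExteriorAlgebra.map W.subtype).toLinearMap

/-- An orientation of a polytope `P`: a ray in the top exterior power of the span of the
differences `x - y`, `x, y ∈ P`. -/
abbrev PolytopeOrientation (P : Set (E → ℝ)) : Type := Module.Ray ℝ (topPower (vectorSpan ℝ P))

/-- For polytopes `Q ⊆ P` of the same dimension: the orientation of `Q` is the restriction of the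
orientation of `P`. -/
def OrientationsAgree {P Q : Set (E → ℝ)} (oP : PolytopeOrientation P)
    (oQ : PolytopeOrientation Q) : Prop :=
  ∃ (p : topPower (vectorSpan ℝ P)) (q : topPower (vectorSpan ℝ Q)) (hp : p ≠ 0) (hq : q ≠ 0),
    rayOfNeZero ℝ p hp = oP ∧ rayOfNeZero ℝ q hq = oQ ∧
      (p : ExteriorAlgebra ℝ (E → ℝ)) = (q : ExteriorAlgebra ℝ (E → ℝ))

/-- `ν` is an outward normal vector to the facet `Q` of `P`: it is parallel to `P`, and the
functional `x ↦ ⟨ν, x⟩` attains its maximum on `P` at all points of `Q`. -/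
def IsOutwardNormal (P Q : Set (E → ℝ)) (ν : E → ℝ) : Prop :=
  ν ∈ vectorSpan ℝ P ∧ ν ≠ 0 ∧ ∀ x ∈ Q, ∀ y ∈ P, ∑ᶠ e, ν e * y e ≤ ∑ᶠ e, ν e * x e

/-- For a facet `Q` of `P`: the orientation of `Q` is the one induced by the orientation of `P`
by contraction with an outward normal vector, that is, `ω` is positive on `Q` if and only if
`ν ∧ ω` is positive on `P`. -/
def OrientationsMatch {P Q : Set (E → ℝ)} (oP : PolytopeOrientation P)
    (oQ : PolytopeOrientation Q) : Prop :=
  ∃ (ν : E → ℝ) (p : topPower (vectorSpan ℝ P)) (q : topPower (vectorSpan ℝ Q))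
    (hp : p ≠ 0) (hq : q ≠ 0), IsOutwardNormal P Q ν ∧
    rayOfNeZero ℝ p hp = oP ∧ rayOfNeZero ℝ q hq = oQ ∧
      (p : ExteriorAlgebra ℝ (E → ℝ)) = ExteriorAlgebra.ι ℝ ν * q

/-- An orientation of a decomposition of `M`: an arbitrary choice of an orientation for each face
of the decomposition, and one for `M` itself.  (Only the values of `face` on the members of the
decomposition play a role.) -/
structure DecompositionOrientation (M : MatroidOn E) where
  face : ∀ N : MatroidOn E, PolytopeOrientation (basePolytope N)
  total : PolytopeOrientation (basePolytope M)

/-- The `ℚ`-linear additive closure `𝓜_id⁺(E)`. -/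
abbrev MatroidIdPlus (E : Type) := Mat_ (Free ℚ (MatroidId E))

instance finite_matroidOn : Finite (MatroidOn E) := by
  refine Finite.of_injective (fun M : MatroidOn E => {B | M.toMatroid.IsBase B}) ?_
  rintro ⟨M, hM⟩ ⟨N, hN⟩ h
  have : M = N := Matroid.ext_isBase (hM.trans hN.symm) fun B _ => Set.ext_iff.1 h B
  subst this
  rfl

instance finite_cells (𝒩 : Set (MatroidOn E)) (M : MatroidOn E) (k : ℕ) :
    Fintype (cells 𝒩 M k) :=
  Fintype.ofFinite _

/-- The term `C_k` of the complex of a decomposition: the formal direct sum of the members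
of `𝒩_k`. -/
def chainObj (𝒩 : Set (MatroidOn E)) (M : MatroidOn E) (k : ℕ) : MatroidIdPlus E where
  ι := cells 𝒩 M k
  X N := Free.of ℚ (MatroidId.mk N.1)

open Classical in
/-- The component from `X ∈ 𝒩_{k+1}` to `Y ∈ 𝒩_k` of the differential.  It is a multiple of the
morphism `ι_{X,Y}`.  If `k = dim P(M)` (so that `X = M`), the coefficient is `1` or `-1` depending
on whether the orientations of `X` and `Y` agree; otherwise it is `1` or `-1` if `Y` is a facet
of `X`, depending on whether the orientations match, and `0` if `Y` is not a facet of `X`. -/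
def incidence {M : MatroidOn E} (Ω : DecompositionOrientation M) (k : ℕ) (X Y : MatroidOn E) :
    Free.of ℚ (MatroidId.mk X) ⟶ Free.of ℚ (MatroidId.mk Y) :=
  if h : basePolytope Y ⊆ basePolytope X then
    (if k = dimension (basePolytope M) then
      (if OrientationsAgree Ω.total (Ω.face Y) then 1 else -1)
    else if IsExposed ℝ (basePolytope X) (basePolytope Y) then
      (if OrientationsMatch (Ω.face X) (Ω.face Y) then 1 else -1)
    else 0 : ℚ) • (Free.embedding ℚ (MatroidId E)).map
      (X := MatroidId.mk X) (Y := MatroidId.mk Y) ⟨h⟩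
  else 0

/-- The differential `C_{k+1} → C_k` of the complex of a decomposition. -/
def differential (𝒩 : Set (MatroidOn E)) {M : MatroidOn E} (Ω : DecompositionOrientation M)
    (k : ℕ) : chainObj 𝒩 M (k + 1) ⟶ chainObj 𝒩 M k :=
  fun X Y => incidence Ω k X.1 Y.1

end decompositions

/-! ### Valuative functors -/

section valuative

/-- The `ℚ`-linear additive extension `𝓒⁺ ⥤ 𝓓` of a functor `𝓒 ⥤ 𝓓`. -/
def additiveExtension {C D : Type 1} [Category.{0} C] [Category.{0} D] [Preadditive D]
    [Linear ℚ D] [HasFiniteBiproducts D] (F : C ⥤ D) : Mat_ (Free ℚ C) ⥤ D :=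
  Mat_.lift (Free.lift ℚ F)

/-- A complex `⋯ → X 1 → X 0 → 0` is contractible: its identity map is homotopic to zero, that is,
it admits a contracting homotopy. -/
def IsContractible {D : Type 1} [Category.{0} D] [Preadditive D] (X : ℕ → D)
    (d : ∀ k, X (k + 1) ⟶ X k) : Prop :=
  ∃ h : ∀ k, X k ⟶ X (k + 1), h 0 ≫ d 0 = 𝟙 (X 0) ∧
    ∀ k, d k ≫ h k + h (k + 1) ≫ d (k + 1) = 𝟙 (X (k + 1))

/-- A functor on `𝓜` is valuative if, for every oriented decomposition of a matroid, it sends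
(the additive extension of its restriction to `𝓜_id(E)` sends) the complex of the decomposition
to a contractible complex. -/
def IsValuative {D : Type 1} [Category.{0} D] [Preadditive D] [Linear ℚ D]
    [HasFiniteBiproducts D] (Φ : MatroidCat ⥤ D) : Prop :=
  ∀ (E : Type) [Finite E] (M : MatroidOn E) (𝒩 : Set (MatroidOn E))
    (Ω : DecompositionOrientation M), IsDecomposition 𝒩 M →
    IsContractible
      (fun k => (additiveExtension (MatroidId.inclusion E ⋙ Φ)).obj (chainObj 𝒩 M k))
      (fun k => (additiveExtension (MatroidId.inclusion E ⋙ Φ)).map (differential 𝒩 Ω k))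

end valuative

/-! ### Graded vector spaces and virtual representations -/

section graded

instance gradedPreadditive {A : Type} {C : Type*} [Category C] [Preadditive C] :
    Preadditive (GradedObject A C) where
  homGroup X Y := inferInstanceAs (AddCommGroup (∀ a, X a ⟶ Y a))
  add_comp _ _ _ _ _ _ := by
    funext a
    exact Preadditive.add_comp _ _ _ _ _ _
  comp_add _ _ _ _ _ _ := by
    funext a
    exact Preadditive.comp_add _ _ _ _ _ _

instance gradedLinear {A : Type} {R : Type*} [Semiring R] {C : Type*} [Category C]
    [Preadditive C] [Linear R C] : Linear R (GradedObject A C) where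
  homModule X Y := inferInstanceAs (Module R (∀ a, X a ⟶ Y a))
  smul_comp _ _ _ _ _ _ := by
    funext a
    exact Linear.smul_comp _ _ _ _ _ _
  comp_smul _ _ _ _ _ _ := by
    funext a
    exact Linear.comp_smul _ _ _ _ _ _

/-- Finite-dimensionality of an `A`-graded vector space. -/
def FinDimGraded {A : Type} : ObjectProperty (GradedObject A (ModuleCat.{0} ℚ)) := fun X =>
  (∀ a, Module.Finite ℚ (X a)) ∧ {a | Nontrivial (X a)}.Finite

/-- The category of finite-dimensional `A`-graded rational vector spaces. -/
abbrev GrVect (A : Type) := (FinDimGraded (A := A)).FullSubcategory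

/-- Finite-dimensionality of an `A`-graded representation. -/
def FinDimGradedRep {A : Type} {Γ : Type} [Group Γ] :
    ObjectProperty (GradedObject A (Rep.{0} ℚ Γ)) := fun X =>
  (∀ a, Module.Finite ℚ (X a)) ∧ {a | Nontrivial (X a)}.Finite

/-- The category of finite-dimensional `A`-graded rational representations of `Γ`. -/
abbrev GrRep (A : Type) (Γ : Type) [Group Γ] :=
  (FinDimGradedRep (A := A) (Γ := Γ)).FullSubcategory

/-- The subgroup of the free abelian group on the objects of an additive category that is generated
by the elements `[X ⊕ Y] - [X] - [Y]`, where `X ⊕ Y` runs over all the biproducts of `X` and `Y`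
(so that isomorphic objects get the same class). -/
def splitRelations (C : Type*) [Category C] [HasZeroMorphisms C] :
    AddSubgroup (FreeAbelianGroup C) :=
  AddSubgroup.closure {x | ∃ (X Y : C) (b : BinaryBicone X Y), Nonempty b.IsBilimit ∧
    x = FreeAbelianGroup.of b.pt - FreeAbelianGroup.of X - FreeAbelianGroup.of Y}

/-- The split Grothendieck group of an additive category. -/
abbrev SplitK₀ (C : Type*) [Category C] [HasZeroMorphisms C] :=
  FreeAbelianGroup C ⧸ splitRelations C

/-- The class of an object in the Grothendieck group. -/
def SplitK₀.mk {C : Type*} [Category C] [HasZeroMorphisms C] (X : C) : SplitK₀ C :=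
  QuotientAddGroup.mk (FreeAbelianGroup.of X)

/-- Virtual graded representations of a finite group `Γ`: the Grothendieck group of the category of
finite-dimensional graded rational representations of `Γ`.  (All the short exact sequences in this
category split.) -/
abbrev VirtualGrRep (A : Type) (Γ : Type) [Group Γ] := SplitK₀ (GrRep A Γ)

instance {A : Type} : HasFiniteBiproducts (GrVect A) where
  out n := ⟨fun f => by
    classical
    let P : GrVect A := ⟨fun a => ModuleCat.of ℚ (∀ j, (f j).obj a), fun a => by
        have := fun j => (f j).property.1 a
        exact inferInstanceAs (Module.Finite ℚ (∀ j, (f j).obj a)), by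
        refine (Set.finite_iUnion fun j => (f j).property.2).subset ?_
        intro a ha
        by_contra hcon
        have h1 : ∀ j, Subsingleton ((f j).obj a) := by
          intro j
          rw [← not_nontrivial_iff_subsingleton]
          intro h
          exact hcon (Set.mem_iUnion.2 ⟨j, h⟩)
        have h2 : Subsingleton (∀ j, (f j).obj a) := inferInstance
        have h3 : Nontrivial (∀ j, (f j).obj a) := ha
        exact not_subsingleton _ h2⟩
    refine hasBiproduct_of_total
      { pt := P
        π := fun j => ObjectProperty.homMk fun a => ModuleCat.ofHom (LinearMap.proj (φ := fun i => ((f i).obj a : Type)) j)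
        ι := fun j => ObjectProperty.homMk fun a => ModuleCat.ofHom (LinearMap.single ℚ (fun i => ((f i).obj a : Type)) j)
        ι_π := ?_ } ?_
    · intro i j
      apply ObjectProperty.hom_ext
      funext a
      apply ModuleCat.hom_ext
      apply LinearMap.ext
      intro x
      by_cases h : i = j
      · subst h
        simp only [dif_pos]
        exact Pi.single_eq_same (M := fun i => ((f i).obj a : Type)) i x
      · simp only [dif_neg h]
        exact Pi.single_eq_of_ne (M := fun i => ((f i).obj a : Type)) (Ne.symm h) x
    · have key : ∀ (a : A) (x : ∀ i, ((f i).obj a : Type)),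
          (∑ j, Pi.single j (x j) : ∀ i, ((f i).obj a : Type)) = x := fun a x =>
        Finset.univ_sum_single x
      let ev (a : A) : (P ⟶ P) →+ (∀ i, ((f i).obj a : Type)) →ₗ[ℚ] (∀ i, ((f i).obj a : Type)) :=
        { toFun := fun g => (g.hom a).hom
          map_zero' := rfl
          map_add' := fun _ _ => rfl }
      apply ObjectProperty.hom_ext
      funext a
      apply ModuleCat.hom_ext
      change ev a _ = LinearMap.id
      rw [map_sum]
      apply LinearMap.ext
      intro x
      rw [LinearMap.sum_apply]
      exact key a x⟩


theorem finite_indV {Γ : Type} [Group Γ] [Finite Γ] (H : Subgroup Γ) (X : Rep.{0} ℚ H)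
    [Module.Finite ℚ X] : Module.Finite ℚ (Rep.ind H.subtype X) := by
  have h1 : Module.Finite ℚ (MonoidAlgebra ℚ Γ) :=
    Module.Finite.equiv (MonoidAlgebra.coeffLinearEquiv ℚ : MonoidAlgebra ℚ Γ ≃ₗ[ℚ] _).symm
  exact Module.Finite.of_surjective
    (Representation.Coinvariants.mk (Representation.tprod
      ((Representation.leftRegular ℚ Γ).comp H.subtype) X.ρ))
    (Representation.Coinvariants.mk_surjective _)

theorem subsingleton_indV {Γ : Type} [Group Γ] (H : Subgroup Γ) (X : Rep.{0} ℚ H)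
    [Subsingleton X] : Subsingleton (Rep.ind H.subtype X) := by
  have : Subsingleton (TensorProduct ℚ (MonoidAlgebra ℚ Γ) X) := inferInstance
  exact (Representation.Coinvariants.mk_surjective (Representation.tprod
      ((Representation.leftRegular ℚ Γ).comp H.subtype) X.ρ)).subsingleton

/-- Induction of graded representations, degree by degree. -/
def indGr {A : Type} {Γ : Type} [Group Γ] [Finite Γ] (H : Subgroup Γ) (X : GrRep A H) :
    GrRep A Γ :=
  ⟨fun a => Rep.ind H.subtype (X.obj a),
    fun a => by
      have := X.property.1 a
      exact finite_indV H (X.obj a),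
    by
      refine X.property.2.subset fun a ha => ?_
      by_contra hcon
      have h1 : Subsingleton (X.obj a) := not_nontrivial_iff_subsingleton.1 hcon
      have h2 := subsingleton_indV H (X.obj a)
      have h3 : Nontrivial (Rep.ind H.subtype (X.obj a)) := ha
      exact not_subsingleton _ h2⟩

/-- If a group `G` acts on `E` preserving the matroid `N`, then `Φ(N)` is a graded representation
of `G`. -/
def repOf {A : Type} {E G : Type} [Finite E] [Group G] [MulAction G E]
    (Φ : MatroidCat ⥤ GrVect A) {N : MatroidOn E} (hN : IsInvariant G N) : GrRep A G :=
  ⟨fun a => Rep.of (X := ((Φ.obj ⟨E, N⟩).obj a : Type))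
    { toFun := fun γ => ((Φ.map (hN.aut γ)).hom a).hom
      map_one' := by
        rw [hN.aut_one, Φ.map_id]
        rfl
      map_mul' := fun γ δ => by
        rw [hN.aut_mul, Φ.map_comp]
        rfl },
    (Φ.obj ⟨E, N⟩).property⟩

end graded

end RelaxValuative

end

open CategoryTheory CategoryTheory.Limits Module
open scoped Pointwise

noncomputable section

namespace RelaxValuative

/-! ### Convex sets cut by a hyperplane, and faces of polytopes. -/

section convex

variable {V : Type*} [NormedAddCommGroup V] [NormedSpace ℝ V]

/-! Relaxing at one stressed flat F of rank r cuts a polytope in two. If N' relaxes N at F, the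
hyperplane on which the coordinates in F sum to r divides the polytope of N' into those of N (sum at
most r) and of Λ (sum at least r), and these meet in the polytope of Π. The faces of the two halves
decompose N', and the only ones outside the boundary are N, Λ and Π. A valuative functor therefore
turns Φ(N') → Φ(N) ⊕ Φ(Λ) → Φ(Π) into a contractible complex, that is, a short exact sequence. It is
recorded as a bicartesian square (`IsSplitRelaxation.isBicartesian`), a form from which the
orientation signs have disappeared. If the hyperplane has vertices of N' on one side only, two
parallel sides of the square are identities (`IsRelaxationSquare.isBicartesian`).

Distinct stressed flats have disjoint cusps (`IsStressedFlat.eq_of_cusp`), so the flats of the orbit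
can be relaxed one at a time, each step giving such a square. The intermediate matroids need not be
Γ-invariant, so the induction cannot run on classes of representations. Instead the squares of
vector spaces are pasted (`iterated_relaxation`) into one bicartesian square with corners Φ(M̃),
Φ(M), ∏ Φ(Λ_i) and ∏ Φ(Π_i), where i runs over the orbit.

All maps of this square come from the identity of E, so it is Γ-equivariant, with Γ permuting the
factors of the products. A product over a transitive Γ-set is induced from a stabilizer
(`EquivariantFamily.exists_indV_equiv`). Averaging over Γ then splits the exact sequence Φ(M̃) →
Φ(M) × Ind Φ(Λ) → Ind Φ(Π), which is the asserted relation (`mk_add_mk_of_isBicartesian`). -/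

theorem exists_extend_of_mem_intrinsicInterior {S : Set V} {x y : V}
    (hx : x ∈ intrinsicInterior ℝ S) (hy : y ∈ S) : ∃ ε : ℝ, 0 < ε ∧ x - ε • (y - x) ∈ S := by
  obtain ⟨x', hx', rfl⟩ := hx
  let y' : affineSpan ℝ S := ⟨y, subset_affineSpan ℝ S hy⟩
  have : Nonempty (affineSpan ℝ S) := ⟨y'⟩
  have hc : Continuous fun t : ℝ => (AffineMap.lineMap x' y' t : affineSpan ℝ S) :=
    AffineMap.lineMap_continuous
  have h0 : (fun t : ℝ => (AffineMap.lineMap x' y' t : affineSpan ℝ S)) ⁻¹'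
      (interior (Subtype.val ⁻¹' S)) ∈ nhds (0 : ℝ) :=
    (isOpen_interior.preimage hc).mem_nhds (by simpa using hx')
  obtain ⟨ε, hε, hball⟩ := Metric.mem_nhds_iff.1 h0
  refine ⟨ε / 2, by positivity, ?_⟩
  have h1 : -(ε / 2) ∈ Metric.ball (0 : ℝ) ε := by
    rw [Metric.mem_ball, Real.dist_eq, sub_zero, abs_neg, abs_of_pos (by positivity)]
    linarith
  have h2 : ((AffineMap.lineMap x' y' (-(ε / 2)) : affineSpan ℝ S) : V) ∈ S :=
    interior_subset (s := Subtype.val ⁻¹' S) (hball h1)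
  have h3 : ((AffineMap.lineMap x' y' (-(ε / 2)) : affineSpan ℝ S) : V)
      = (x' : V) - (ε / 2) • (y - x') := by
    rw [AffineMap.lineMap_apply, AffineSubspace.coe_vadd, Submodule.coe_smul,
      AffineSubspace.coe_vsub, vadd_eq_add, vsub_eq_sub, neg_smul]
    abel
  rwa [h3] at h2

/-- The homothety with centre `y` and ratio `1 - t` is an open map of the affine span that carries
`S` into itself, so it preserves the relative interior. -/
theorem lineMap_mem_intrinsicInterior {S : Set V} (hS : Convex ℝ S) {x y : V}
    (hx : x ∈ intrinsicInterior ℝ S) (hy : y ∈ S) {t : ℝ} (h0 : 0 ≤ t) (h1 : t < 1) :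
    (1 - t) • x + t • y ∈ intrinsicInterior ℝ S := by
  obtain ⟨x', hx', rfl⟩ := hx
  let y' : affineSpan ℝ S := ⟨y, subset_affineSpan ℝ S hy⟩
  have : Nonempty (affineSpan ℝ S) := ⟨y'⟩
  have hcoe : ∀ z : affineSpan ℝ S, ((AffineMap.homothety y' (1 - t) z : affineSpan ℝ S) : V)
      = (1 - t) • (z : V) + t • y := by
    intro z
    rw [AffineMap.homothety_apply, AffineSubspace.coe_vadd, Submodule.coe_smul,
      AffineSubspace.coe_vsub, vadd_eq_add, vsub_eq_sub, smul_sub, sub_smul, sub_smul]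
    simp only [one_smul, y']
    abel
  refine ⟨AffineMap.homothety y' (1 - t) x', ?_, hcoe x'⟩
  have hop : IsOpen (AffineMap.homothety y' (1 - t) '' interior (Subtype.val ⁻¹' S)) :=
    AffineMap.homothety_isOpenMap y' (1 - t) (by linarith) _ isOpen_interior
  refine interior_maximal ?_ hop ⟨x', hx', rfl⟩
  rintro _ ⟨z, hz, rfl⟩
  rw [Set.mem_preimage, hcoe]
  exact hS (interior_subset (s := Subtype.val ⁻¹' S) hz) hy (by linarith) h0 (by ring)

/-- If `l₁` cuts out `B` and `l₂` cuts out `C` in `B`, a large multiple of `l₁` plus `l₂` cuts out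
`C`. Finiteness of `s` is what bounds the multiple needed; for general convex sets exposed faces are
not transitive. -/
theorem isExposed_trans_of_finite {s : Set V} (hs : s.Finite) {B C : Set V}
    (hB : IsExposed ℝ (convexHull ℝ s) B) (hC : IsExposed ℝ B C) :
    IsExposed ℝ (convexHull ℝ s) C := by
  intro hne
  obtain ⟨x₀, hx₀⟩ := hne
  have hx₀B := hC.subset hx₀
  obtain ⟨l₂, hl₂⟩ := hC ⟨x₀, hx₀⟩
  obtain ⟨l₁, hl₁⟩ := hB ⟨x₀, hx₀B⟩
  have hx₀A := hB.subset hx₀B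
  have hm₁ : ∀ y ∈ convexHull ℝ s, l₁ y ≤ l₁ x₀ := by
    have := hx₀B; rw [hl₁] at this; exact this.2
  have hm₂ : ∀ y ∈ B, l₂ y ≤ l₂ x₀ := by
    have := hx₀; rw [hl₂] at this; exact this.2
  -- `K` bounds the finitely many slopes at which a vertex off `B` could gain more in `l₂` than it
  -- loses in `l₁`. Vertices on `B` contribute the junk value of a division by zero, which is
  -- harmless as they are treated separately.
  obtain ⟨K, hK⟩ := (hs.image fun v => (l₂ v - l₂ x₀) / (l₁ x₀ - l₁ v)).bddAbove
  have hBmem : ∀ y ∈ convexHull ℝ s, l₁ x₀ ≤ l₁ y → y ∈ B := by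
    intro y hy h
    rw [hl₁]
    exact ⟨hy, fun z hz => (hm₁ z hz).trans h⟩
  have hKs : ∀ v ∈ convexHull ℝ s, K * l₁ v + l₂ v ≤ K * l₁ x₀ + l₂ x₀ := by
    intro v hv
    have hconv : Convex ℝ {v | (K • l₁ + l₂) v ≤ K * l₁ x₀ + l₂ x₀} :=
      convex_halfSpace_le (K • l₁ + l₂).isLinear _
    refine convexHull_min (s := s) ?_ hconv hv
    intro v hv
    have hvA := subset_convexHull ℝ s hv
    change K * l₁ v + l₂ v ≤ _
    rcases (hm₁ v hvA).lt_or_eq with h | h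
    · have h1 := hK ⟨v, hv, rfl⟩
      rw [div_le_iff₀ (by linarith)] at h1
      linarith
    · have := hm₂ v (hBmem v hvA h.ge)
      rw [h]; linarith
  -- With `K` alone a maximum may also be attained off `B`; the extra `l₁` forces every maximiser
  -- into `B`.
  refine ⟨(K + 1) • l₁ + l₂, ?_⟩
  ext x
  constructor
  · intro hx
    have hxB := hC.subset hx
    refine ⟨hB.subset hxB, fun y hy => ?_⟩
    have h1 : l₁ x₀ ≤ l₁ x := by rw [hl₁] at hxB; exact hxB.2 x₀ hx₀A
    have h2 : l₂ x₀ ≤ l₂ x := by rw [hl₂] at hx; exact hx.2 x₀ hx₀B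
    have h3 := hKs y hy
    have h4 := hm₁ y hy
    have h5 := hm₁ x (hB.subset hxB)
    have h6 : l₁ x = l₁ x₀ := le_antisymm h5 h1
    change (K + 1) * l₁ y + l₂ y ≤ (K + 1) * l₁ x + l₂ x
    rw [h6]
    linarith
  · rintro ⟨hxA, hx⟩
    have h1 : (K + 1) * l₁ x₀ + l₂ x₀ ≤ (K + 1) * l₁ x + l₂ x := hx x₀ hx₀A
    have h2 := hKs x hxA
    have h3 : l₁ x₀ ≤ l₁ x := by linarith
    have h4 := hm₁ x hxA
    have hxB := hBmem x hxA h3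
    rw [hl₂]
    refine ⟨hxB, fun y hy => (hm₂ y hy).trans ?_⟩
    have : l₁ x = l₁ x₀ := le_antisymm h4 h3
    rw [this] at h1
    linarith

/-- Krein–Milman: extreme points of a face are extreme in the whole polytope, hence belong to `s`.
The closure is harmless because the hull of a finite set is closed. -/
theorem eq_convexHull_of_isExposed {s : Set V} (hs : s.Finite) {B : Set V}
    (hB : IsExposed ℝ (convexHull ℝ s) B) : B = convexHull ℝ (s ∩ B) := by
  refine subset_antisymm ?_
    (convexHull_min Set.inter_subset_right (hB.convex (convex_convexHull ℝ s)))
  have hc : IsCompact (convexHull ℝ s) := hs.isCompact_convexHull ℝ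
  have hBc := hB.isCompact hc
  have h1 : B.extremePoints ℝ ⊆ s ∩ B := fun x hx =>
    ⟨extremePoints_convexHull_subset (hB.isExtreme.extremePoints_subset_extremePoints hx), hx.1⟩
  have h2 : IsClosed (convexHull ℝ (s ∩ B)) :=
    ((hs.subset Set.inter_subset_left).isCompact_convexHull ℝ).isClosed
  have h3 := closure_convexHull_extremePoints hBc (hB.convex (convex_convexHull ℝ s))
  calc B = closure (convexHull ℝ (B.extremePoints ℝ)) := h3.symm
    _ ⊆ _ := h2.closure_subset_iff.2 (convexHull_mono h1)

variable {S : Set V} {ℓ : V →ₗ[ℝ] ℝ} {c : ℝ}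

/-- Start from any relative interior point and move towards `u` or `w` until the level is `c`. This
happens strictly before the end of the segment, so the point stays in the relative interior. -/
theorem exists_mem_intrinsicInterior_eq [FiniteDimensional ℝ V] (hS : Convex ℝ S)
    (hlow : ∃ u ∈ S, ℓ u < c) (hhigh : ∃ w ∈ S, c < ℓ w) :
    ∃ x ∈ intrinsicInterior ℝ S, ℓ x = c := by
  obtain ⟨u, hu, huc⟩ := hlow
  obtain ⟨w, hw, hwc⟩ := hhigh
  obtain ⟨x, hx⟩ := Set.Nonempty.intrinsicInterior hS ⟨u, hu⟩
  rcases lt_trichotomy (ℓ x) c with h | h | h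
  · refine ⟨_, lineMap_mem_intrinsicInterior hS hx hw (t := (c - ℓ x) / (ℓ w - ℓ x))
      (div_nonneg (by linarith) (by linarith)) ((div_lt_one (by linarith)).2 (by linarith)), ?_⟩
    have : ℓ w - ℓ x ≠ 0 := by linarith
    simp only [map_add, map_smul, smul_eq_mul]
    field_simp
    ring
  · exact ⟨x, hx, h⟩
  · refine ⟨_, lineMap_mem_intrinsicInterior hS hx hu (t := (ℓ x - c) / (ℓ x - ℓ u))
      (div_nonneg (by linarith) (by linarith)) ((div_lt_one (by linarith)).2 (by linarith)), ?_⟩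
    have : ℓ x - ℓ u ≠ 0 := by linarith
    simp only [map_add, map_smul, smul_eq_mul]
    field_simp
    ring

/-- A point `y` beyond the hyperplane can be replaced by a point of `S` slightly past `x` on the
opposite side, which spans the same direction from `x`. -/
theorem vectorSpan_inter_le {x : V} (hx : x ∈ intrinsicInterior ℝ S) (hxc : ℓ x = c) :
    vectorSpan ℝ (S ∩ {y | ℓ y ≤ c}) = vectorSpan ℝ S := by
  refine le_antisymm (vectorSpan_mono ℝ Set.inter_subset_left) ?_
  have hxS := intrinsicInterior_subset hx
  rw [vectorSpan_eq_span_vsub_set_right ℝ hxS, Submodule.span_le]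
  rintro _ ⟨y, hy, rfl⟩
  change y - x ∈ vectorSpan ℝ (S ∩ {y | ℓ y ≤ c})
  by_cases h : ℓ y ≤ c
  · exact vsub_mem_vectorSpan ℝ ⟨hy, h⟩ ⟨hxS, hxc.le⟩
  · obtain ⟨ε, hε, hmem⟩ := exists_extend_of_mem_intrinsicInterior hx hy
    have h1 : x - ε • (y - x) ∈ S ∩ {y | ℓ y ≤ c} := by
      refine ⟨hmem, ?_⟩
      change ℓ (x - ε • (y - x)) ≤ c
      rw [map_sub, map_smul, map_sub, smul_eq_mul, hxc]
      have : 0 ≤ ε * (ℓ y - c) := mul_nonneg hε.le (by linarith)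
      linarith
    have h2 : x - (x - ε • (y - x)) ∈ vectorSpan ℝ (S ∩ {y | ℓ y ≤ c}) :=
      vsub_mem_vectorSpan ℝ ⟨hxS, hxc.le⟩ h1
    rw [sub_sub_cancel] at h2
    have h3 := Submodule.smul_mem _ ε⁻¹ h2
    rwa [smul_smul, inv_mul_cancel₀ hε.ne', one_smul] at h3

/-- Modulo the directions of the slice, `w - x` generates all directions of `S`, and it is not
itself a direction of the slice because `ℓ` does not vanish on it. -/
theorem finrank_vectorSpan_inter_eq [FiniteDimensional ℝ V] (hS : Convex ℝ S) {x : V}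
    (hx : x ∈ intrinsicInterior ℝ S) (hxc : ℓ x = c) (hhigh : ∃ w ∈ S, c < ℓ w) :
    finrank ℝ (vectorSpan ℝ S) = finrank ℝ (vectorSpan ℝ (S ∩ {y | ℓ y = c})) + 1 := by
  obtain ⟨w, hw, hwc⟩ := hhigh
  have hxS := intrinsicInterior_subset hx
  set T := S ∩ {y | ℓ y = c} with hT
  have hxT : x ∈ T := ⟨hxS, hxc⟩
  have hlow : ∀ y ∈ S, ℓ y ≤ c → y - x ∈ vectorSpan ℝ T ⊔ Submodule.span ℝ {w - x} := by
    intro y hy hyc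
    have hd : ℓ w - ℓ y ≠ 0 := by linarith
    have hd1 : ℓ w - c ≠ 0 := by linarith
    -- The parameter at which the segment from `y` to `w` crosses level `c`.
    set t := (c - ℓ y) / (ℓ w - ℓ y) with ht
    have ht0 : 0 ≤ t := div_nonneg (by linarith) (by linarith)
    have ht1 : 0 < 1 - t := by
      have : t < 1 := (div_lt_one (by linarith)).2 (by linarith)
      linarith
    have hz : (1 - t) • y + t • w ∈ T := by
      refine ⟨hS hy hw ht1.le ht0 (by ring), ?_⟩
      change ℓ _ = c
      simp only [map_add, map_smul, smul_eq_mul, ht]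
      field_simp
      ring
    have h1 : (1 - t) • y + t • w - x ∈ vectorSpan ℝ T := vsub_mem_vectorSpan ℝ hz hxT
    have h2 : y - x = (1 - t)⁻¹ • (((1 - t) • y + t • w - x) - t • (w - x)) := by
      have : (1 - t) • y + t • w - x - t • (w - x) = (1 - t) • (y - x) := by
        module
      rw [this, smul_smul, inv_mul_cancel₀ ht1.ne', one_smul]
    rw [h2]
    refine Submodule.smul_mem _ _ (Submodule.sub_mem _ (Submodule.mem_sup_left h1) ?_)
    exact Submodule.smul_mem _ _ (Submodule.mem_sup_right (Submodule.mem_span_singleton_self _))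
  have hle : vectorSpan ℝ S ≤ vectorSpan ℝ T ⊔ Submodule.span ℝ {w - x} := by
    rw [vectorSpan_eq_span_vsub_set_right ℝ hxS, Submodule.span_le]
    rintro _ ⟨y, hy, rfl⟩
    change y - x ∈ vectorSpan ℝ T ⊔ Submodule.span ℝ {w - x}
    by_cases h : ℓ y ≤ c
    · exact hlow y hy h
    · obtain ⟨ε, hε, hmem⟩ := exists_extend_of_mem_intrinsicInterior hx hy
      have h1 := hlow _ hmem (by
        rw [map_sub, map_smul, map_sub, smul_eq_mul, hxc]
        have : 0 ≤ ε * (ℓ y - c) := mul_nonneg hε.le (by linarith)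
        linarith)
      have h2 : y - x = (-ε⁻¹) • (x - ε • (y - x) - x) := by
        rw [sub_sub_cancel_left, neg_smul_neg, smul_smul, inv_mul_cancel₀ hε.ne', one_smul]
      rw [h2]
      exact Submodule.smul_mem _ _ h1
  have hker : vectorSpan ℝ T ≤ LinearMap.ker ℓ := by
    rw [vectorSpan_eq_span_vsub_set_right ℝ hxT, Submodule.span_le]
    rintro _ ⟨y, hy, rfl⟩
    change ℓ (y - x) = 0
    rw [map_sub, hy.2, hxc, sub_self]
  have hlt : vectorSpan ℝ T < vectorSpan ℝ S := by
    refine lt_of_le_of_ne (vectorSpan_mono ℝ Set.inter_subset_left) fun h => ?_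
    have h1 : w - x ∈ vectorSpan ℝ T := by
      rw [h]; exact vsub_mem_vectorSpan ℝ hw hxS
    have h2 : ℓ (w - x) = 0 := hker h1
    rw [map_sub, hxc] at h2
    linarith
  have h1 := Submodule.finrank_lt_finrank_of_lt hlt
  have h2 := (Submodule.finrank_mono hle).trans (Submodule.finrank_add_le_finrank_add_finrank _ _)
  have h3 := finrank_span_le_card (R := ℝ) ({w - x} : Set V)
  simp only [Set.toFinset_singleton, Finset.card_singleton] at h3
  omega

/-- A functional maximal at `x` on a neighbourhood of `x` in `S` would be constant on `S`; here only
directions staying in the half-space may be tested. If the face has a point strictly below the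
hyperplane, mixing with that point makes every direction testable, and the face is the whole half.
Otherwise the face lies in the hyperplane, where all directions can be tested. -/
theorem eq_of_isExposed_inter_le (hS : Convex ℝ S) {x : V} (hx : x ∈ intrinsicInterior ℝ S)
    {B : Set V} (hB : IsExposed ℝ (S ∩ {y | ℓ y ≤ c}) B) (hxB : x ∈ B) :
    B = S ∩ {y | ℓ y ≤ c} ∨ B = S ∩ {y | ℓ y = c} := by
  obtain ⟨l, hl⟩ := hB ⟨x, hxB⟩
  have hxm : ∀ y ∈ S ∩ {y | ℓ y ≤ c}, l y ≤ l x := by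
    have := hxB; rw [hl] at this; exact this.2
  have hmem : ∀ y ∈ S ∩ {y | ℓ y ≤ c}, l x ≤ l y → y ∈ B := by
    intro y hy h
    rw [hl]
    exact ⟨hy, fun z hz => (hxm z hz).trans h⟩
  have hBl : ∀ y ∈ B, l y = l x := by
    intro y hy
    refine le_antisymm (hxm y (hB.subset hy)) ?_
    rw [hl] at hy
    exact hy.2 x (hB.subset hxB)
  by_cases hz : ∃ z ∈ B, ℓ z < c
  · left
    obtain ⟨z, hzB, hzc⟩ := hz
    refine subset_antisymm hB.subset fun y hy => hmem y hy ?_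
    obtain ⟨ε, hε, hu⟩ := exists_extend_of_mem_intrinsicInterior hx hy.1
    set u := x - ε • (y - x) with hu'
    have hzS := hB.subset hzB
    -- The point `u` opposite to `y` may leave the half-space. A mixture with `z`, where the
    -- functional equals its maximum, brings it back while keeping a positive share of `u`.
    obtain ⟨t, ht0, ht1, htc⟩ : ∃ t : ℝ, 0 < t ∧ t ≤ 1 ∧ t * ℓ u + (1 - t) * ℓ z ≤ c := by
      by_cases h : ℓ u ≤ c
      · exact ⟨1, one_pos, le_rfl, by linarith⟩
      · refine ⟨(c - ℓ z) / (ℓ u - ℓ z), div_pos (by linarith) (by linarith),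
          (div_le_one (by linarith)).2 (by linarith), le_of_eq ?_⟩
        have : ℓ u - ℓ z ≠ 0 := by linarith
        field_simp
        ring
    have h1 : t • u + (1 - t) • z ∈ S ∩ {y | ℓ y ≤ c} := by
      refine ⟨hS hu hzS.1 ht0.le (by linarith) (by ring), ?_⟩
      change ℓ _ ≤ c
      simpa only [map_add, map_smul, smul_eq_mul] using htc
    have h2 := hxm _ h1
    simp only [map_add, map_smul, map_sub, smul_eq_mul, hu', hBl z hzB] at h2
    have h3 : 0 ≤ (t * ε) * (l y - l x) := by linarith
    have h4 := nonneg_of_mul_nonneg_right h3 (by positivity)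
    linarith
  · right
    push Not at hz
    have hxc : ℓ x = c := le_antisymm (hB.subset hxB).2 (hz x hxB)
    refine subset_antisymm (fun y hy => ⟨(hB.subset hy).1, le_antisymm (hB.subset hy).2 (hz y hy)⟩) ?_
    intro y hy
    refine hmem y ⟨hy.1, le_of_eq hy.2⟩ ?_
    obtain ⟨ε, hε, hu⟩ := exists_extend_of_mem_intrinsicInterior hx hy.1
    have h2 := hxm (x - ε • (y - x)) ⟨hu, by
      change ℓ _ ≤ c
      have hyc : ℓ y = c := hy.2
      rw [map_sub, map_smul, map_sub, hxc, hyc, sub_self, smul_zero, sub_zero]⟩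
    simp only [map_smul, map_sub, smul_eq_mul] at h2
    have h3 : 0 ≤ ε * (l y - l x) := by linarith
    have h4 := nonneg_of_mul_nonneg_right h3 hε
    linarith

theorem convex_exists_smul_add_smul_eq {Q : Set V} (hQ : Convex ℝ Q) {q₁ q₂ : V}
    (h₁ : q₁ ∈ Q) (h₂ : q₂ ∈ Q) {s t : ℝ} (hs : 0 ≤ s) (ht : 0 ≤ t) (hst : 0 < s + t) :
    ∃ q ∈ Q, s • q₁ + t • q₂ = (s + t) • q := by
  refine ⟨(s / (s + t)) • q₁ + (t / (s + t)) • q₂, hQ h₁ h₂ (by positivity) (by positivity)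
    (by field_simp), ?_⟩
  rw [smul_add, smul_smul, smul_smul, mul_div_cancel₀ _ hst.ne', mul_div_cancel₀ _ hst.ne']

/-- If all the points at level `c` on segments joining generators below and above the level `c`
belong to a convex set `Q`, then so do all the points at level `c` on segments joining points of
the convex hulls. -/
theorem exists_level_point {s : Set V} {Q : Set V} (hQ : Convex ℝ Q)
    (h : ∀ u ∈ s, ∀ w ∈ s, ℓ u ≤ c → c < ℓ w →
      ∃ q ∈ Q, (ℓ w - c) • u + (c - ℓ u) • w = (ℓ w - ℓ u) • q) {u w : V}
    (hu : u ∈ convexHull ℝ (s ∩ {y | ℓ y ≤ c})) (hw : w ∈ convexHull ℝ (s ∩ {y | c < ℓ y})) :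
    ℓ u ≤ c ∧ c < ℓ w ∧ ∃ q ∈ Q, (ℓ w - c) • u + (c - ℓ u) • w = (ℓ w - ℓ u) • q := by
  have hu' : ∀ u ∈ convexHull ℝ (s ∩ {y | ℓ y ≤ c}), ℓ u ≤ c := fun u hu =>
    convexHull_min (s := s ∩ {y | ℓ y ≤ c}) (fun y hy => hy.2) (convex_halfSpace_le ℓ.isLinear c) hu
  -- The hypothesis is extended from generators to hulls in one variable at a time. The denominators
  -- are cleared, so the crossing point for a convex combination of `u₁` and `u₂` is the mean of the
  -- two crossing points with weights `a * (ℓ w - ℓ u₁)` and `b * (ℓ w - ℓ u₂)`.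
  have step : ∀ w ∈ s, c < ℓ w → ∀ u ∈ convexHull ℝ (s ∩ {y | ℓ y ≤ c}),
      ℓ u ≤ c ∧ ∃ q ∈ Q, (ℓ w - c) • u + (c - ℓ u) • w = (ℓ w - ℓ u) • q := by
    intro w hw hwc u hu
    refine convexHull_min (s := s ∩ {y | ℓ y ≤ c}) (t := {u | ℓ u ≤ c ∧ ∃ q ∈ Q,
      (ℓ w - c) • u + (c - ℓ u) • w = (ℓ w - ℓ u) • q}) ?_ ?_ hu
    · rintro u ⟨hu, huc⟩
      exact ⟨huc, h u hu w hw huc hwc⟩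
    · rintro u₁ ⟨h₁, q₁, hq₁, e₁⟩ u₂ ⟨h₂, q₂, hq₂, e₂⟩ a b ha hb hab
      have hD₁ : 0 < ℓ w - ℓ u₁ := by linarith
      have hD₂ : 0 < ℓ w - ℓ u₂ := by linarith
      have hpos : 0 < a * (ℓ w - ℓ u₁) + b * (ℓ w - ℓ u₂) := by
        rcases ha.lt_or_eq with ha' | ha'
        · have := mul_pos ha' hD₁
          have := mul_nonneg hb hD₂.le
          linarith
        · have : b = 1 := by linarith
          rw [← ha', this]; linarith
      obtain ⟨q, hq, e⟩ := convex_exists_smul_add_smul_eq hQ hq₁ hq₂ (mul_nonneg ha hD₁.le)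
        (mul_nonneg hb hD₂.le) hpos
      obtain rfl : b = 1 - a := by linarith
      refine ⟨?_, q, hq, ?_⟩
      · simp only [map_add, map_smul, smul_eq_mul]
        nlinarith
      · simp only [map_add, map_smul, smul_eq_mul]
        rw [mul_smul, mul_smul, ← e₁, ← e₂] at e
        rw [show ℓ w - (a * ℓ u₁ + (1 - a) * ℓ u₂)
          = a * (ℓ w - ℓ u₁) + (1 - a) * (ℓ w - ℓ u₂) by ring, ← e]
        module
  refine ⟨hu' u hu, ?_⟩
  refine convexHull_min (s := s ∩ {y | c < ℓ y}) (t := {w | c < ℓ w ∧ ∃ q ∈ Q,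
      (ℓ w - c) • u + (c - ℓ u) • w = (ℓ w - ℓ u) • q}) ?_ ?_ hw
  · rintro w ⟨hw, hwc⟩
    exact ⟨hwc, (step w hw hwc u hu).2⟩
  · have huc := hu' u hu
    rintro w₁ ⟨h₁, q₁, hq₁, e₁⟩ w₂ ⟨h₂, q₂, hq₂, e₂⟩ a b ha hb hab
    have hD₁ : 0 < ℓ w₁ - ℓ u := by linarith
    have hD₂ : 0 < ℓ w₂ - ℓ u := by linarith
    have hpos : 0 < a * (ℓ w₁ - ℓ u) + b * (ℓ w₂ - ℓ u) := by
      rcases ha.lt_or_eq with ha' | ha'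
      · have := mul_pos ha' hD₁
        have := mul_nonneg hb hD₂.le
        linarith
      · have : b = 1 := by linarith
        rw [← ha', this]; linarith
    obtain ⟨q, hq, e⟩ := convex_exists_smul_add_smul_eq hQ hq₁ hq₂ (mul_nonneg ha hD₁.le)
      (mul_nonneg hb hD₂.le) hpos
    refine ⟨(convex_halfSpace_gt ℓ.isLinear c) h₁ h₂ ha hb hab, q, hq, ?_⟩
    obtain rfl : b = 1 - a := by linarith
    simp only [map_add, map_smul, smul_eq_mul]
    rw [mul_smul, mul_smul, ← e₁, ← e₂] at e
    rw [show a * ℓ w₁ + (1 - a) * ℓ w₂ - ℓ u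
      = a * (ℓ w₁ - ℓ u) + (1 - a) * (ℓ w₂ - ℓ u) by ring, ← e]
    module

/-- Every point of the hull lies on a segment from the hull of the low generators to the hull of the
high ones. That segment crosses level `c` at some `q` in `Q`, and the level of `x` tells on which
side of `q` it lies. -/
theorem exists_segment_of_mem_convexHull {s : Set V} {Q : Set V} (hQ : Convex ℝ Q)
    (h : ∀ u ∈ s, ∀ w ∈ s, ℓ u ≤ c → c < ℓ w →
      ∃ q ∈ Q, (ℓ w - c) • u + (c - ℓ u) • w = (ℓ w - ℓ u) • q)
    (hlow : ∃ u ∈ s, ℓ u ≤ c) (hhigh : ∃ w ∈ s, c < ℓ w) {x : V} (hx : x ∈ convexHull ℝ s) :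
    ∃ u ∈ convexHull ℝ (s ∩ {y | ℓ y ≤ c}), ∃ w ∈ convexHull ℝ (s ∩ {y | c < ℓ y}), ∃ q ∈ Q,
      (ℓ x ≤ c → x ∈ segment ℝ u q) ∧ (c ≤ ℓ x → x ∈ segment ℝ q w) := by
  have hs : s = (s ∩ {y | ℓ y ≤ c}) ∪ (s ∩ {y | c < ℓ y}) := by
    ext y
    constructor
    · intro hy
      exact (le_or_gt (ℓ y) c).imp (fun h => ⟨hy, h⟩) (fun h => ⟨hy, h⟩)
    · rintro (hy | hy) <;> exact hy.1
  obtain ⟨u₀, hu₀, hu₀c⟩ := hlow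
  obtain ⟨w₀, hw₀, hw₀c⟩ := hhigh
  have h₁ : (s ∩ {y | ℓ y ≤ c}).Nonempty := ⟨u₀, hu₀, hu₀c⟩
  have h₂ : (s ∩ {y | c < ℓ y}).Nonempty := ⟨w₀, hw₀, hw₀c⟩
  rw [hs, convexHull_union h₁ h₂, mem_convexJoin] at hx
  obtain ⟨u, hu, w, hw, a, b, ha, hb, hab, rfl⟩ := hx
  obtain ⟨huc, hwc, q, hq, e⟩ := exists_level_point hQ h hu hw
  refine ⟨u, hu, w, hw, q, hq, ?_, ?_⟩
  · intro hx
    simp only [map_add, map_smul, smul_eq_mul] at hx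
    rcases huc.lt_or_eq with huc | huc
    · have hD : 0 < c - ℓ u := by linarith
      have hD' : 0 < ℓ w - ℓ u := by linarith
      obtain rfl : a = 1 - b := by linarith
      have hb1 : b * (ℓ w - ℓ u) ≤ c - ℓ u := by linarith
      refine ⟨1 - b * (ℓ w - ℓ u) / (c - ℓ u), b * (ℓ w - ℓ u) / (c - ℓ u), ?_, by positivity,
        by ring, ?_⟩
      · have := (div_le_one hD).2 hb1
        linarith
      · have e' : w = (c - ℓ u)⁻¹ • ((ℓ w - ℓ u) • q - (ℓ w - c) • u) := by
          rw [← e, add_sub_cancel_left, smul_smul, inv_mul_cancel₀ hD.ne', one_smul]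
        generalize ℓ w = m at *
        have hne := hD.ne'
        rw [e']
        match_scalars <;> field_simp <;> ring
    -- If `u` is itself at level `c`, the division by `c - ℓ u` breaks down, but then a point of the
    -- segment at level at most `c` can only be `u`.
    · have : b = 0 := by
        rw [huc] at hx
        have h1 : b * (ℓ w - c) ≤ 0 := by
          obtain rfl : a = 1 - b := by linarith
          linarith
        by_contra hb0
        have := mul_pos (hb.lt_of_ne' hb0) (show 0 < ℓ w - c by linarith)
        linarith
      subst this
      rw [zero_smul, add_zero, show a = 1 by linarith, one_smul]
      exact left_mem_segment ℝ u q
  · intro hx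
    simp only [map_add, map_smul, smul_eq_mul] at hx
    have hD : 0 < ℓ w - c := by linarith
    have hD' : 0 < ℓ w - ℓ u := by linarith
    obtain rfl : b = 1 - a := by linarith
    have ha1 : a * (ℓ w - ℓ u) ≤ ℓ w - c := by linarith
    refine ⟨a * (ℓ w - ℓ u) / (ℓ w - c), 1 - a * (ℓ w - ℓ u) / (ℓ w - c), by positivity, ?_,
      by ring, ?_⟩
    · have := (div_le_one hD).2 ha1
      linarith
    · have e' : u = (ℓ w - c)⁻¹ • ((ℓ w - ℓ u) • q - (c - ℓ u) • w) := by
        rw [← e, add_sub_cancel_right, smul_smul, inv_mul_cancel₀ hD.ne', one_smul]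
      generalize ℓ u = m at *
      have hne := hD.ne'
      rw [e']
      match_scalars <;> field_simp <;> ring

end convex

/-! ### Base polytopes, their vertices and their faces. -/

section polytopes

variable {E : Type}

/-- The vertices of the base polytope. -/
def baseVectors (M : MatroidOn E) : Set (E → ℝ) := {v | ∃ B, M.toMatroid.IsBase B ∧ v = B.indicator 1}

theorem basePolytope_eq (M : MatroidOn E) : basePolytope M = convexHull ℝ (baseVectors M) := rfl

theorem convex_basePolytope (M : MatroidOn E) : Convex ℝ (basePolytope M) := convex_convexHull ℝ _

theorem indicator_mem_basePolytope {M : MatroidOn E} {B : Set E} (hB : M.toMatroid.IsBase B) :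
    B.indicator 1 ∈ basePolytope M := subset_convexHull ℝ _ ⟨B, hB, rfl⟩

/-- A 0/1-vector is a vertex of the unit cube, so the cube without it is still convex. That convex
set contains all the base vectors, and hence the polytope, if `B` is not a base. -/
theorem isBase_of_indicator_mem {M : MatroidOn E} {B : Set E}
    (h : B.indicator (1 : E → ℝ) ∈ basePolytope M) : M.toMatroid.IsBase B := by
  by_contra hB
  let cube : Set (E → ℝ) := {x | ∀ e, 0 ≤ x e ∧ x e ≤ 1}
  have hconv : Convex ℝ (cube \ {B.indicator 1}) := by
    rintro x ⟨hx, hxB⟩ y ⟨hy, hyB⟩ a b ha hb hab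
    refine ⟨fun e => ⟨?_, ?_⟩, fun hcon => ?_⟩
    · have := mul_nonneg ha (hx e).1
      have := mul_nonneg hb (hy e).1
      simp only [Pi.add_apply, Pi.smul_apply, smul_eq_mul]
      linarith
    · have := mul_le_mul_of_nonneg_left (hx e).2 ha
      have := mul_le_mul_of_nonneg_left (hy e).2 hb
      simp only [Pi.add_apply, Pi.smul_apply, smul_eq_mul]
      linarith
    · rcases ha.lt_or_eq with ha' | ha'
      · apply hxB
        funext e
        have h1 := congrFun hcon e
        simp only [Pi.add_apply, Pi.smul_apply, smul_eq_mul] at h1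
        by_cases he : e ∈ B
        · rw [Set.indicator_of_mem he, Pi.one_apply] at h1 ⊢
          have := mul_le_mul_of_nonneg_left (hy e).2 hb
          refine le_antisymm (hx e).2 ?_
          by_contra hlt
          have := mul_lt_mul_of_pos_left (not_le.1 hlt) ha'
          linarith
        · rw [Set.indicator_of_notMem he] at h1 ⊢
          have := mul_nonneg hb (hy e).1
          refine le_antisymm ?_ (hx e).1
          by_contra hlt
          have := mul_pos ha' (not_le.1 hlt)
          linarith
      · apply hyB
        rw [Set.mem_singleton_iff, ← hcon, ← ha', show b = 1 by linarith]
        simp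
  have hsub : basePolytope M ⊆ cube \ {B.indicator 1} := by
    refine convexHull_min ?_ hconv
    rintro _ ⟨B', hB', rfl⟩
    refine ⟨fun e => ⟨Set.indicator_nonneg (by simp) e, Set.indicator_le_self' (by simp) e⟩, ?_⟩
    intro heq
    apply hB
    have : B' = B := by
      ext e
      have h1 := congrFun heq e
      by_cases he : e ∈ B <;> by_cases he' : e ∈ B' <;> simp_all
    rwa [← this]
  exact (hsub h).2 rfl

theorem indicator_mem_basePolytope_iff {M : MatroidOn E} {B : Set E} :
    B.indicator (1 : E → ℝ) ∈ basePolytope M ↔ M.toMatroid.IsBase B :=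
  ⟨isBase_of_indicator_mem, indicator_mem_basePolytope⟩

theorem MatroidOn.ext_isBase {M N : MatroidOn E}
    (h : ∀ B, M.toMatroid.IsBase B ↔ N.toMatroid.IsBase B) : M = N := by
  obtain ⟨M, hM⟩ := M
  obtain ⟨N, hN⟩ := N
  obtain rfl : M = N := Matroid.ext_isBase (hM.trans hN.symm) fun B _ => h B
  rfl

theorem basePolytope_injective : Function.Injective (basePolytope (E := E)) := fun M N h =>
  MatroidOn.ext_isBase fun B => by
    rw [← indicator_mem_basePolytope_iff, h, indicator_mem_basePolytope_iff]

theorem basePolytope_mono {M N : MatroidOn E}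
    (h : ∀ B, M.toMatroid.IsBase B → N.toMatroid.IsBase B) : basePolytope M ⊆ basePolytope N :=
  convexHull_mono fun _ ⟨B, hB, e⟩ => ⟨B, h B hB, e⟩

open Classical in
theorem indicator_exchange {B : Set E} {e f : E} (he : e ∈ B) (hf : f ∉ B) :
    (insert f (B \ {e})).indicator (1 : E → ℝ)
      = B.indicator 1 - Pi.single e 1 + Pi.single f 1 := by
  have hef : e ≠ f := fun h => hf (h ▸ he)
  funext x
  rw [Pi.add_apply, Pi.sub_apply]
  by_cases hxf : x = f
  · subst hxf
    rw [Set.indicator_of_mem (Set.mem_insert _ _), Set.indicator_of_notMem hf, Pi.single_eq_same,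
      Pi.single_eq_of_ne hef.symm]
    simp
  · rw [Pi.single_eq_of_ne hxf, add_zero]
    by_cases hxe : x = e
    · subst hxe
      rw [Set.indicator_of_notMem (by simp [hxf]), Set.indicator_of_mem he, Pi.single_eq_same]
      simp
    · rw [Pi.single_eq_of_ne hxe, sub_zero]
      simp [Set.indicator_apply, hxf, hxe]

/-- The fundamental circuit of `e` in `B₂` spans `e` by its other elements, whereas `B₁ \ {e}` does
not span `e`. So some other element `f` of the circuit lies outside the closure of `B₁ \ {e}`, and
this `f` serves both exchanges. -/
theorem exists_symm_exchange (M : MatroidOn E) {B₁ B₂ : Set E} (h₁ : M.toMatroid.IsBase B₁)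
    (h₂ : M.toMatroid.IsBase B₂) {e : E} (he : e ∈ B₁ \ B₂) :
    ∃ f ∈ B₂ \ B₁, M.toMatroid.IsBase (insert f (B₁ \ {e})) ∧
      M.toMatroid.IsBase (insert e (B₂ \ {f})) := by
  have hg : ∀ X : Set E, X ⊆ M.toMatroid.E := fun X => by
    rw [M.ground_eq]; exact Set.subset_univ X
  have hecl : e ∈ M.toMatroid.closure B₂ := by
    rw [h₂.closure_eq]; exact hg {e} rfl
  have hC := h₂.indep.fundCircuit_isCircuit hecl he.2
  have hecl' : e ∉ M.toMatroid.closure (B₁ \ {e}) := h₁.indep.notMem_closure_sdiff_of_mem he.1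
  have : ∃ f ∈ M.toMatroid.fundCircuit e B₂ \ {e}, f ∉ M.toMatroid.closure (B₁ \ {e}) := by
    by_contra! hcon
    exact hecl' (M.toMatroid.closure_subset_closure_of_subset_closure hcon
      (hC.mem_closure_sdiff_singleton_of_mem (M.toMatroid.mem_fundCircuit e B₂)))
  obtain ⟨f, ⟨hfC, hfe⟩, hfcl⟩ := this
  have hfe : f ≠ e := hfe
  have hf₂ : f ∈ B₂ := by
    have := M.toMatroid.fundCircuit_subset_insert e B₂ hfC
    exact this.resolve_left hfe
  have hf₁ : f ∉ B₁ := fun h =>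
    hfcl (M.toMatroid.mem_closure_of_mem ⟨h, hfe⟩ (hg _))
  refine ⟨f, ⟨hf₂, hf₁⟩, h₁.exchange_isBase_of_indep hf₁ ?_, h₂.exchange_isBase_of_indep he.2 ?_⟩
  · rw [(h₁.indep.sdiff _).insert_indep_iff]
    exact Or.inl ⟨hg {f} rfl, hfcl⟩
  · have := (h₂.indep.mem_fundCircuit_iff hecl he.2).1 hfC
    rwa [← Set.insert_sdiff_singleton_comm hfe.symm] at this

variable [Finite E]

theorem finite_baseVectors (M : MatroidOn E) : (baseVectors M).Finite := by
  refine (Set.toFinite (Set.range fun B : Set E => B.indicator (1 : E → ℝ))).subset ?_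
  rintro _ ⟨B, -, rfl⟩
  exact ⟨B, rfl⟩

theorem MatroidOn.exists_isBase_iff {p : Set E → Prop} (hne : ∃ B, p B)
    (hex : Matroid.ExchangeProperty p) : ∃ M : MatroidOn E, ∀ B, M.toMatroid.IsBase B ↔ p B :=
  ⟨⟨Matroid.ofIsBaseOfFinite (E := Set.univ) Set.finite_univ p hne hex
    (fun _ _ => Set.subset_univ _), rfl⟩, fun _ => Iff.rfl⟩

/-- The bases of a matroid on which a linear functional attains its maximum are the bases of
a matroid. -/
theorem exists_isBase_iff_isMax (M : MatroidOn E) (l : (E → ℝ) →ₗ[ℝ] ℝ) :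
    ∃ N : MatroidOn E, ∀ B, N.toMatroid.IsBase B ↔ M.toMatroid.IsBase B ∧
      ∀ B', M.toMatroid.IsBase B' → l (B'.indicator 1) ≤ l (B.indicator 1) := by
  classical
  refine MatroidOn.exists_isBase_iff ?_ ?_
  · obtain ⟨B₀, hB₀⟩ := M.toMatroid.exists_isBase
    obtain ⟨B, hB, hmax⟩ := Set.exists_max_image {B | M.toMatroid.IsBase B}
      (fun B => l (B.indicator 1)) (Set.toFinite _) ⟨B₀, hB₀⟩
    exact ⟨B, hB, hmax⟩
  · rintro B₁ B₂ ⟨h₁, m₁⟩ ⟨h₂, m₂⟩ e he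
    -- The two exchanges change the value of `l` by opposite amounts. Since `B₂` is maximal, the
    -- exchange in `B₂` gains nothing, so the exchange in `B₁` loses nothing.
    obtain ⟨f, hf, hb₁, hb₂⟩ := exists_symm_exchange M h₁ h₂ he
    refine ⟨f, hf, hb₁, fun B' hB' => (m₁ B' hB').trans ?_⟩
    have h3 := m₂ _ hb₂
    rw [indicator_exchange hf.1 he.2] at h3
    rw [indicator_exchange he.1 hf.2]
    simp only [map_add, map_sub] at h3 ⊢
    linarith

/-- A decomposition must consist of matroids, so each face of a base polytope has to be recognised
as one; its vertices are the bases maximising a functional. -/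
theorem exists_basePolytope_eq_of_isExposed {M : MatroidOn E} {R : Set (E → ℝ)}
    (hR : IsExposed ℝ (basePolytope M) R) (hne : R.Nonempty) :
    ∃ N : MatroidOn E, basePolytope N = R := by
  have := Fintype.ofFinite E
  obtain ⟨l, hl⟩ := hR hne
  obtain ⟨N, hN⟩ := exists_isBase_iff_isMax M l.toLinearMap
  refine ⟨N, ?_⟩
  rw [eq_convexHull_of_isExposed (finite_baseVectors M) hR, basePolytope_eq]
  congr 1
  ext v
  constructor
  · rintro ⟨B, hB, rfl⟩
    obtain ⟨h1, h2⟩ := (hN B).1 hB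
    refine ⟨⟨B, h1, rfl⟩, ?_⟩
    rw [hl]
    refine ⟨indicator_mem_basePolytope h1, fun y hy => ?_⟩
    refine convexHull_min (s := baseVectors M) (t := {y | l y ≤ l (B.indicator 1)}) ?_
      (convex_halfSpace_le l.isLinear _) hy
    rintro _ ⟨B', hB', rfl⟩
    exact h2 B' hB'
  · rintro ⟨⟨B, hB, rfl⟩, h2⟩
    rw [hl] at h2
    exact ⟨B, (hN B).2 ⟨hB, fun B' hB' => h2.2 _ (indicator_mem_basePolytope hB')⟩, rfl⟩

theorem isExposed_trans {M : MatroidOn E} {Q R : Set (E → ℝ)}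
    (hQ : IsExposed ℝ (basePolytope M) Q) (hR : IsExposed ℝ Q R) :
    IsExposed ℝ (basePolytope M) R := by
  have := Fintype.ofFinite E
  exact isExposed_trans_of_finite (finite_baseVectors M) hQ hR

/-- The sum of the coordinates in `F`. -/
def level (F : Set E) : (E → ℝ) →ₗ[ℝ] ℝ := ∑ e ∈ F.toFinite.toFinset, LinearMap.proj e

theorem level_indicator (F B : Set E) :
    level F (B.indicator 1) = ((B ∩ F).ncard : ℝ) := by
  classical
  rw [level, LinearMap.sum_apply]
  simp only [LinearMap.proj_apply, Set.indicator_apply, Pi.one_apply]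
  rw [Finset.sum_ite, Finset.sum_const_zero, add_zero, Finset.sum_const, nsmul_eq_mul, mul_one,
    Set.ncard_eq_toFinset_card _ (Set.toFinite _)]
  congr 2
  ext x
  simp [and_comm]

end polytopes

/-! ### Relaxation at a single flat -/

section relaxationAt

variable {E : Type} [Finite E]

/-- Combinatorial conditions for `N'` to be the relaxation of `N` (of rank `k`) at a set `F`
(of rank `r`). -/
structure IsRelaxationAt (r k : ℕ) (F : Set E) (N N' : MatroidOn E) : Prop where
  ncard_eq : ∀ B, N.toMatroid.IsBase B → B.ncard = k
  inter_le : ∀ B, N.toMatroid.IsBase B → (B ∩ F).ncard ≤ r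
  isBase_of_eq : ∀ B : Set E, B.ncard = k → (B ∩ F).ncard = r → N.toMatroid.IsBase B
  isBase_iff : ∀ B, N'.toMatroid.IsBase B ↔
    N.toMatroid.IsBase B ∨ (B.ncard = k ∧ (B ∩ F).ncard = r + 1)

variable {r k : ℕ} {F : Set E} {N N' : MatroidOn E}

theorem ncard_exchange {B : Set E} {e f : E} (he : e ∈ B) (hf : f ∉ B) :
    (insert f (B \ {e})).ncard = B.ncard := by
  rw [Set.ncard_insert_of_notMem (fun h => hf h.1) (Set.toFinite _),
    Set.ncard_sdiff_singleton_add_one he (Set.toFinite _)]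

/-- This exchange moves both sets one step towards level `r`. By counting, some `f` of `B₂` outside
`F` is not in `B₁`. If no `e` in `B₁ ∩ F` could replace it, the closure of `B₂ \ {f}` in `N'`, of
rank `k - 1`, would contain `B₁ ∩ F` and `(B₂ \ F) \ {f}`, hence an element of the cusp, which is a
base of `N'`. The new `B₂` has level at most `r`, so it is a base of `N` and not merely of `N'`. -/
theorem IsRelaxationAt.exists_exchange (h : IsRelaxationAt r k F N N') {B₁ B₂ : Set E}
    (h₁ : B₁.ncard = k) (h₁F : (B₁ ∩ F).ncard = r + 1) (h₂ : N.toMatroid.IsBase B₂)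
    (h₂F : (B₂ ∩ F).ncard < r) :
    ∃ e ∈ (B₁ ∩ F) \ B₂, ∃ f ∈ (B₂ \ F) \ B₁, N.toMatroid.IsBase (insert e (B₂ \ {f})) ∧
      (insert e (B₂ \ {f}) ∩ F).ncard = (B₂ ∩ F).ncard + 1 ∧
      (insert f (B₁ \ {e})).ncard = k ∧ (insert f (B₁ \ {e}) ∩ F).ncard = r := by
  have hg : ∀ X : Set E, X ⊆ N'.toMatroid.E := fun X => by
    rw [N'.ground_eq]; exact Set.subset_univ X
  have hsplit : ∀ X : Set E, (X \ F).ncard + (X ∩ F).ncard = X.ncard := by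
    intro X
    rw [add_comm]; exact Set.ncard_inter_add_ncard_sdiff_eq_ncard X F X.toFinite
  have hs₁ := hsplit B₁
  have hs₂ := hsplit B₂
  have hk₂ := h.ncard_eq B₂ h₂
  obtain ⟨f, hf, hf₁⟩ := Set.exists_mem_notMem_of_ncard_lt_ncard
    (s := B₁ \ F) (t := B₂ \ F) (by omega) (Set.toFinite _)
  have hf₁' : f ∉ B₁ := fun hh => hf₁ ⟨hh, hf.2⟩
  have hB₂' : N'.toMatroid.IsBase B₂ := (h.isBase_iff B₂).2 (Or.inl h₂)
  have hi : N'.toMatroid.Indep (B₂ \ {f}) := hB₂'.indep.subset Set.sdiff_subset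
  have key : ∃ e ∈ (B₁ ∩ F) \ B₂, N'.toMatroid.IsBase (insert e (B₂ \ {f})) := by
    by_contra! hcon
    -- The size is chosen so that `B₁ ∩ F`, of size `r + 1`, is completed to a `k`-element set.
    -- Enough elements remain because `B₂` has more than `k - r` elements outside `F`.
    obtain ⟨J, hJ, hJc⟩ := Set.exists_subset_card_eq (s := (B₂ \ F) \ {f}) (n := k - r - 1) (by
      have := Set.ncard_sdiff_singleton_add_one hf (Set.toFinite _)
      omega)
    have hdj : Disjoint (B₁ ∩ F) J := by
      rw [Set.disjoint_left]
      exact fun x hx hxJ => (hJ hxJ).1.2 hx.2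
    have hZ : ((B₁ ∩ F) ∪ J).ncard = k := by
      rw [Set.ncard_union_eq hdj (Set.toFinite _) (Set.toFinite _)]
      omega
    have hZF : ((B₁ ∩ F) ∪ J) ∩ F = B₁ ∩ F := by
      ext x
      constructor
      · rintro ⟨hx | hx, hxF⟩
        · exact hx
        · exact absurd hxF (hJ hx).1.2
      · exact fun hx => ⟨Or.inl hx, hx.2⟩
    have hZb : N'.toMatroid.IsBase ((B₁ ∩ F) ∪ J) :=
      (h.isBase_iff _).2 (Or.inr ⟨hZ, by rw [hZF, h₁F]⟩)
    have hsub : (B₁ ∩ F) ∪ J ⊆ N'.toMatroid.closure (B₂ \ {f}) := by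
      rintro x (hx | hx)
      · by_cases hx₂ : x ∈ B₂
        · exact N'.toMatroid.mem_closure_of_mem ⟨hx₂, fun hxf => hf.2 (hxf ▸ hx.2)⟩ (hg _)
        · by_contra hxcl
          refine hcon x ⟨hx, hx₂⟩ (hB₂'.exchange_isBase_of_indep hx₂ ?_)
          rw [hi.insert_indep_iff]
          exact Or.inl ⟨hg {x} rfl, hxcl⟩
      · exact N'.toMatroid.mem_closure_of_mem ⟨(hJ hx).1.1, (hJ hx).2⟩ (hg _)
    have h9 := hZb.indep.encard_le_eRk_of_subset hsub
    rw [N'.toMatroid.eRk_closure_eq, hi.eRk_eq_encard, ← Set.Finite.cast_ncard_eq (Set.toFinite _),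
      ← Set.Finite.cast_ncard_eq (Set.toFinite _), hZ] at h9
    have h10 : k ≤ (B₂ \ {f}).ncard := by exact_mod_cast h9
    have := Set.ncard_sdiff_singleton_add_one hf.1 (Set.toFinite _)
    omega
  obtain ⟨e, he, hb⟩ := key
  have hlev₂ : (insert e (B₂ \ {f}) ∩ F).ncard = (B₂ ∩ F).ncard + 1 := by
    rw [Set.insert_inter_of_mem he.1.2]
    have : (B₂ \ {f}) ∩ F = B₂ ∩ F := by
      ext x
      exact ⟨fun hx => ⟨hx.1.1, hx.2⟩, fun hx => ⟨⟨hx.1, fun hxf => hf.2 (hxf ▸ hx.2)⟩, hx.2⟩⟩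
    rw [this, Set.ncard_insert_of_notMem (fun hh => he.2 hh.1) (Set.toFinite _)]
  have hlev₁ : (insert f (B₁ \ {e}) ∩ F).ncard = r := by
    rw [Set.insert_inter_of_notMem hf.2]
    have : (B₁ \ {e}) ∩ F = (B₁ ∩ F) \ {e} := by
      ext x
      exact ⟨fun hx => ⟨⟨hx.1.1, hx.2⟩, hx.1.2⟩, fun hx => ⟨⟨hx.1.1, hx.2⟩, hx.1.2⟩⟩
    rw [this]
    have := Set.ncard_sdiff_singleton_add_one he.1 (Set.toFinite _)
    omega
  refine ⟨e, he, f, ⟨hf, hf₁'⟩, ?_, hlev₂, ?_, hlev₁⟩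
  · refine ((h.isBase_iff _).1 hb).resolve_right fun hh => ?_
    omega
  · rw [ncard_exchange he.1.1 hf₁', h₁]

/-- With `n` the defect of `B₂` from level `r`, the weights 1 and `n` give the point at level `r` of
the segment from `B₂` to `B₁`. Exchanging `e` and `f` preserves the sum of the two vectors: one copy
of `B₁` becomes a vertex of the wall, and `B₂` comes one level closer, so induction on the defect
applies. -/
theorem IsRelaxationAt.exists_mem_basePolytope (h : IsRelaxationAt r k F N N') {P : MatroidOn E}
    (hP : ∀ B : Set E, B.ncard = k → (B ∩ F).ncard = r → P.toMatroid.IsBase B) (n : ℕ) :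
    ∀ {B₁ B₂ : Set E}, B₁.ncard = k → (B₁ ∩ F).ncard = r + 1 → N.toMatroid.IsBase B₂ →
    (B₂ ∩ F).ncard + n = r → ∃ q ∈ basePolytope P,
      B₂.indicator (1 : E → ℝ) + (n : ℝ) • B₁.indicator (1 : E → ℝ) = ((n : ℝ) + 1) • q := by
  induction n with
  | zero =>
    intro B₁ B₂ _ _ h₂ hn
    refine ⟨_, indicator_mem_basePolytope (hP B₂ (h.ncard_eq B₂ h₂) (by omega)), ?_⟩
    simp
  | succ n ih =>
    classical
    have := Fintype.ofFinite E
    intro B₁ B₂ h₁ h₁F h₂ hn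
    obtain ⟨e, he, f, hf, hb, hlev, hk, hr⟩ := h.exists_exchange h₁ h₁F h₂ (by omega)
    obtain ⟨q, hq, e1⟩ := ih h₁ h₁F hb (by omega)
    obtain ⟨q', hq', e2⟩ := convex_exists_smul_add_smul_eq (convex_basePolytope P)
      (indicator_mem_basePolytope (hP _ hk hr)) hq zero_le_one
      (by positivity : (0 : ℝ) ≤ (n : ℝ) + 1) (by positivity)
    refine ⟨q', hq', ?_⟩
    rw [indicator_exchange hf.1.1 he.2] at e1
    rw [indicator_exchange he.1.1 hf.2, ← e1] at e2
    push_cast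
    rw [show (n : ℝ) + 1 + 1 = 1 + (n + 1) by ring, ← e2]
    module

/-- `N'` is the relaxation of `N` at `F`, the bases of `P` are the sets of size `k` meeting `F` in
`r` elements, and the bases of `L` are those meeting `F` in `r` or `r + 1` elements. -/
structure IsRelaxationSquare (r k : ℕ) (F : Set E) (N N' L P : MatroidOn E) : Prop
    extends IsRelaxationAt r k F N N' where
  isBase_wall_iff : ∀ B, P.toMatroid.IsBase B ↔ B.ncard = k ∧ (B ∩ F).ncard = r
  isBase_upper_iff : ∀ B, L.toMatroid.IsBase B ↔
    B.ncard = k ∧ ((B ∩ F).ncard = r ∨ (B ∩ F).ncard = r + 1)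

/-- A relaxation such that there are bases of `N'` on both sides of the level `r`. -/
structure IsSplitRelaxation (r k : ℕ) (F : Set E) (N N' L P : MatroidOn E) : Prop
    extends IsRelaxationSquare r k F N N' L P where
  exists_lt : ∃ B, N.toMatroid.IsBase B ∧ (B ∩ F).ncard < r
  exists_gt : ∃ B : Set E, B.ncard = k ∧ (B ∩ F).ncard = r + 1

namespace IsRelaxationSquare

variable {L P : MatroidOn E} (h : IsRelaxationSquare r k F N N' L P)
include h

omit [Finite E] in
theorem wall_subset_lower : basePolytope P ⊆ basePolytope N :=
  basePolytope_mono fun B hB => h.isBase_of_eq B ((h.isBase_wall_iff B).1 hB).1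
    ((h.isBase_wall_iff B).1 hB).2

omit [Finite E] in
theorem wall_subset_upper : basePolytope P ⊆ basePolytope L :=
  basePolytope_mono fun B hB => (h.isBase_upper_iff B).2
    ⟨((h.isBase_wall_iff B).1 hB).1, Or.inl ((h.isBase_wall_iff B).1 hB).2⟩

omit [Finite E] in
theorem lower_subset : basePolytope N ⊆ basePolytope N' :=
  basePolytope_mono fun B hB => (h.isBase_iff B).2 (Or.inl hB)

omit [Finite E] in
theorem upper_subset : basePolytope L ⊆ basePolytope N' :=
  basePolytope_mono fun B hB => (h.isBase_iff B).2 <| by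
    obtain ⟨h1, h2 | h2⟩ := (h.isBase_upper_iff B).1 hB
    · exact Or.inl (h.isBase_of_eq B h1 h2)
    · exact Or.inr ⟨h1, h2⟩

end IsRelaxationSquare

namespace IsSplitRelaxation

variable {L P : MatroidOn E} (h : IsSplitRelaxation r k F N N' L P)
include h

theorem level_le {x : E → ℝ} (hx : x ∈ basePolytope N) : level F x ≤ r := by
  refine convexHull_min (s := baseVectors N) (t := {x | level F x ≤ r}) ?_
    (convex_halfSpace_le (level F).isLinear _) hx
  rintro _ ⟨B, hB, rfl⟩
  rw [Set.mem_ofPred_eq, level_indicator]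
  exact_mod_cast h.inter_le B hB

theorem le_level {x : E → ℝ} (hx : x ∈ basePolytope L) : r ≤ level F x := by
  refine convexHull_min (s := baseVectors L) (t := {x | r ≤ level F x}) ?_
    (convex_halfSpace_ge (level F).isLinear _) hx
  rintro _ ⟨B, hB, rfl⟩
  rw [Set.mem_ofPred_eq, level_indicator]
  have := ((h.isBase_upper_iff B).1 hB).2
  exact_mod_cast (by omega : r ≤ (B ∩ F).ncard)

theorem level_eq {x : E → ℝ} (hx : x ∈ basePolytope P) : level F x = r :=
  le_antisymm (h.level_le (h.wall_subset_lower hx)) (h.le_level (h.wall_subset_upper hx))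

theorem exists_segment {x : E → ℝ} (hx : x ∈ basePolytope N') :
    ∃ u ∈ basePolytope N, ∃ w ∈ basePolytope L, ∃ q ∈ basePolytope P,
      (level F x ≤ r → x ∈ segment ℝ u q) ∧ (r ≤ level F x → x ∈ segment ℝ q w) := by
  have := Fintype.ofFinite E
  have hseg : ∀ u ∈ baseVectors N', ∀ w ∈ baseVectors N', level F u ≤ r → r < level F w →
      ∃ q ∈ basePolytope P,
        (level F w - r) • u + (r - level F u) • w = (level F w - level F u) • q := by
    rintro _ ⟨B₂, hB₂, rfl⟩ _ ⟨B₁, hB₁, rfl⟩ h₂ h₁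
    rw [level_indicator, Nat.cast_le] at h₂
    rw [level_indicator, Nat.cast_lt] at h₁
    have hB₁' := ((h.isBase_iff B₁).1 hB₁).resolve_left fun hh => by
      have := h.inter_le B₁ hh
      omega
    have hB₂' := ((h.isBase_iff B₂).1 hB₂).resolve_right (by omega)
    obtain ⟨n, hn⟩ := Nat.exists_eq_add_of_le h₂
    obtain ⟨q, hq, e⟩ := h.exists_mem_basePolytope
      (fun B h1 h2 => (h.isBase_wall_iff B).2 ⟨h1, h2⟩) n hB₁'.1 hB₁'.2 hB₂' hn.symm
    refine ⟨q, hq, ?_⟩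
    rw [level_indicator, level_indicator, hB₁'.2, hn]
    push_cast
    rw [show ((B₂ ∩ F).ncard + n + 1 - ((B₂ ∩ F).ncard + n) : ℝ) = 1 by ring,
      show ((B₂ ∩ F).ncard + n - (B₂ ∩ F).ncard : ℝ) = n by ring,
      show ((B₂ ∩ F).ncard + n + 1 - (B₂ ∩ F).ncard : ℝ) = n + 1 by ring, one_smul, e]
  have hlow : ∃ u ∈ baseVectors N', level F u ≤ r := by
    obtain ⟨B, hB, hl⟩ := h.exists_lt
    refine ⟨_, ⟨B, (h.isBase_iff B).2 (Or.inl hB), rfl⟩, ?_⟩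
    rw [level_indicator, Nat.cast_le]
    exact hl.le
  have hhigh : ∃ w ∈ baseVectors N', r < level F w := by
    obtain ⟨B, hB, hl⟩ := h.exists_gt
    refine ⟨_, ⟨B, (h.isBase_iff B).2 (Or.inr ⟨hB, hl⟩), rfl⟩, ?_⟩
    rw [level_indicator, Nat.cast_lt]
    omega
  obtain ⟨u, hu, w, hw, q, hq, h1, h2⟩ := exists_segment_of_mem_convexHull
    (convex_basePolytope P) hseg hlow hhigh hx
  refine ⟨u, convexHull_mono ?_ hu, w, convexHull_mono ?_ hw, q, hq, h1, h2⟩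
  · rintro _ ⟨⟨B, hB, rfl⟩, hl⟩
    rw [Set.mem_ofPred_eq, level_indicator, Nat.cast_le] at hl
    exact ⟨B, ((h.isBase_iff B).1 hB).resolve_right (by omega), rfl⟩
  · rintro _ ⟨⟨B, hB, rfl⟩, hl⟩
    rw [Set.mem_ofPred_eq, level_indicator, Nat.cast_lt] at hl
    have := ((h.isBase_iff B).1 hB).resolve_left fun hh => by
      have := h.inter_le B hh
      omega
    exact ⟨B, (h.isBase_upper_iff B).2 ⟨this.1, Or.inr this.2⟩, rfl⟩

theorem lower_eq : basePolytope N = basePolytope N' ∩ {x | level F x ≤ r} := by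
  refine subset_antisymm (fun x hx => ⟨h.lower_subset hx, h.level_le hx⟩) ?_
  rintro x ⟨hx, hl⟩
  obtain ⟨u, hu, w, hw, q, hq, h1, h2⟩ := h.exists_segment hx
  exact (convex_basePolytope N).segment_subset hu (h.wall_subset_lower hq) (h1 hl)

theorem upper_eq : basePolytope L = basePolytope N' ∩ {x | (r : ℝ) ≤ level F x} := by
  refine subset_antisymm (fun x hx => ⟨h.upper_subset hx, h.le_level hx⟩) ?_
  rintro x ⟨hx, hl⟩
  obtain ⟨u, hu, w, hw, q, hq, h1, h2⟩ := h.exists_segment hx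
  exact (convex_basePolytope L).segment_subset (h.wall_subset_upper hq) hw (h2 hl)

theorem isExposed_level_eq : IsExposed ℝ (basePolytope N) (basePolytope N ∩ {x | level F x = r}) := by
  rintro ⟨x₀, hx₀, hl₀⟩
  have hl₀ : level F x₀ = r := hl₀
  refine ⟨(level F).toContinuousLinearMap, ?_⟩
  ext x
  refine and_congr_right fun hx => ⟨fun hl y hy => ?_, fun hl => ?_⟩
  · have hl : level F x = r := hl
    change level F y ≤ level F x
    rw [hl]
    exact h.level_le hy
  · refine le_antisymm (h.level_le hx) ?_
    rw [← hl₀]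
    exact hl x₀ hx₀

/-- The slice is a face of the lower half, hence spanned by the base vectors of `N` that it
contains, and these are vertices of the wall. -/
theorem wall_eq : basePolytope P = basePolytope N' ∩ {x | level F x = r} := by
  refine subset_antisymm (fun x hx =>
    ⟨h.lower_subset (h.wall_subset_lower hx), h.level_eq hx⟩) ?_
  have := Fintype.ofFinite E
  rintro x ⟨hx, hl⟩
  have hxN : x ∈ basePolytope N ∩ {x | level F x = r} := by
    refine ⟨?_, hl⟩
    rw [h.lower_eq]
    exact ⟨hx, le_of_eq hl⟩
  rw [eq_convexHull_of_isExposed (finite_baseVectors N) h.isExposed_level_eq] at hxN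
  refine convexHull_mono ?_ hxN
  rintro _ ⟨⟨B, hB, rfl⟩, -, hlB⟩
  rw [Set.mem_ofPred_eq, level_indicator, Nat.cast_inj] at hlB
  exact ⟨B, (h.isBase_wall_iff B).2 ⟨h.ncard_eq B hB, hlB⟩, rfl⟩

theorem inter_eq : basePolytope N ∩ basePolytope L = basePolytope P := by
  rw [h.lower_eq, h.upper_eq, h.wall_eq]
  ext x
  simp only [Set.mem_inter_iff, Set.mem_ofPred_eq]
  exact ⟨fun hx => ⟨hx.1.1, le_antisymm hx.1.2 hx.2.2⟩, fun hx => ⟨⟨hx.1, hx.2.le⟩, hx.1, hx.2.ge⟩⟩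

theorem isExposed_wall_lower : IsExposed ℝ (basePolytope N) (basePolytope P) := by
  have h1 : basePolytope P = basePolytope N ∩ {x | level F x = r} := by
    refine subset_antisymm (fun x hx => ⟨h.wall_subset_lower hx, h.level_eq hx⟩) ?_
    rw [h.wall_eq]
    exact Set.inter_subset_inter_left _ h.lower_subset
  rw [h1]
  exact h.isExposed_level_eq

theorem isExposed_wall_upper : IsExposed ℝ (basePolytope L) (basePolytope P) := by
  intro hne
  refine ⟨-(level F).toContinuousLinearMap, ?_⟩
  obtain ⟨x₀, hx₀⟩ := hne
  ext x
  refine ⟨fun hx => ⟨h.wall_subset_upper hx, fun y hy => ?_⟩, fun hx => ?_⟩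
  · change -level F y ≤ -level F x
    rw [h.level_eq hx]
    exact neg_le_neg (h.le_level hy)
  · rw [h.wall_eq]
    refine ⟨h.upper_subset hx.1, le_antisymm ?_ (h.le_level hx.1)⟩
    have h1 : -level F x₀ ≤ -level F x := hx.2 x₀ (h.wall_subset_upper hx₀)
    rw [h.level_eq hx₀] at h1
    exact neg_le_neg_iff.1 h1

theorem exists_level_lt : ∃ u ∈ basePolytope N', level F u < r := by
  obtain ⟨B, hB, hl⟩ := h.exists_lt
  refine ⟨_, h.lower_subset (indicator_mem_basePolytope hB), ?_⟩
  rw [level_indicator, Nat.cast_lt]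
  exact hl

theorem exists_lt_level : ∃ u ∈ basePolytope N', (r : ℝ) < level F u := by
  obtain ⟨B, hB, hl⟩ := h.exists_gt
  refine ⟨_, indicator_mem_basePolytope ((h.isBase_iff B).2 (Or.inr ⟨hB, hl⟩)), ?_⟩
  rw [level_indicator, Nat.cast_lt]
  omega

end IsSplitRelaxation

/-- The faces of the base polytopes of two matroids. -/
def faces (N L : MatroidOn E) : Set (MatroidOn E) :=
  {K | IsExposed ℝ (basePolytope N) (basePolytope K) ∨
    IsExposed ℝ (basePolytope L) (basePolytope K)}

namespace IsSplitRelaxation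

variable {L P : MatroidOn E} (h : IsSplitRelaxation r k F N N' L P)
include h

/-- The one nontrivial intersection is that of a face of the lower half with a face of the upper
half. It lies in the wall, where both faces leave traces that are faces of the wall, and faces of
faces are faces. Empty intersections need no care, since `IsExposed` holds vacuously for them. -/
theorem isDecomposition : IsDecomposition (faces N L) N' := by
  have hmixed : ∀ Q R, IsExposed ℝ (basePolytope N) Q → IsExposed ℝ (basePolytope L) R →
      IsExposed ℝ Q (Q ∩ R) ∧ IsExposed ℝ R (Q ∩ R) := by
    intro Q R hQ hR
    have h1 : IsExposed ℝ (basePolytope P) (Q ∩ basePolytope P) :=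
      (hQ.inter h.isExposed_wall_lower).mono h.wall_subset_lower Set.inter_subset_right
    have h2 : IsExposed ℝ (basePolytope P) (R ∩ basePolytope P) :=
      (hR.inter h.isExposed_wall_upper).mono h.wall_subset_upper Set.inter_subset_right
    have h3 : Q ∩ R = (Q ∩ basePolytope P) ∩ (R ∩ basePolytope P) := by
      ext x
      refine ⟨fun hx => ?_, fun hx => ⟨hx.1.1, hx.2.1⟩⟩
      have : x ∈ basePolytope P := by
        rw [← h.inter_eq]
        exact ⟨hQ.subset hx.1, hR.subset hx.2⟩
      exact ⟨⟨hx.1, this⟩, hx.2, this⟩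
    have h4 : IsExposed ℝ (basePolytope P) (Q ∩ R) := by
      rw [h3]; exact h1.inter h2
    exact ⟨(isExposed_trans h.isExposed_wall_lower h4).mono hQ.subset Set.inter_subset_left,
      (isExposed_trans h.isExposed_wall_upper h4).mono hR.subset Set.inter_subset_right⟩
  refine ⟨?_, ?_, ?_⟩
  · rintro _ ⟨K, hK, rfl⟩ R hne hR
    obtain ⟨K', rfl⟩ := exists_basePolytope_eq_of_isExposed hR hne
    exact ⟨K', hK.imp (fun hK => isExposed_trans hK hR) (fun hK => isExposed_trans hK hR), rfl⟩
  · rintro _ ⟨K, hK, rfl⟩ _ ⟨K', hK', rfl⟩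
    rcases hK with hK | hK <;> rcases hK' with hK' | hK'
    · have := hK.inter hK'
      exact ⟨this.mono hK.subset Set.inter_subset_left,
        this.mono hK'.subset Set.inter_subset_right⟩
    · exact hmixed _ _ hK hK'
    · have := hmixed _ _ hK' hK
      rw [Set.inter_comm]
      exact ⟨this.2, this.1⟩
    · have := hK.inter hK'
      exact ⟨this.mono hK.subset Set.inter_subset_left,
        this.mono hK'.subset Set.inter_subset_right⟩
  · refine subset_antisymm (fun x hx => ?_) ?_
    · rcases le_total (level F x) r with hl | hl
      · exact ⟨_, ⟨N, Or.inl (IsExposed.refl _), rfl⟩, by rw [h.lower_eq]; exact ⟨hx, hl⟩⟩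
      · exact ⟨_, ⟨L, Or.inr (IsExposed.refl _), rfl⟩, by rw [h.upper_eq]; exact ⟨hx, hl⟩⟩
    · rintro x ⟨_, ⟨K, hK | hK, rfl⟩, hx⟩
      · exact h.lower_subset (hK.subset hx)
      · exact h.upper_subset (hK.subset hx)

/-- One such point controls the whole complex: it shows that the wall and both halves are internal,
and that the halves have full dimension and the wall has codimension one. -/
theorem exists_interior_wall : ∃ x ∈ intrinsicInterior ℝ (basePolytope N'), x ∈ basePolytope P := by
  have := Fintype.ofFinite E
  obtain ⟨x, hx, hl⟩ := exists_mem_intrinsicInterior_eq (convex_basePolytope N')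
    h.exists_level_lt h.exists_lt_level
  refine ⟨x, hx, ?_⟩
  rw [h.wall_eq]
  exact ⟨intrinsicInterior_subset hx, hl⟩

theorem not_subset_frontier {K : MatroidOn E} (hK : basePolytope P ⊆ basePolytope K) :
    ¬ basePolytope K ⊆ intrinsicFrontier ℝ (basePolytope N') := by
  intro hcon
  obtain ⟨x, hx, hxP⟩ := h.exists_interior_wall
  obtain ⟨y, hy, rfl⟩ := hx
  obtain ⟨z, hz, hzy⟩ := hcon (hK hxP)
  obtain rfl : z = y := Subtype.ext hzy
  exact hz.2 hy

theorem dimension_lower : dimension (basePolytope N) = dimension (basePolytope N') := by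
  have := Fintype.ofFinite E
  obtain ⟨x, hx, hxP⟩ := h.exists_interior_wall
  rw [dimension, dimension, h.lower_eq, vectorSpan_inter_le hx (h.level_eq hxP)]

theorem dimension_upper : dimension (basePolytope L) = dimension (basePolytope N') := by
  have := Fintype.ofFinite E
  obtain ⟨x, hx, hxP⟩ := h.exists_interior_wall
  have h1 : {x | (r : ℝ) ≤ level F x} = {x | (-level F) x ≤ -(r : ℝ)} := by
    ext y
    simp
  rw [dimension, dimension, h.upper_eq, h1, vectorSpan_inter_le hx]
  rw [LinearMap.neg_apply, h.level_eq hxP]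

theorem dimension_eq : dimension (basePolytope N') = dimension (basePolytope P) + 1 := by
  have := Fintype.ofFinite E
  obtain ⟨x, hx, hxP⟩ := h.exists_interior_wall
  rw [dimension, dimension, h.wall_eq]
  exact finrank_vectorSpan_inter_eq (convex_basePolytope N') hx (h.level_eq hxP)
    h.exists_lt_level

/-- An internal face contains a relative interior point of the polytope of `N'`. The only faces of a
half through such a point are the half itself and the wall. -/
theorem eq_of_mem_faces {K : MatroidOn E} (hK : K ∈ faces N L)
    (hfr : ¬ basePolytope K ⊆ intrinsicFrontier ℝ (basePolytope N')) : K = N ∨ K = L ∨ K = P := by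
  have := Fintype.ofFinite E
  obtain ⟨x, hxK, hxf⟩ := Set.not_subset.1 hfr
  have hKN' : basePolytope K ⊆ basePolytope N' := by
    rcases hK with hK | hK
    · exact hK.subset.trans h.lower_subset
    · exact hK.subset.trans h.upper_subset
  have hx : x ∈ intrinsicInterior ℝ (basePolytope N') := by
    have h1 := subset_intrinsicClosure (𝕜 := ℝ) (hKN' hxK)
    rw [← intrinsicInterior_union_intrinsicFrontier] at h1
    exact h1.resolve_right hxf
  rcases hK with hK | hK
  · rw [h.lower_eq] at hK
    rcases eq_of_isExposed_inter_le (convex_basePolytope N') hx hK hxK with h1 | h1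
    · exact Or.inl (basePolytope_injective (h1.trans h.lower_eq.symm))
    · exact Or.inr (Or.inr (basePolytope_injective (h1.trans h.wall_eq.symm)))
  -- The upper half is a lower half for the opposite functional.
  · have e1 : {x | (r : ℝ) ≤ level F x} = {x | (-level F) x ≤ -(r : ℝ)} := by
      ext y
      simp
    have e2 : {x | level F x = r} = {x | (-level F) x = -(r : ℝ)} := by
      ext y
      simp
    rw [h.upper_eq, e1] at hK
    rcases eq_of_isExposed_inter_le (convex_basePolytope N') hx hK hxK with h1 | h1
    · rw [← e1] at h1
      exact Or.inr (Or.inl (basePolytope_injective (h1.trans h.upper_eq.symm)))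
    · rw [← e2] at h1
      exact Or.inr (Or.inr (basePolytope_injective (h1.trans h.wall_eq.symm)))

/-- With `m` the dimension of the wall, the complex lives in degrees `m`, `m + 1` and `m + 2`: the
wall, the two halves, and `N'` itself in the extra degree above its dimension `m + 1`. -/
theorem cells_wall : cells (faces N L) N' (dimension (basePolytope P)) = {P} := by
  ext K
  constructor
  · rintro (⟨hK, hfr, hd⟩ | ⟨-, hd⟩)
    · have := h.dimension_lower
      have := h.dimension_upper
      have := h.dimension_eq
      rcases h.eq_of_mem_faces hK hfr with rfl | rfl | rfl
      · omega
      · omega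
      · rfl
    · have := h.dimension_eq
      omega
  · rintro rfl
    exact Or.inl ⟨Or.inl h.isExposed_wall_lower, h.not_subset_frontier subset_rfl, rfl⟩

theorem cells_top : cells (faces N L) N' (dimension (basePolytope P) + 1) = {N, L} := by
  have h1 := h.dimension_lower
  have h2 := h.dimension_upper
  have h3 := h.dimension_eq
  ext K
  constructor
  · rintro (⟨hK, hfr, hd⟩ | ⟨-, hd⟩)
    · rcases h.eq_of_mem_faces hK hfr with rfl | rfl | rfl
      · exact Or.inl rfl
      · exact Or.inr rfl
      · omega
    · omega
  · rintro (rfl | rfl)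
    · exact Or.inl ⟨Or.inl (IsExposed.refl _), h.not_subset_frontier h.wall_subset_lower, by omega⟩
    · exact Or.inl ⟨Or.inr (IsExposed.refl _), h.not_subset_frontier h.wall_subset_upper, by omega⟩

theorem cells_total : cells (faces N L) N' (dimension (basePolytope P) + 2) = {N'} := by
  have h1 := h.dimension_lower
  have h2 := h.dimension_upper
  have h3 := h.dimension_eq
  ext K
  constructor
  · rintro (⟨hK, hfr, hd⟩ | ⟨hK, -⟩)
    · rcases h.eq_of_mem_faces hK hfr with rfl | rfl | rfl <;> omega
    · exact hK
  · rintro rfl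
    exact Or.inr ⟨rfl, by omega⟩

theorem cells_eq_empty {n : ℕ} (hn : n < dimension (basePolytope P) ∨
    dimension (basePolytope P) + 2 < n) : cells (faces N L) N' n = ∅ := by
  have h1 := h.dimension_lower
  have h2 := h.dimension_upper
  have h3 := h.dimension_eq
  refine Set.eq_empty_of_forall_notMem ?_
  rintro K (⟨hK, hfr, hd⟩ | ⟨-, hd⟩)
  · rcases h.eq_of_mem_faces hK hfr with rfl | rfl | rfl <;> omega
  · omega

omit [Finite E] in
theorem lower_ne_upper : N ≠ L := by
  rintro rfl
  obtain ⟨B, hB, hl⟩ := h.exists_lt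
  have := ((h.isBase_upper_iff B).1 hB).2
  omega

end IsSplitRelaxation

end relaxationAt

/-! ### Bicartesian squares -/

section squares

/-- The square with sides `α`, `β`, `γ`, `δ` is both cartesian and cocartesian. -/
structure IsBicartesian {X Y Z W : Type*} [AddCommGroup X] [AddCommGroup Y] [AddCommGroup Z]
    [AddCommGroup W] [Module ℚ X] [Module ℚ Y] [Module ℚ Z] [Module ℚ W]
    (α : X →ₗ[ℚ] Y) (β : X →ₗ[ℚ] Z) (γ : Y →ₗ[ℚ] W) (δ : Z →ₗ[ℚ] W) : Prop where
  eq_zero : ∀ x, α x = 0 → β x = 0 → x = 0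
  exists_lift : ∀ y z, γ y = δ z → ∃ x, α x = y ∧ β x = z
  exists_add : ∀ w, ∃ y z, γ y + δ z = w

variable {X Y Z W : Type*} [AddCommGroup X] [AddCommGroup Y] [AddCommGroup Z]
    [AddCommGroup W] [Module ℚ X] [Module ℚ Y] [Module ℚ Z] [Module ℚ W]
    {α : X →ₗ[ℚ] Y} {β : X →ₗ[ℚ] Z} {γ : Y →ₗ[ℚ] W} {δ : Z →ₗ[ℚ] W}

/-- This and its mirror image serve the degenerate relaxations, in which the hyperplane does not cut
the polytope. -/
theorem isBicartesian_of_bijective_left (hcomm : ∀ x, γ (α x) = δ (β x))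
    (hα : Function.Bijective α) (hδ : Function.Bijective δ) : IsBicartesian α β γ δ where
  eq_zero x hx _ := hα.1 (by rw [hx, map_zero])
  exists_lift y z h := by
    obtain ⟨x, rfl⟩ := hα.2 y
    exact ⟨x, rfl, hδ.1 (by rw [← h, hcomm])⟩
  exists_add w := by
    obtain ⟨z, rfl⟩ := hδ.2 w
    exact ⟨0, z, by simp⟩

theorem isBicartesian_of_bijective_right (hcomm : ∀ x, γ (α x) = δ (β x))
    (hβ : Function.Bijective β) (hγ : Function.Bijective γ) : IsBicartesian α β γ δ where
  eq_zero x _ hx := hβ.1 (by rw [hx, map_zero])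
  exists_lift y z h := by
    obtain ⟨x, rfl⟩ := hβ.2 z
    exact ⟨x, hγ.1 (by rw [h, hcomm]), rfl⟩
  exists_add w := by
    obtain ⟨z, rfl⟩ := hγ.2 w
    exact ⟨z, 0, by simp⟩

/-- A contracting homotopy of the complex given by a commutative square with arbitrary signs makes
the square bicartesian. -/
theorem isBicartesian_of_homotopy (hcomm : ∀ x, γ (α x) = δ (β x)) {ε₁ ε₂ ε₃ ε₄ : ℚ}
    (h₁ : ε₁ = 1 ∨ ε₁ = -1) (h₂ : ε₂ = 1 ∨ ε₂ = -1) (h₃ : ε₃ = 1 ∨ ε₃ = -1)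
    (h₄ : ε₄ = 1 ∨ ε₄ = -1) (s : Y →ₗ[ℚ] X) (s' : Z →ₗ[ℚ] X) (t : W →ₗ[ℚ] Y) (t' : W →ₗ[ℚ] Z)
    (e₁ : ∀ x, s (ε₁ • α x) + s' (ε₂ • β x) = x)
    (e₂ : ∀ y, t (ε₃ • γ y) + ε₁ • α (s y) = y)
    (e₃ : ∀ y, t' (ε₃ • γ y) + ε₂ • β (s y) = 0)
    (e₄ : ∀ z, t (ε₄ • δ z) + ε₁ • α (s' z) = 0)
    (e₅ : ∀ z, t' (ε₄ • δ z) + ε₂ • β (s' z) = z)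
    (e₆ : ∀ w, ε₃ • γ (t w) + ε₄ • δ (t' w) = w) : IsBicartesian α β γ δ := by
  -- The homotopy lifts a cycle `(y, z)` of the signed complex to `s y + s' z`.
  have lift : ∀ y z, ε₃ • γ y + ε₄ • δ z = 0 → ∃ x, ε₁ • α x = y ∧ ε₂ • β x = z := by
    intro y z h
    have h5 : ε₄ • δ z = -(ε₃ • γ y) := (neg_eq_of_add_eq_zero_right h).symm
    refine ⟨s y + s' z, ?_, ?_⟩
    · have h6 := e₄ z
      rw [h5, map_neg] at h6
      rw [map_add, smul_add]
      calc ε₁ • α (s y) + ε₁ • α (s' z)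
          = (t (ε₃ • γ y) + ε₁ • α (s y)) + (-t (ε₃ • γ y) + ε₁ • α (s' z)) := by abel
        _ = y := by rw [h6, e₂, add_zero]
    · have h6 := e₅ z
      rw [h5, map_neg] at h6
      rw [map_add, smul_add]
      calc ε₂ • β (s y) + ε₂ • β (s' z)
          = (t' (ε₃ • γ y) + ε₂ • β (s y)) + (-t' (ε₃ • γ y) + ε₂ • β (s' z)) := by abel
        _ = z := by rw [h6, e₃, zero_add]
  refine ⟨?_, ?_, ?_⟩
  · intro x hα hβ
    rw [← e₁ x, hα, hβ]
    simp
  · -- if the signs are such that the square with signs commutes, its diagonal vanishes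
    have hd : ∀ {u : W}, u = -u → u = 0 := fun {u} hu => by
      have h2 : (2 : ℚ) • u = 0 := by
        rw [two_smul]; nth_rewrite 2 [hu]; exact add_neg_cancel u
      exact (smul_eq_zero.1 h2).resolve_left two_ne_zero
    -- No compatibility between the four signs is assumed, so the signed lifting property yields a
    -- lift of `y` and `z` only up to the sign of `z`. This avoids all computation with
    -- orientations.
    have split : ∀ y z, γ y = δ z → (∃ x, α x = y ∧ β x = z) ∨
        (∃ x, α x = y ∧ β x = -z) := by
      intro y z h
      have : ∃ σ : ℚ, (σ = 1 ∨ σ = -1) ∧ ε₃ • γ y + ε₄ • δ (σ • z) = 0 := by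
        rcases h₃ with rfl | rfl <;> rcases h₄ with rfl | rfl
        · exact ⟨-1, Or.inr rfl, by simp [h]⟩
        · exact ⟨1, Or.inl rfl, by simp [h]⟩
        · exact ⟨1, Or.inl rfl, by simp [h]⟩
        · exact ⟨-1, Or.inr rfl, by simp [h]⟩
      obtain ⟨σ, hσ, h0⟩ := this
      obtain ⟨x, hx1, hx2⟩ := lift y (σ • z) h0
      rcases h₁ with rfl | rfl <;> rcases h₂ with rfl | rfl <;> rcases hσ with rfl | rfl <;>
        simp only [one_smul, neg_smul] at hx1 hx2
      · exact Or.inl ⟨x, hx1, hx2⟩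
      · exact Or.inr ⟨x, hx1, hx2⟩
      · exact Or.inr ⟨x, hx1, by rw [← hx2, neg_neg]⟩
      · exact Or.inl ⟨x, hx1, neg_injective hx2⟩
      · exact Or.inr ⟨-x, by rw [map_neg, hx1], by rw [map_neg, hx2]⟩
      · exact Or.inl ⟨-x, by rw [map_neg, hx1], by rw [map_neg, hx2, neg_neg]⟩
      · exact Or.inl ⟨-x, by rw [map_neg, hx1], by rw [map_neg, hx2]⟩
      · exact Or.inr ⟨-x, by rw [map_neg, hx1], by rw [map_neg, hx2]⟩
    intro y z h
    rcases split y z h with h' | ⟨x, hx1, hx2⟩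
    · exact h'
    -- With the wrong sign, commutativity gives `δ z = -δ z`. Both images in `W` then vanish, so
    -- `(y, 0)` and `(0, z)` are cycles whatever the signs, and they can be lifted separately.
    · have h5 : δ z = 0 := hd (by
        rw [← map_neg δ, ← hx2, ← hcomm, hx1, h])
      have h6 : γ y = 0 := by rw [h, h5]
      obtain ⟨x', hx1', hx2'⟩ := lift y 0 (by simp [h6])
      obtain ⟨x'', hx1'', hx2''⟩ := lift 0 z (by simp [h5])
      refine ⟨ε₁ • x' + ε₂ • x'', ?_, ?_⟩
      · rw [map_add, map_smul, map_smul, hx1']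
        have : α x'' = 0 := by
          rcases h₁ with rfl | rfl <;> simpa using hx1''
        rw [this, smul_zero, add_zero]
      · rw [map_add, map_smul, map_smul, hx2'']
        have : β x' = 0 := by
          rcases h₂ with rfl | rfl <;> simpa using hx2'
        rw [this, smul_zero, zero_add]
  · intro w
    exact ⟨ε₃ • t w, ε₄ • t' w, by rw [map_smul, map_smul, e₆]⟩

end squares

/-! ### Components of contracting homotopies -/

section components

theorem sum_coe_of_eq_singleton {α M : Type*} [AddCommMonoid M] {s : Set α} [Fintype s] {a : α}
    (hs : s = {a}) (ha : a ∈ s) (G : s → M) : ∑ z, G z = G ⟨a, ha⟩ := by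
  subst hs
  exact Fintype.sum_eq_single _ fun z hz => absurd (Subtype.ext (Set.mem_singleton_iff.1 z.2)) hz

theorem sum_coe_of_eq_pair {α M : Type*} [AddCommMonoid M] {s : Set α} [Fintype s] {a b : α}
    (hs : s = {a, b}) (hab : a ≠ b) (ha : a ∈ s) (hb : b ∈ s) (G : s → M) :
    ∑ z, G z = G ⟨a, ha⟩ + G ⟨b, hb⟩ := by
  subst hs
  refine Fintype.sum_eq_add _ _ (fun h => hab (congrArg Subtype.val h)) ?_
  rintro ⟨z, rfl | rfl⟩ ⟨h1, h2⟩
  · exact absurd rfl h1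
  · exact absurd rfl h2

theorem sum_coe_of_eq_empty {α M : Type*} [AddCommMonoid M] {s : Set α} [Fintype s]
    (hs : s = ∅) (G : s → M) : ∑ z, G z = 0 := by
  subst hs
  exact Fintype.sum_empty _

variable {D : Type 1} [Category.{0} D] [Preadditive D] [HasFiniteBiproducts D]
  {J : ℕ → Type} [∀ k, Fintype (J k)] (f : ∀ k, J k → D)
  (d : ∀ k (i : J (k + 1)) (j : J k), f (k + 1) i ⟶ f k j)

/-- A morphism between biproducts is a matrix, so the homotopy can be read off entry by entry; this
isolates the few entries belonging to the nonzero cells. -/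
theorem IsContractible.exists_components
    (h : IsContractible (fun k => ⨁ f k) (fun k => biproduct.matrix (d k))) :
    ∃ s : ∀ k (i : J k) (j : J (k + 1)), f k i ⟶ f (k + 1) j,
      (∀ i j, ∑ l, s 0 i l ≫ d 0 l j = biproduct.ι (f 0) i ≫ biproduct.π (f 0) j) ∧
      ∀ k i j, ∑ l, d k i l ≫ s k l j + ∑ l, s (k + 1) i l ≫ d (k + 1) l j =
        biproduct.ι (f (k + 1)) i ≫ biproduct.π (f (k + 1)) j := by
  obtain ⟨s, h0, hs⟩ := h
  obtain ⟨c, rfl⟩ : ∃ c : ∀ k (i : J k) (j : J (k + 1)), f k i ⟶ f (k + 1) j,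
      s = fun k => biproduct.matrix (c k) :=
    ⟨fun k => biproduct.components (s k), funext fun k => (biproduct.components_matrix (s k)).symm⟩
  refine ⟨c, fun i j => ?_, fun k i j => ?_⟩
  · have h1 := congrArg (fun g => biproduct.ι (f 0) i ≫ g ≫ biproduct.π (f 0) j) h0
    simp only [Category.id_comp] at h1
    rw [← h1]
    simp [biproduct.lift_desc]
  · have h1 := congrArg (fun g => biproduct.ι (f (k + 1)) i ≫ g ≫ biproduct.π (f (k + 1)) j) (hs k)
    simp only [Category.id_comp] at h1
    rw [← h1]
    simp [biproduct.lift_desc]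

end components

/-! ### Orientations exist -/

section orientations

variable {E : Type} [Finite E]

/-- The top exterior power is a line and embeds in the ambient exterior algebra. This provides some
orientation of every polytope, without which valuativity could not be applied. -/
theorem nontrivial_topPower (W : Submodule ℝ (E → ℝ)) : Nontrivial (topPower W) := by
  have h1 : finrank ℝ (⋀[ℝ]^(finrank ℝ W) W) = 1 := by
    rw [exteriorPower.finrank_eq, Nat.choose_self]
  have h2 : Nontrivial (⋀[ℝ]^(finrank ℝ W) W) :=
    Module.nontrivial_of_finrank_pos (R := ℝ) (by rw [h1]; exact one_pos)
  obtain ⟨x, hx⟩ := exists_ne (0 : ⋀[ℝ]^(finrank ℝ W) W)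
  refine ⟨⟨_, Submodule.mem_map_of_mem x.2⟩, 0, fun h => hx ?_⟩
  have h3 : ExteriorAlgebra.map W.subtype (x : ExteriorAlgebra ℝ W) = 0 := congrArg Subtype.val h
  have h4 : Function.Injective (ExteriorAlgebra.map W.subtype) :=
    ExteriorAlgebra.map_injective_field (LinearMap.ker_eq_bot.2 W.injective_subtype)
  exact Subtype.ext (h4 (by rw [h3, Submodule.coe_zero, map_zero]))

instance nonempty_polytopeOrientation (P : Set (E → ℝ)) : Nonempty (PolytopeOrientation P) := by
  have := nontrivial_topPower (vectorSpan ℝ P)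
  obtain ⟨x, hx⟩ := exists_ne (0 : topPower (vectorSpan ℝ P))
  exact ⟨rayOfNeZero ℝ x hx⟩

instance nonempty_decompositionOrientation (M : MatroidOn E) :
    Nonempty (DecompositionOrientation M) :=
  ⟨⟨fun _ => Classical.arbitrary _, Classical.arbitrary _⟩⟩

end orientations

/-! ### Valuative functors and single relaxations -/

section valuative

variable {E : Type} [Finite E]

variable {A : Type} (Φ : MatroidCat ⥤ GrVect A) (a : A)

/-- The degree `a` part of the value of a functor at an object. -/
abbrev piece (X : MatroidCat) : Type := ((Φ.obj X).obj a : Type)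

/-- The degree `a` part of the value of a functor at a morphism. -/
def pieceMap {X Y : MatroidCat} (f : X ⟶ Y) : piece Φ a X →ₗ[ℚ] piece Φ a Y :=
  ((Φ.map f).hom a).hom

theorem pieceMap_id (X : MatroidCat) : pieceMap Φ a (𝟙 X) = LinearMap.id := by
  rw [pieceMap, Φ.map_id]
  rfl

theorem pieceMap_comp {X Y Z : MatroidCat} (f : X ⟶ Y) (g : Y ⟶ Z) (x : piece Φ a X) :
    pieceMap Φ a (f ≫ g) x = pieceMap Φ a g (pieceMap Φ a f x) := by
  rw [pieceMap, Φ.map_comp]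
  rfl

/-- The morphism given by the identity. -/
def iota {X Y : MatroidOn E} (h : basePolytope Y ⊆ basePolytope X) :
    MatroidCat.mk E X ⟶ MatroidCat.mk E Y :=
  (MatroidId.inclusion E).map (X := MatroidId.mk X) (Y := MatroidId.mk Y) ⟨h⟩

theorem iota_comp {X Y Z : MatroidOn E} (h : basePolytope Y ⊆ basePolytope X)
    (h' : basePolytope Z ⊆ basePolytope Y) : iota h ≫ iota h' = iota (h'.trans h) := rfl

theorem iota_self {X : MatroidOn E} (h : basePolytope X ⊆ basePolytope X) :
    iota h = 𝟙 (MatroidCat.mk E X) := rfl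

theorem pieceMap_iota_comp {X Y Z : MatroidOn E} (h : basePolytope Y ⊆ basePolytope X)
    (h' : basePolytope Z ⊆ basePolytope Y) (x : piece Φ a ⟨E, X⟩) :
    pieceMap Φ a (iota h') (pieceMap Φ a (iota h) x) = pieceMap Φ a (iota (h'.trans h)) x := by
  rw [← iota_comp h h', pieceMap_comp]

theorem bijective_pieceMap_iota {X Y : MatroidOn E} (h : basePolytope Y ⊆ basePolytope X)
    (hXY : X = Y) : Function.Bijective (pieceMap Φ a (iota h)) := by
  subst hXY
  rw [iota_self, pieceMap_id]
  exact Function.bijective_id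

/-- The component of the differential of the image of the complex of a decomposition. -/
def incidenceMap {M : MatroidOn E} (Ω : DecompositionOrientation M) (k : ℕ) (X Y : MatroidOn E) :
    Φ.obj ⟨E, X⟩ ⟶ Φ.obj ⟨E, Y⟩ :=
  (Free.lift ℚ (MatroidId.inclusion E ⋙ Φ)).map (incidence Ω k X Y)

theorem lift_map_smul_embedding {C D : Type 1} [Category.{0} C] [Category.{0} D] [Preadditive D]
    [Linear ℚ D] (G : C ⥤ D) {X Y : C} (c : ℚ) (f : X ⟶ Y) :
    (Free.lift ℚ G).map (c • (Free.embedding ℚ C).map f) = c • G.map f := by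
  rw [Functor.map_smul]
  congr 1
  exact (Free.lift_map_single ℚ G f 1).trans (one_smul ℚ _)

omit [Finite E] in
-- The only information about orientations that survives: every relevant coefficient is a sign.
theorem exists_incidence_eq {M : MatroidOn E} (Ω : DecompositionOrientation M) {k : ℕ}
    {X Y : MatroidOn E} (h : basePolytope Y ⊆ basePolytope X)
    (hk : k = dimension (basePolytope M) ∨ IsExposed ℝ (basePolytope X) (basePolytope Y)) :
    ∃ ε : ℚ, (ε = 1 ∨ ε = -1) ∧ incidence Ω k X Y =
      ε • (Free.embedding ℚ (MatroidId E)).map (X := MatroidId.mk X) (Y := MatroidId.mk Y) ⟨h⟩ := by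
  classical
  refine ⟨_, ?_, dif_pos h⟩
  split_ifs <;> simp_all

theorem exists_incidenceMap_eq {M : MatroidOn E} (Ω : DecompositionOrientation M) {k : ℕ}
    {X Y : MatroidOn E} (h : basePolytope Y ⊆ basePolytope X)
    (hk : k = dimension (basePolytope M) ∨ IsExposed ℝ (basePolytope X) (basePolytope Y)) :
    ∃ ε : ℚ, (ε = 1 ∨ ε = -1) ∧ incidenceMap Φ Ω k X Y = ε • Φ.map (iota h) := by
  obtain ⟨ε, hε, e⟩ := exists_incidence_eq Ω h hk
  exact ⟨ε, hε, (congrArg _ e).trans (lift_map_smul_embedding (MatroidId.inclusion E ⋙ Φ) ε _)⟩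

/-- The degree `a` part of a morphism of graded vector spaces. -/
def evalHom {X Y : GrVect A} (f : X ⟶ Y) : (X.obj a : Type) →ₗ[ℚ] (Y.obj a : Type) := (f.hom a).hom

variable {Φ} {r k : ℕ} {F : Set E} {N N' L P : MatroidOn E}

/-- The complex has three nonzero terms, and the homotopy identities in these degrees are the six
equations required by `isBicartesian_of_homotopy`: one for `N'`, four for the pair `N`, `L`, and one
for the wall. -/
theorem IsSplitRelaxation.isBicartesian (hΦ : IsValuative Φ)
    (h : IsSplitRelaxation r k F N N' L P) :
    IsBicartesian (pieceMap Φ a (iota h.lower_subset)) (pieceMap Φ a (iota h.upper_subset))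
      (pieceMap Φ a (iota h.wall_subset_lower)) (pieceMap Φ a (iota h.wall_subset_upper)) := by
  obtain ⟨Ω⟩ := nonempty_decompositionOrientation N'
  have hc := hΦ E N' (faces N L) Ω h.isDecomposition
  -- The additive extension sends a formal sum to a biproduct and a formal matrix to a matrix by
  -- definition, so `hc` has the required form.
  obtain ⟨s, hs0, hs⟩ := IsContractible.exists_components
    (J := fun k => cells (faces N L) N' k)
    (fun k i => Φ.obj ⟨E, i.1⟩)
    (fun k i j => incidenceMap Φ Ω k i.1 j.1) hc
  set m := dimension (basePolytope P) with hm
  have c0 := h.cells_wall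
  have c1 := h.cells_top
  have c2 := h.cells_total
  have c3 := h.cells_eq_empty (n := m + 3) (by omega)
  rw [← hm] at c0 c1 c2
  have mP : P ∈ cells (faces N L) N' m := by rw [c0]; rfl
  have mN : N ∈ cells (faces N L) N' (m + 1) := by rw [c1]; exact Or.inl rfl
  have mL : L ∈ cells (faces N L) N' (m + 1) := by rw [c1]; exact Or.inr rfl
  have mN' : N' ∈ cells (faces N L) N' (m + 2) := by rw [c2]; rfl
  have hNL := h.lower_ne_upper
  have hd := h.dimension_eq
  obtain ⟨ε₁, h₁, i₁⟩ := exists_incidenceMap_eq Φ Ω (k := m + 1) h.lower_subset (Or.inl hd.symm)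
  obtain ⟨ε₂, h₂, i₂⟩ := exists_incidenceMap_eq Φ Ω (k := m + 1) h.upper_subset (Or.inl hd.symm)
  obtain ⟨ε₃, h₃, i₃⟩ := exists_incidenceMap_eq Φ Ω (k := m) h.wall_subset_lower
    (Or.inr h.isExposed_wall_lower)
  obtain ⟨ε₄, h₄, i₄⟩ := exists_incidenceMap_eq Φ Ω (k := m) h.wall_subset_upper
    (Or.inr h.isExposed_wall_upper)
  have E2 := hs (m + 1) ⟨N', mN'⟩ ⟨N', mN'⟩
  rw [sum_coe_of_eq_empty c3, sum_coe_of_eq_pair c1 hNL mN mL, add_zero, biproduct.ι_π_self] at E2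
  have E1 : ∀ i j, _ := hs m
  simp only [sum_coe_of_eq_singleton c0 mP, sum_coe_of_eq_singleton c2 mN'] at E1
  have E0 : s m ⟨P, mP⟩ ⟨N, mN⟩ ≫ incidenceMap Φ Ω m N P +
      s m ⟨P, mP⟩ ⟨L, mL⟩ ≫ incidenceMap Φ Ω m L P = 𝟙 _ := by
    -- In degree zero the homotopy identity has no term from below and is a separate equation; in
    -- positive degree that term is an empty sum.
    obtain hm0 | ⟨m', hm'⟩ : m = 0 ∨ ∃ m', m = m' + 1 := by
      cases m with
      | zero => exact Or.inl rfl
      | succ m' => exact Or.inr ⟨m', rfl⟩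
    · clear_value m
      subst hm0
      have := hs0 ⟨P, mP⟩ ⟨P, mP⟩
      rwa [sum_coe_of_eq_pair c1 hNL mN mL, biproduct.ι_π_self] at this
    · have c4 := h.cells_eq_empty (n := m') (by omega)
      clear_value m
      subst hm'
      have := hs m' ⟨P, mP⟩ ⟨P, mP⟩
      rwa [sum_coe_of_eq_pair c1 hNL mN mL, biproduct.ι_π_self, sum_coe_of_eq_empty c4,
        zero_add] at this
  have E11 := E1 ⟨N, mN⟩ ⟨N, mN⟩
  have E12 := E1 ⟨N, mN⟩ ⟨L, mL⟩
  have E21 := E1 ⟨L, mL⟩ ⟨N, mN⟩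
  have E22 := E1 ⟨L, mL⟩ ⟨L, mL⟩
  rw [biproduct.ι_π_self] at E11 E22
  rw [biproduct.ι_π_ne _ (fun hh => hNL (congrArg Subtype.val hh))] at E12
  rw [biproduct.ι_π_ne _ (fun hh => hNL (congrArg Subtype.val hh).symm)] at E21
  dsimp only at E2 E11 E12 E21 E22
  rw [i₁, i₂] at E2
  rw [i₃, i₄] at E0
  rw [i₃, i₁] at E11
  rw [i₃, i₂] at E12
  rw [i₄, i₁] at E21
  rw [i₄, i₂] at E22
  refine isBicartesian_of_homotopy (fun x => ?_) h₁ h₂ h₃ h₄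
    (evalHom a (s (m + 1) ⟨N, mN⟩ ⟨N', mN'⟩)) (evalHom a (s (m + 1) ⟨L, mL⟩ ⟨N', mN'⟩))
    (evalHom a (s m ⟨P, mP⟩ ⟨N, mN⟩)) (evalHom a (s m ⟨P, mP⟩ ⟨L, mL⟩))
    (fun x => LinearMap.congr_fun (congrArg (evalHom a) E2) x)
    (fun x => LinearMap.congr_fun (congrArg (evalHom a) E11) x)
    (fun x => LinearMap.congr_fun (congrArg (evalHom a) E12) x)
    (fun x => LinearMap.congr_fun (congrArg (evalHom a) E21) x)
    (fun x => LinearMap.congr_fun (congrArg (evalHom a) E22) x)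
    (fun x => LinearMap.congr_fun (congrArg (evalHom a) E0) x)
  rw [pieceMap_iota_comp, pieceMap_iota_comp]

end valuative

/-! ### Iterated relaxations -/

section iteration

variable {E A : Type} [Finite E] {Φ : MatroidCat ⥤ GrVect A} (a : A) {r k : ℕ}

/-- If the cusp is empty, then `N' = N` and `L = P`; if no base of `N` lies below level `r`, then `N
= P` and `N' = L`. In both cases a pair of parallel sides consists of identities. -/
theorem IsRelaxationSquare.isBicartesian {F : Set E} {N N' L P : MatroidOn E}
    (hΦ : IsValuative Φ) (h : IsRelaxationSquare r k F N N' L P) :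
    IsBicartesian (pieceMap Φ a (iota h.lower_subset)) (pieceMap Φ a (iota h.upper_subset))
      (pieceMap Φ a (iota h.wall_subset_lower)) (pieceMap Φ a (iota h.wall_subset_upper)) := by
  have hcomm : ∀ x, pieceMap Φ a (iota h.wall_subset_lower) (pieceMap Φ a (iota h.lower_subset) x) =
      pieceMap Φ a (iota h.wall_subset_upper) (pieceMap Φ a (iota h.upper_subset) x) := fun x => by
    rw [pieceMap_iota_comp, pieceMap_iota_comp]
  by_cases hgt : ∃ B : Set E, B.ncard = k ∧ (B ∩ F).ncard = r + 1
  · by_cases hlt : ∃ B, N.toMatroid.IsBase B ∧ (B ∩ F).ncard < r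
    · exact IsSplitRelaxation.isBicartesian a hΦ ⟨h, hlt, hgt⟩
    · have hN : ∀ B, N.toMatroid.IsBase B ↔ B.ncard = k ∧ (B ∩ F).ncard = r := fun B =>
        ⟨fun hB => ⟨h.ncard_eq B hB, le_antisymm (h.inter_le B hB)
          (not_lt.1 fun hh => hlt ⟨B, hB, hh⟩)⟩, fun hB => h.isBase_of_eq B hB.1 hB.2⟩
      refine isBicartesian_of_bijective_right hcomm (bijective_pieceMap_iota Φ a _ ?_)
        (bijective_pieceMap_iota Φ a _ ?_)
      · refine MatroidOn.ext_isBase fun B => ?_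
        rw [h.isBase_iff, h.isBase_upper_iff, hN, and_or_left]
      · refine MatroidOn.ext_isBase fun B => ?_
        rw [h.isBase_wall_iff, hN]
  · refine isBicartesian_of_bijective_left hcomm (bijective_pieceMap_iota Φ a _ ?_)
        (bijective_pieceMap_iota Φ a _ ?_)
    · exact MatroidOn.ext_isBase fun B => (h.isBase_iff B).trans (or_iff_left fun hh => hgt ⟨B, hh⟩)
    · refine MatroidOn.ext_isBase fun B => ?_
      rw [h.isBase_wall_iff, h.isBase_upper_iff]
      exact and_congr_right fun hB => or_iff_left fun hh => hgt ⟨B, hB, hh⟩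

variable {ι : Type} [DecidableEq ι] {R : Finset ι → MatroidOn E} {F : ι → Set E}
  {L P : ι → MatroidOn E}

omit [Finite E] in
theorem empty_subset_of_isRelaxationSquare
    (h : ∀ s i, i ∉ s → IsRelaxationSquare r k (F i) (R s) (R (insert i s)) (L i) (P i))
    (s : Finset ι) : basePolytope (R ∅) ⊆ basePolytope (R s) := by
  induction s using Finset.induction_on with
  | empty => exact subset_rfl
  | insert i s hi ih => exact ih.trans (h s i hi).lower_subset

omit [Finite E] in
theorem upper_subset_of_isRelaxationSquare
    (h : ∀ s i, i ∉ s → IsRelaxationSquare r k (F i) (R s) (R (insert i s)) (L i) (P i))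
    {s : Finset ι} {i : ι} (hi : i ∈ s) : basePolytope (L i) ⊆ basePolytope (R s) := by
  have := (h (s.erase i) i (Finset.notMem_erase i s)).upper_subset
  rwa [Finset.insert_erase hi] at this

/-- Pasting of squares: adding `j` to `s` glues the square of `R (insert j s)` over `R s` to what is
known for `s`. The three clauses are the bicartesian conditions with the products over `s` written
out index by index. -/
theorem iterated_relaxation (hΦ : IsValuative Φ)
    (h : ∀ s i, i ∉ s → IsRelaxationSquare r k (F i) (R s) (R (insert i s)) (L i) (P i))
    (hPL : ∀ i, basePolytope (P i) ⊆ basePolytope (L i))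
    (hP : ∀ i, basePolytope (P i) ⊆ basePolytope (R ∅)) (s : Finset ι) :
    (∀ (h₁ : basePolytope (R ∅) ⊆ basePolytope (R s))
      (h₂ : ∀ i ∈ s, basePolytope (L i) ⊆ basePolytope (R s)) (z : piece Φ a ⟨E, R s⟩),
      pieceMap Φ a (iota h₁) z = 0 → (∀ i hi, pieceMap Φ a (iota (h₂ i hi)) z = 0) → z = 0) ∧
    (∀ (h₁ : basePolytope (R ∅) ⊆ basePolytope (R s))
      (h₂ : ∀ i ∈ s, basePolytope (L i) ⊆ basePolytope (R s)) (x : piece Φ a ⟨E, R ∅⟩)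
      (y : ∀ i, piece Φ a ⟨E, L i⟩),
      (∀ i ∈ s, pieceMap Φ a (iota (hP i)) x = pieceMap Φ a (iota (hPL i)) (y i)) →
      ∃ z : piece Φ a ⟨E, R s⟩, pieceMap Φ a (iota h₁) z = x ∧
        ∀ i hi, pieceMap Φ a (iota (h₂ i hi)) z = y i) ∧
    (∀ w : ∀ i, piece Φ a ⟨E, P i⟩, ∃ x : piece Φ a ⟨E, R ∅⟩, ∀ i ∈ s,
      ∃ y, pieceMap Φ a (iota (hP i)) x + pieceMap Φ a (iota (hPL i)) y = w i) := by
  induction s using Finset.induction_on with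
  | empty =>
    refine ⟨fun h₁ _ z hz _ => ?_, fun h₁ _ x _ _ => ⟨x, ?_, ?_⟩, fun w => ⟨0, ?_⟩⟩
    · rwa [iota_self, pieceMap_id] at hz
    · rw [iota_self, pieceMap_id]; rfl
    · intro i hi
      exact absurd hi (Finset.notMem_empty i)
    · intro i hi
      exact absurd hi (Finset.notMem_empty i)
  | insert j s hj ih =>
    obtain ⟨ih₁, ih₂, ih₃⟩ := ih
    have hsq := h s j hj
    have sq := hsq.isBicartesian a hΦ
    have k₁ := empty_subset_of_isRelaxationSquare h s
    have k₂ : ∀ i ∈ s, basePolytope (L i) ⊆ basePolytope (R s) := fun i hi =>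
      upper_subset_of_isRelaxationSquare h hi
    refine ⟨fun h₁ h₂ z hz hzi => ?_, fun h₁ h₂ x y hxy => ?_, fun w => ?_⟩
    · refine sq.eq_zero z (ih₁ k₁ k₂ _ ?_ fun i hi => ?_) (hzi j (Finset.mem_insert_self j s))
      · rw [pieceMap_iota_comp]; exact hz
      · rw [pieceMap_iota_comp]; exact hzi i (Finset.mem_insert_of_mem hi)
    -- Lift to `R s` first, then across the square of `j`. The two data agree there because the map
    -- from `R s` to the wall `P j` factors through `R ∅`.
    · obtain ⟨z', hz'x, hz'y⟩ := ih₂ k₁ k₂ x y fun i hi => hxy i (Finset.mem_insert_of_mem hi)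
      obtain ⟨z, hz1, hz2⟩ := sq.exists_lift z' (y j) (by
        rw [← hxy j (Finset.mem_insert_self j s), ← hz'x, pieceMap_iota_comp])
      refine ⟨z, ?_, fun i hi => ?_⟩
      · rw [← hz'x, ← hz1, pieceMap_iota_comp]
      · rcases Finset.mem_insert.1 hi with rfl | hi'
        · exact hz2
        · rw [← hz'y i hi', ← hz1, pieceMap_iota_comp]
    · obtain ⟨x₁, hx₁⟩ := ih₃ w
      obtain ⟨x₀, y₀, hxy₀⟩ := sq.exists_add (w j - pieceMap Φ a (iota (hP j)) x₁)
      -- The correction `x₀` repairs index `j` and does not disturb the earlier ones: since it comes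
      -- from `R s`, its image in `P i` factors through `L i` for `i ∈ s` and can be absorbed in
      -- `y`.
      refine ⟨x₁ + pieceMap Φ a (iota k₁) x₀, fun i hi => ?_⟩
      rcases Finset.mem_insert.1 hi with rfl | hi'
      · refine ⟨y₀, ?_⟩
        rw [map_add, pieceMap_iota_comp, add_assoc, hxy₀, add_sub_cancel]
      · obtain ⟨y, hy⟩ := hx₁ i hi'
        refine ⟨y - pieceMap Φ a (iota (k₂ i hi')) x₀, ?_⟩
        rw [map_add, map_sub, pieceMap_iota_comp, pieceMap_iota_comp, ← hy]
        abel

/-- The square of a simultaneous relaxation at several sets is bicartesian. -/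
theorem isBicartesian_of_isRelaxationSquare [Fintype ι] (hΦ : IsValuative Φ)
    (h : ∀ s i, i ∉ s → IsRelaxationSquare r k (F i) (R s) (R (insert i s)) (L i) (P i))
    {M M' : MatroidOn E} (hM : M = R ∅) (hM' : M' = R Finset.univ)
    (h₁ : basePolytope M ⊆ basePolytope M')
    (h₂ : ∀ i, basePolytope (L i) ⊆ basePolytope M')
    (hP : ∀ i, basePolytope (P i) ⊆ basePolytope M)
    (hPL : ∀ i, basePolytope (P i) ⊆ basePolytope (L i)) :
    IsBicartesian (pieceMap Φ a (iota h₁)) (LinearMap.pi fun i => pieceMap Φ a (iota (h₂ i)))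
      (LinearMap.pi fun i => pieceMap Φ a (iota (hP i)))
      (LinearMap.pi fun i => pieceMap Φ a (iota (hPL i)) ∘ₗ LinearMap.proj i) := by
  subst hM hM'
  obtain ⟨i₁, i₂, i₃⟩ := iterated_relaxation a hΦ h hPL hP Finset.univ
  refine ⟨fun z hz hz' => i₁ h₁ (fun i _ => h₂ i) z hz fun i _ => congrFun hz' i,
    fun x y hxy => ?_, fun w => ?_⟩
  · obtain ⟨z, hz, hz'⟩ := i₂ h₁ (fun i _ => h₂ i) x y fun i _ => congrFun hxy i
    exact ⟨z, hz, funext fun i => hz' i (Finset.mem_univ i)⟩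
  · obtain ⟨x, hx⟩ := i₃ w
    choose y hy using fun i => hx i (Finset.mem_univ i)
    exact ⟨x, y, funext hy⟩

end iteration

/-! ### Relaxations at stressed flats -/

section stressed

variable {E : Type} [Finite E] {M : MatroidOn E} {F : Set E} {r k : ℕ}

theorem encard_eq_natCast_iff {X : Set E} {n : ℕ} : X.encard = n ↔ X.ncard = n := by
  rw [← X.toFinite.cast_ncard_eq]
  exact Nat.cast_inj

/-- Uniformity of the restriction makes `C ∩ F` a basis of `F`, and uniformity of the contraction
lets `C \ F` extend it. -/
theorem IsStressedFlat.isBase_of_ncard (hF : IsStressedFlat M F) (hr : M.toMatroid.eRk F = r)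
    (hk : M.toMatroid.eRank = k) {C : Set E} (hC : C.ncard = k) (hCF : (C ∩ F).ncard = r) :
    M.toMatroid.IsBase C := by
  have hC' : C.encard = k := encard_eq_natCast_iff.2 hC
  have hCF' : (C ∩ F).encard = r := encard_eq_natCast_iff.2 hCF
  have hi : M.toMatroid.Indep (C ∩ F) :=
    hF.indep_of_subset Set.inter_subset_right (by rw [hr, hCF'])
  have hb : M.toMatroid.IsBasis (C ∩ F) F := by
    refine hi.isBasis_of_eRk_ge (Set.toFinite _) Set.inter_subset_right ?_
      (by rw [M.ground_eq]; exact Set.subset_univ F)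
    rw [hi.eRk_eq_encard, hCF', hr]
  have hu := hF.indep_union (J := C \ F) hb Set.disjoint_sdiff_right (by
    rw [hr, ← hCF', Set.encard_sdiff_add_encard_inter, hC', hk])
  rw [Set.sdiff_union_inter] at hu
  refine hu.isBase_of_eRk_ge C.toFinite ?_
  rw [hu.eRk_eq_encard, hC', hk]

theorem mem_cusp_iff (hr : M.toMatroid.eRk F = r) (hk : M.toMatroid.eRank = k) {C : Set E} :
    C ∈ cusp M F ↔ C.ncard = k ∧ (C ∩ F).ncard = r + 1 := by
  rw [cusp, Set.mem_ofPred_eq, hr, hk, encard_eq_natCast_iff]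
  refine and_congr_right' ?_
  rw [← encard_eq_natCast_iff]
  push_cast
  rfl

theorem relax_isBase_iff {𝓕 : Set (Set E)} (h𝓕 : ∀ F ∈ 𝓕, IsStressedFlat M F) {B : Set E} :
    (relax M 𝓕 h𝓕).toMatroid.IsBase B ↔
      M.toMatroid.IsBase B ∨ ∃ F ∈ 𝓕, B ∈ cusp M F := Iff.rfl

theorem IsStressedFlat.exists_isBase_inter (hr : M.toMatroid.eRk F = r) :
    ∃ B, M.toMatroid.IsBase B ∧ (B ∩ F).ncard = r := by
  obtain ⟨I, hI⟩ := M.toMatroid.exists_isBasis F (by rw [M.ground_eq]; exact Set.subset_univ F)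
  obtain ⟨B, hB, hIB⟩ := hI.indep.exists_isBase_superset
  refine ⟨B, hB, ?_⟩
  rw [← hI.eq_of_subset_indep (hB.indep.inter_right F) (Set.subset_inter hIB hI.subset)
    Set.inter_subset_right, ← encard_eq_natCast_iff, hI.encard_eq_eRk, hr]

theorem ncard_inter_compl_add (X F : Set E) : (X ∩ Fᶜ).ncard + (X ∩ F).ncard = X.ncard := by
  rw [← Set.sdiff_eq, add_comm]
  exact Set.ncard_inter_add_ncard_sdiff_eq_ncard X F X.toFinite

/-- The matroid `M` enters only through a set of size `k` meeting `F` in `r` elements. It guarantees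
that `k - r` is not truncated and that the two uniform summands have their nominal ranks. -/
theorem piMatroid_isBase_iff (hr : M.toMatroid.eRk F = r) (hk : M.toMatroid.eRank = k)
    {B : Set E} : (piMatroid r k F).toMatroid.IsBase B ↔ B.ncard = k ∧ (B ∩ F).ncard = r := by
  obtain ⟨B₀, hB₀, hB₀F⟩ := IsStressedFlat.exists_isBase_inter hr
  have hB₀k : B₀.ncard = k := by rw [← encard_eq_natCast_iff, hB₀.encard_eq_eRank, hk]
  have hsplit := fun X : Set E => ncard_inter_compl_add X F
  have hrk : r ≤ k := by
    have := hsplit B₀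
    omega
  have hi₀ : (piMatroid r k F).toMatroid.Indep B₀ := by
    rw [piMatroid_indep]
    have := hsplit B₀
    omega
  have hle : ∀ I, (piMatroid r k F).toMatroid.Indep I → I.ncard ≤ k := by
    intro I hI
    rw [piMatroid_indep] at hI
    have := hsplit I
    omega
  have hbase : ∀ I, (piMatroid r k F).toMatroid.Indep I → I.ncard = k →
      (piMatroid r k F).toMatroid.IsBase I := by
    intro I hI hIk
    obtain ⟨B', hB', hIB'⟩ := hI.exists_isBase_superset
    rwa [Set.eq_of_subset_of_ncard_le hIB' (by rw [hIk]; exact hle B' hB'.indep) B'.toFinite]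
  constructor
  · intro hB
    have h1 : B.ncard = k := by
      rw [← hB₀k, hB.ncard_eq_ncard_of_isBase (hbase B₀ hi₀ hB₀k)]
    have h2 := piMatroid_indep.1 hB.indep
    have := hsplit B
    omega
  · rintro ⟨h1, h2⟩
    refine hbase B ?_ h1
    rw [piMatroid_indep]
    have := hsplit B
    omega

theorem eRank_piMatroid (hr : M.toMatroid.eRk F = r) (hk : M.toMatroid.eRank = k) :
    (piMatroid r k F).toMatroid.eRank = k := by
  obtain ⟨B, hB⟩ := (piMatroid r k F).toMatroid.exists_isBase
  rw [← hB.encard_eq_eRank, encard_eq_natCast_iff]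
  exact ((piMatroid_isBase_iff hr hk).1 hB).1

theorem eRk_piMatroid (hr : M.toMatroid.eRk F = r) (hk : M.toMatroid.eRank = k) :
    (piMatroid r k F).toMatroid.eRk F = r := by
  obtain ⟨I, hI⟩ := (piMatroid r k F).toMatroid.exists_isBasis F
    (by rw [(piMatroid r k F).ground_eq]; exact Set.subset_univ F)
  obtain ⟨B, hB, hIB⟩ := hI.indep.exists_isBase_superset
  rw [← hI.encard_eq_eRk, encard_eq_natCast_iff,
    hI.eq_of_subset_indep (hB.indep.inter_right F) (Set.subset_inter hIB hI.subset)
    Set.inter_subset_right]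
  exact ((piMatroid_isBase_iff hr hk).1 hB).2

theorem lambdaMatroid_isBase_iff (hr : M.toMatroid.eRk F = r) (hk : M.toMatroid.eRank = k)
    (hF : IsStressedFlat (piMatroid r k F) F) {B : Set E} :
    (lambdaMatroid r k F hF).toMatroid.IsBase B ↔
      B.ncard = k ∧ ((B ∩ F).ncard = r ∨ (B ∩ F).ncard = r + 1) := by
  rw [lambdaMatroid, relax_isBase_iff, piMatroid_isBase_iff hr hk, and_or_left]
  refine or_congr_right ?_
  rw [← mem_cusp_iff (eRk_piMatroid hr hk) (eRank_piMatroid hr hk)]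
  simp

/-- The point is that relaxing at other stressed flats creates no base meeting `F` in more than `r`
elements: such a base would lie in the cusp of another flat, which `IsStressedFlat.eq_of_cusp`
forces to be `F`. -/
theorem isRelaxationSquare_relax {𝓕 𝓖 : Set (Set E)} (h𝓕 : ∀ G ∈ 𝓕, IsStressedFlat M G)
    (h𝓖 : ∀ G ∈ 𝓖, IsStressedFlat M G) (hF : IsStressedFlat M F) (hFF : F ∉ 𝓕)
    (hins : 𝓖 = insert F 𝓕) (hr : M.toMatroid.eRk F = r) (hk : M.toMatroid.eRank = k) :
    IsRelaxationSquare r k F (relax M 𝓕 h𝓕) (relax M 𝓖 h𝓖) (lambdaMatroid r k F (hF.piMatroid hr hk))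
      (piMatroid r k F) where
  ncard_eq B hB := by
    rw [← encard_eq_natCast_iff, ← hk]
    rcases hB with hB | ⟨G, -, hB⟩
    · exact hB.encard_eq_eRank
    · exact hB.1
  inter_le B hB := by
    by_contra hcon
    have h1 : M.toMatroid.eRk F + 1 ≤ (B ∩ F).encard := by
      rw [hr, ← (B ∩ F).toFinite.cast_ncard_eq]
      exact_mod_cast (by omega : r + 1 ≤ (B ∩ F).ncard)
    rcases hB with hB | ⟨G, hG, hB⟩
    · have h2 := (hB.indep.inter_right F).encard_le_eRk_of_subset Set.inter_subset_right
      rw [hr, ← (B ∩ F).toFinite.cast_ncard_eq, Nat.cast_le] at h2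
      exact hcon h2
    · exact hFF ((hF.eq_of_cusp (h𝓕 G hG) hB.1 h1 hB.2.ge) ▸ hG)
  isBase_of_eq B h1 h2 := Or.inl (hF.isBase_of_ncard hr hk h1 h2)
  isBase_iff B := by
    subst hins
    rw [relax_isBase_iff, relax_isBase_iff, ← mem_cusp_iff hr hk]
    simp only [Set.mem_insert_iff, exists_eq_or_imp]
    rw [or_assoc]
    exact or_congr_right or_comm
  isBase_wall_iff _ := piMatroid_isBase_iff hr hk
  isBase_upper_iff _ := lambdaMatroid_isBase_iff hr hk _

end stressed

/-! ### Induced representations as products over an orbit -/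

section induced

/-- A family of vector spaces indexed by a `Γ`-set, with compatible linear maps `V i → V (γ i)`. -/
structure EquivariantFamily (Γ ι : Type) [Group Γ] [MulAction Γ ι] (V : ι → Type)
    [∀ i, AddCommGroup (V i)] [∀ i, Module ℚ (V i)] where
  -- The target is a separate index with a proof, so that equal indices such as `(γ * δ) • i` and `γ
  -- • δ • i` require no transport between fibres.
  trans : ∀ (γ : Γ) (i j : ι), γ • i = j → V i →ₗ[ℚ] V j
  trans_one : ∀ i (h : (1 : Γ) • i = i) v, trans 1 i i h v = v
  trans_mul : ∀ (γ δ : Γ) i j k (hij : δ • i = j) (hjk : γ • j = k) (hik : (γ * δ) • i = k) v,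
    trans (γ * δ) i k hik v = trans γ j k hjk (trans δ i j hij v)

namespace EquivariantFamily

variable {Γ ι : Type} [Group Γ] [MulAction Γ ι] {V : ι → Type}
    [∀ i, AddCommGroup (V i)] [∀ i, Module ℚ (V i)] (T : EquivariantFamily Γ ι V)

theorem trans_trans {γ δ ε : Γ} {i j k : ι} (hε : γ * δ = ε) (hij : δ • i = j) (hjk : γ • j = k)
    (hik : ε • i = k) (v : V i) :
    T.trans γ j k hjk (T.trans δ i j hij v) = T.trans ε i k hik v := by
  subst hε
  exact (T.trans_mul γ δ i j k hij hjk hik v).symm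

/-- The representation on the product of the family. -/
def piRep : Representation ℚ Γ (∀ i, V i) where
  toFun γ := LinearMap.pi fun j =>
    T.trans γ (γ⁻¹ • j) j (smul_inv_smul γ j) ∘ₗ LinearMap.proj (γ⁻¹ • j)
  map_one' := by
    refine LinearMap.ext fun v => funext fun j => ?_
    have : ∀ i (h : (1 : Γ) • i = j), T.trans 1 i j h (v i) = v j := by
      intro i h
      obtain rfl : i = j := by rw [← h, one_smul]
      exact T.trans_one i h _
    exact this _ _
  map_mul' γ δ := by
    refine LinearMap.ext fun v => funext fun j => ?_
    have : ∀ i i' (h : (γ * δ) • i = j) (h' : δ • i' = γ⁻¹ • j),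
        T.trans (γ * δ) i j h (v i) =
          T.trans γ (γ⁻¹ • j) j (smul_inv_smul γ j) (T.trans δ i' _ h' (v i')) := by
      intro i i' h h'
      obtain rfl : i = i' := by
        rw [mul_smul, smul_eq_iff_eq_inv_smul, ← h'] at h
        exact MulAction.injective δ h
      exact T.trans_mul _ _ _ _ _ _ _ _ _
    exact this _ _ _ _

theorem piRep_apply (γ : Γ) (v : ∀ i, V i) {i j : ι} (h : γ • i = j) :
    T.piRep γ v j = T.trans γ i j h (v i) := by
  have : ∀ i', (hi' : γ • i' = j) → T.trans γ i' j hi' (v i') = T.trans γ i j h (v i) := by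
    intro i' hi'
    obtain rfl : i' = i := MulAction.injective γ (hi'.trans h.symm)
    rfl
  exact this _ (smul_inv_smul γ j)

variable [DecidableEq ι]

theorem piRep_single (γ : Γ) {i j : ι} (h : γ • i = j) (v : V i) :
    T.piRep γ (Pi.single i v) = Pi.single j (T.trans γ i j h v) := by
  funext k
  rw [T.piRep_apply γ _ (smul_inv_smul γ k)]
  by_cases hk : k = j
  · subst hk
    rw [Pi.single_eq_same]
    have : ∀ i', (hi' : γ • i' = k) → T.trans γ i' k hi' ((Pi.single i v : ∀ i, V i) i') =
        T.trans γ i k h v := by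
      intro i' hi'
      obtain rfl : i' = i := MulAction.injective γ (hi'.trans h.symm)
      rw [Pi.single_eq_same]
    exact this _ _
  · rw [Pi.single_eq_of_ne hk, Pi.single_eq_of_ne, map_zero]
    intro hh
    exact hk (by rw [← h, ← hh, smul_inv_smul])

variable {H : Subgroup Γ} {i₀ : ι} (hH : ∀ γ ∈ H, γ • i₀ = i₀)
  (hH' : ∀ γ : Γ, γ • i₀ = i₀ → γ ∈ H)
  {ρ : Representation ℚ H (V i₀)} (hρ : ∀ (γ : H) v, ρ γ v = T.trans γ i₀ i₀ (hH γ γ.2) v)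

include hρ

/-- Frobenius reciprocity for the inclusion of the factor at `i₀`. The inverse appears because Γ
acts on the first argument of `IndV.mk` by right multiplication by inverses, so that `IndV.mk γ v`
plays the role of `γ⁻¹` applied to `v`. -/
theorem exists_indV_map : ∃ f : Representation.IndV H.subtype ρ →ₗ[ℚ] (∀ i, V i),
    (∀ (γ : Γ) v, f (Representation.IndV.mk H.subtype ρ γ v) = T.piRep γ⁻¹ (Pi.single i₀ v)) ∧
    ∀ (γ : Γ) x, f (Representation.ind H.subtype ρ γ x) = T.piRep γ (f x) := by
  let f : Representation.IndV H.subtype ρ →ₗ[ℚ] (∀ i, V i) :=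
    Representation.Coinvariants.lift _
    (TensorProduct.lift <| (Finsupp.lift _ _ _ fun γ : Γ =>
      T.piRep γ⁻¹ ∘ₗ LinearMap.single ℚ V i₀) ∘ₗ
      (MonoidAlgebra.coeffLinearEquiv ℚ).toLinearMap) fun η => by
        ext γ x : 4
        simp only [LinearMap.coe_comp, Function.comp_apply, MonoidAlgebra.lsingle_apply]
        simp [Representation.ofMulAction_single, mul_inv_rev]
        rw [hρ, T.piRep_single (η : Γ)⁻¹ (hH _ (H.inv_mem η.2)),
          T.trans_trans (inv_mul_cancel _) _ _ (one_smul _ _), T.trans_one]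
  have hf : ∀ (γ : Γ) v, f (Representation.IndV.mk H.subtype ρ γ v) =
      T.piRep γ⁻¹ (Pi.single i₀ v) := by
    intro γ v
    simp [f]
  refine ⟨f, hf, fun γ x => ?_⟩
  refine LinearMap.congr_fun (f := f ∘ₗ Representation.ind H.subtype ρ γ) (g := T.piRep γ ∘ₗ f) ?_ x
  refine Representation.IndV.hom_ext _ _ fun δ => LinearMap.ext fun v => ?_
  change f (Representation.ind H.subtype ρ γ (Representation.IndV.mk _ _ δ v)) =
    T.piRep γ (f (Representation.IndV.mk _ _ δ v))
  rw [Representation.ind_mk, hf, hf, ← Module.End.mul_apply, ← map_mul, mul_inv_rev, inv_inv]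

include hH' in
-- The inverse map carries the factor at `i` back to `i₀` by a chosen group element `σ i`. Another
-- choice differs by an element of `H`, which the coinvariants absorb.
theorem exists_indV_equiv [Fintype ι] [MulAction.IsPretransitive Γ ι] :
    ∃ e : (∀ i, V i) ≃ₗ[ℚ] Representation.IndV H.subtype ρ,
      (∀ (γ : Γ) x, e (T.piRep γ x) = Representation.ind H.subtype ρ γ (e x)) ∧
      ∀ (γ : Γ) x, e.symm (Representation.ind H.subtype ρ γ x) = T.piRep γ (e.symm x) := by
  obtain ⟨f, hf, hfe⟩ := T.exists_indV_map hH hρ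
  choose σ hσ using fun i => MulAction.exists_smul_eq Γ i₀ i
  have hσ' : ∀ i, (σ i)⁻¹ • i = i₀ := fun i => inv_smul_eq_iff.2 (hσ i).symm
  let g : (∀ i, V i) →ₗ[ℚ] Representation.IndV H.subtype ρ :=
    ∑ i, Representation.IndV.mk H.subtype ρ (σ i)⁻¹ ∘ₗ T.trans (σ i)⁻¹ i i₀ (hσ' i) ∘ₗ
      LinearMap.proj i
  have hg : ∀ i (v : V i), g (Pi.single i v) =
      Representation.IndV.mk H.subtype ρ (σ i)⁻¹ (T.trans (σ i)⁻¹ i i₀ (hσ' i) v) := by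
    intro i v
    rw [LinearMap.sum_apply, Finset.sum_eq_single i]
    · simp
    · intro j _ hj
      simp [Pi.single_eq_of_ne hj]
    · simp
  have h₁ : f ∘ₗ g = LinearMap.id := by
    refine LinearMap.pi_ext fun i v => ?_
    rw [LinearMap.comp_apply, hg, hf, inv_inv, T.piRep_single _ (hσ i),
      T.trans_trans (mul_inv_cancel (σ i)) _ _ (one_smul Γ i), T.trans_one]
    rfl
  have h₂ : g ∘ₗ f = LinearMap.id := by
    refine Representation.IndV.hom_ext _ _ fun γ => LinearMap.ext fun v => ?_
    obtain ⟨i, hi⟩ : ∃ i, γ⁻¹ • i₀ = i := ⟨_, rfl⟩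
    rw [LinearMap.comp_apply, LinearMap.comp_apply, hf, T.piRep_single γ⁻¹ hi, hg]
    have hη : (σ i)⁻¹ * γ⁻¹ ∈ H := hH' _ (by rw [mul_smul, hi, hσ'])
    rw [T.trans_trans rfl hi (hσ' i) (hH _ hη), ← hρ ⟨_, hη⟩]
    -- The defining relation of the coinvariants, moving `(σ i)⁻¹ * γ⁻¹` across the tensor sign.
    have hrel := Representation.Coinvariants.mk_self_apply (Representation.tprod
      ((Representation.leftRegular ℚ Γ).comp H.subtype) ρ) ⟨_, hη⟩
      (MonoidAlgebra.single γ 1 ⊗ₜ v)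
    refine Eq.trans ?_ hrel
    simp [Representation.ofMulAction_single]
  let e : (∀ i, V i) ≃ₗ[ℚ] Representation.IndV H.subtype ρ := LinearEquiv.ofLinearMap g f h₂ h₁
  have he : ∀ (γ : Γ) x, e.symm (Representation.ind H.subtype ρ γ x) = T.piRep γ (e.symm x) := hfe
  refine ⟨e, fun γ x => ?_, he⟩
  rw [← e.symm.injective.eq_iff, he, e.symm_apply_apply, e.symm_apply_apply]

end EquivariantFamily

end induced

/-! ### Classes in the Grothendieck group -/

section classes

theorem SplitK₀.mk_pt {C : Type*} [Category C] [HasZeroMorphisms C] {X Y : C}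
    (b : BinaryBicone X Y) (hb : b.IsBilimit) :
    SplitK₀.mk b.pt = SplitK₀.mk X + SplitK₀.mk Y := by
  have h : (QuotientAddGroup.mk (FreeAbelianGroup.of b.pt - FreeAbelianGroup.of X -
      FreeAbelianGroup.of Y) : SplitK₀ C) = 0 :=
    (QuotientAddGroup.eq_zero_iff _).2 (AddSubgroup.subset_closure ⟨X, Y, b, ⟨hb⟩, rfl⟩)
  rw [QuotientAddGroup.mk_sub, QuotientAddGroup.mk_sub, sub_sub, sub_eq_zero] at h
  exact h

/-- Maschke: average a linear section over the group, whose order is invertible in ℚ. -/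
theorem exists_equivariant_section {Γ T W : Type} [Group Γ] [Finite Γ] [AddCommGroup T]
    [AddCommGroup W] [Module ℚ T] [Module ℚ W] (ρ : Representation ℚ Γ T)
    (σ : Representation ℚ Γ W) (g : T →ₗ[ℚ] W) (hg : ∀ γ x, g (ρ γ x) = σ γ (g x))
    (hsurj : Function.Surjective g) :
    ∃ s : W →ₗ[ℚ] T, (∀ γ x, s (σ γ x) = ρ γ (s x)) ∧ ∀ x, g (s x) = x := by
  have := Fintype.ofFinite Γ
  obtain ⟨s₀, hs₀⟩ := g.exists_rightInverse_of_surjective (LinearMap.range_eq_top.2 hsurj)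
  have hs₀' : ∀ x, g (s₀ x) = x := fun x => LinearMap.congr_fun hs₀ x
  refine ⟨(Fintype.card Γ : ℚ)⁻¹ • ∑ γ : Γ, ρ γ ∘ₗ s₀ ∘ₗ σ γ⁻¹, fun δ x => ?_, fun x => ?_⟩
  · simp only [LinearMap.smul_apply, LinearMap.sum_apply, LinearMap.comp_apply, map_smul, map_sum]
    congr 1
    refine Fintype.sum_equiv (Equiv.mulLeft δ⁻¹) _ _ fun γ => ?_
    simp only [Equiv.coe_mulLeft, mul_inv_rev, inv_inv, map_mul, Module.End.mul_apply]
    rw [← Module.End.mul_apply (ρ δ), ← map_mul ρ, mul_inv_cancel, map_one, Module.End.one_apply]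
  · simp only [LinearMap.smul_apply, LinearMap.sum_apply, LinearMap.comp_apply, map_smul, map_sum,
      hg, hs₀']
    have : ∀ γ : Γ, σ γ (σ γ⁻¹ x) = x := fun γ => by
      rw [← Module.End.mul_apply, ← map_mul, mul_inv_cancel, map_one, Module.End.one_apply]
    simp only [this, Finset.sum_const, Finset.card_univ]
    rw [← Nat.cast_smul_eq_nsmul ℚ, smul_smul, inv_mul_cancel₀ (by simp), one_smul]

variable {A Γ : Type} [Group Γ]

/-- A morphism of graded representations, given degree by degree. -/
def grHom {X Y : GrRep A Γ} (f : ∀ a, (X.obj a).V →ₗ[ℚ] (Y.obj a).V)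
    (hf : ∀ a γ x, f a ((X.obj a).ρ γ x) = (Y.obj a).ρ γ (f a x)) : X ⟶ Y :=
  ObjectProperty.homMk fun a => Rep.ofHom
    (ρ := (X.obj a).ρ) (σ := (Y.obj a).ρ) ⟨f a, fun γ => LinearMap.ext fun x => hf a γ x⟩

/-- The degree `a` part of a morphism of graded representations. -/
def evalRep (a : A) {X Y : GrRep A Γ} (f : X ⟶ Y) : (X.obj a).V →ₗ[ℚ] (Y.obj a).V :=
  (f.hom a).hom.toLinearMap

theorem evalRep_ext {X Y : GrRep A Γ} {f g : X ⟶ Y}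
    (h : ∀ a x, evalRep a f x = evalRep a g x) : f = g := by
  apply ObjectProperty.hom_ext
  funext a
  apply Rep.hom_ext
  apply Representation.IntertwiningMap.ext
  exact LinearMap.ext fun x => h a x

/-- The direct sum of two graded representations. -/
def prodGr (X Y : GrRep A Γ) : GrRep A Γ :=
  ⟨fun a => Rep.of ((X.obj a).ρ.prod (Y.obj a).ρ), fun a => by
    have := X.property.1 a
    have := Y.property.1 a
    exact inferInstanceAs (Module.Finite ℚ ((X.obj a).V × (Y.obj a).V)), by
    refine (X.property.2.union Y.property.2).subset fun a ha => ?_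
    by_contra hcon
    rw [Set.mem_union, not_or] at hcon
    have h1 : Subsingleton (X.obj a).V := not_nontrivial_iff_subsingleton.1 hcon.1
    have h2 : Subsingleton (Y.obj a).V := not_nontrivial_iff_subsingleton.1 hcon.2
    have h3 : Nontrivial ((X.obj a).V × (Y.obj a).V) := ha
    have h4 : Subsingleton ((X.obj a).V × (Y.obj a).V) := inferInstance
    exact not_subsingleton _ h4⟩

theorem mk_eq_add_of_split {X Y T : GrRep A Γ} (i : X ⟶ T) (p : T ⟶ Y) (q : T ⟶ X) (j : Y ⟶ T)
    (h₁ : ∀ a x, evalRep a q (evalRep a i x) = x) (h₂ : ∀ a x, evalRep a p (evalRep a j x) = x)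
    (h₃ : ∀ a x, evalRep a p (evalRep a i x) = 0) (h₄ : ∀ a x, evalRep a q (evalRep a j x) = 0)
    (h₅ : ∀ a x, evalRep a i (evalRep a q x) + evalRep a j (evalRep a p x) = x) :
    (SplitK₀.mk T : VirtualGrRep A Γ) = SplitK₀.mk X + SplitK₀.mk Y :=
  SplitK₀.mk_pt (BinaryBicone.mk T q p i j (evalRep_ext h₁) (evalRep_ext h₃) (evalRep_ext h₄)
    (evalRep_ext h₂)) (isBinaryBilimitOfTotal _ (evalRep_ext h₅))

theorem mk_prodGr (X Y : GrRep A Γ) :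
    (SplitK₀.mk (prodGr X Y) : VirtualGrRep A Γ) = SplitK₀.mk X + SplitK₀.mk Y := by
  refine mk_eq_add_of_split (T := prodGr X Y)
    (grHom (Y := prodGr X Y) (fun a => LinearMap.inl ℚ (X.obj a).V (Y.obj a).V) ?_)
    (grHom (X := prodGr X Y) (fun a => LinearMap.snd ℚ (X.obj a).V (Y.obj a).V) ?_)
    (grHom (X := prodGr X Y) (fun a => LinearMap.fst ℚ (X.obj a).V (Y.obj a).V) ?_)
    (grHom (Y := prodGr X Y) (fun a => LinearMap.inr ℚ (X.obj a).V (Y.obj a).V) ?_)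
    (fun _ _ => rfl) (fun _ _ => rfl) (fun _ _ => rfl) (fun _ _ => rfl) ?_
  · intro a γ x
    exact Prod.ext rfl (map_zero ((Y.obj a).ρ γ)).symm
  · intro a γ x; rfl
  · intro a γ x; rfl
  · intro a γ x
    exact Prod.ext (map_zero ((X.obj a).ρ γ)).symm rfl
  · intro a x
    exact Prod.ext (add_zero _) (zero_add _)

/-- A degreewise bicartesian square of equivariant maps gives a relation in the Grothendieck
group. -/
theorem mk_add_mk_of_isBicartesian [Finite Γ] {X Y Z W : GrRep A Γ}
    (α : ∀ a, (X.obj a).V →ₗ[ℚ] (Y.obj a).V) (β : ∀ a, (X.obj a).V →ₗ[ℚ] (Z.obj a).V)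
    (γ : ∀ a, (Y.obj a).V →ₗ[ℚ] (W.obj a).V) (δ : ∀ a, (Z.obj a).V →ₗ[ℚ] (W.obj a).V)
    (hα : ∀ a g x, α a ((X.obj a).ρ g x) = (Y.obj a).ρ g (α a x))
    (hβ : ∀ a g x, β a ((X.obj a).ρ g x) = (Z.obj a).ρ g (β a x))
    (hγ : ∀ a g x, γ a ((Y.obj a).ρ g x) = (W.obj a).ρ g (γ a x))
    (hδ : ∀ a g x, δ a ((Z.obj a).ρ g x) = (W.obj a).ρ g (δ a x))
    (hcomm : ∀ a x, γ a (α a x) = δ a (β a x))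
    (h : ∀ a, IsBicartesian (α a) (β a) (γ a) (δ a)) :
    (SplitK₀.mk X + SplitK₀.mk W : VirtualGrRep A Γ) = SplitK₀.mk Y + SplitK₀.mk Z := by
  let f : ∀ a, (X.obj a).V →ₗ[ℚ] (Y.obj a).V × (Z.obj a).V := fun a => (α a).prod (β a)
  -- The sign makes `f` and `p` a short exact sequence, which is then split equivariantly.
  let p : ∀ a, (Y.obj a).V × (Z.obj a).V →ₗ[ℚ] (W.obj a).V := fun a => (γ a).coprod (-(δ a))
  have hf : ∀ a, Function.Injective (f a) := fun a => by
    rw [injective_iff_map_eq_zero]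
    exact fun x hx => (h a).eq_zero x (congrArg Prod.fst hx) (congrArg Prod.snd hx)
  have hpf : ∀ a x, p a (f a x) = 0 := fun a x => by
    simp [p, f, hcomm]
  have hker : ∀ a t, p a t = 0 → ∃ x, f a x = t := by
    rintro a ⟨y, z⟩ ht
    obtain ⟨x, hx, hx'⟩ := (h a).exists_lift y z (by simpa [p, add_neg_eq_zero] using ht)
    exact ⟨x, Prod.ext hx hx'⟩
  have hp : ∀ a, Function.Surjective (p a) := fun a w => by
    obtain ⟨y, z, hyz⟩ := (h a).exists_add w
    exact ⟨(y, -z), by simpa [p] using hyz⟩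
  have hfe : ∀ a g x, f a ((X.obj a).ρ g x) = ((prodGr Y Z).obj a).ρ g (f a x) := fun a g x =>
    Prod.ext (hα a g x) (hβ a g x)
  have hpe : ∀ a g x, p a (((prodGr Y Z).obj a).ρ g x) = (W.obj a).ρ g (p a x) := by
    rintro a g ⟨y, z⟩
    change p a ((Y.obj a).ρ g y, (Z.obj a).ρ g z) = _
    simp [p, hγ, hδ]
  choose s hse hs using fun a => exists_equivariant_section (T := (Y.obj a).V × (Z.obj a).V)
    ((Y.obj a).ρ.prod (Z.obj a).ρ) (W.obj a).ρ (p a) (hpe a) (hp a)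
  let e : ∀ a, (X.obj a).V ≃ₗ[ℚ] LinearMap.range (f a) := fun a => LinearEquiv.ofInjective (f a) (hf a)
  have hmem : ∀ a t, t - s a (p a t) ∈ LinearMap.range (f a) := fun a t =>
    hker a _ (by rw [map_sub, hs, sub_self])
  -- The section `s` leaves the complementary projection `t ↦ t - s (p t)`, with values in the range
  -- of `f`; reading it through `f` gives the retraction onto `X`.
  let q : ∀ a, (Y.obj a).V × (Z.obj a).V →ₗ[ℚ] (X.obj a).V := fun a =>
    (e a).symm.toLinearMap ∘ₗ (LinearMap.id - s a ∘ₗ p a).codRestrict (LinearMap.range (f a)) (hmem a)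
  have hq : ∀ a t, f a (q a t) = t - s a (p a t) := fun a t =>
    congrArg Subtype.val ((e a).apply_symm_apply ⟨t - s a (p a t), hmem a t⟩)
  rw [← mk_prodGr Y Z]
  refine (mk_eq_add_of_split (T := prodGr Y Z) (grHom (Y := prodGr Y Z) f hfe)
    (grHom (X := prodGr Y Z) p hpe) (grHom (X := prodGr Y Z) q ?_)
    (grHom (Y := prodGr Y Z) s hse) ?_ ?_ ?_ ?_ ?_).symm
  · intro a g t
    apply hf a
    refine ((hq a _).trans ?_).trans (hfe a g (q a t)).symm
    refine (congrArg₂ (· - ·) (Eq.refl (((Y.obj a).ρ.prod (Z.obj a).ρ) g t))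
      ((congrArg (s a) (hpe a g t)).trans (hse a g (p a t)))).trans ?_
    refine (map_sub (((Y.obj a).ρ.prod (Z.obj a).ρ) g) t (s a (p a t))).symm.trans ?_
    exact congrArg _ (hq a t).symm
  · intro a x
    apply hf a
    refine (hq a (f a x)).trans ?_
    rw [hpf, map_zero, sub_zero]
  · exact hs
  · exact hpf
  · intro a x
    apply hf a
    refine (hq a (s a x)).trans ?_
    rw [hs, sub_self, map_zero]
  · intro a t
    exact (congrArg (· + s a (p a t)) (hq a t)).trans (sub_add_cancel _ _)

end classes

/-- Used to replace the two products over the orbit by the induced representations. -/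
theorem IsBicartesian.congr {X Y Z W Z' W' : Type*} [AddCommGroup X] [AddCommGroup Y]
    [AddCommGroup Z] [AddCommGroup W] [AddCommGroup Z'] [AddCommGroup W'] [Module ℚ X] [Module ℚ Y]
    [Module ℚ Z] [Module ℚ W] [Module ℚ Z'] [Module ℚ W'] {α : X →ₗ[ℚ] Y} {β : X →ₗ[ℚ] Z}
    {γ : Y →ₗ[ℚ] W} {δ : Z →ₗ[ℚ] W} (h : IsBicartesian α β γ δ) (e : Z ≃ₗ[ℚ] Z')
    (e' : W ≃ₗ[ℚ] W') :
    IsBicartesian α (e.toLinearMap ∘ₗ β) (e'.toLinearMap ∘ₗ γ)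
      (e'.toLinearMap ∘ₗ δ ∘ₗ e.symm.toLinearMap) where
  eq_zero x hx hx' := h.eq_zero x hx (by simpa using hx')
  exists_lift y z hyz := by
    obtain ⟨x, hx, hx'⟩ := h.exists_lift y (e.symm z) (e'.injective hyz)
    exact ⟨x, hx, by simp [hx']⟩
  exists_add w := by
    obtain ⟨y, z, hyz⟩ := h.exists_add (e'.symm w)
    exact ⟨y, e z, by simp [← map_add, hyz]⟩

/-! ### Families of matroids indexed by an orbit -/

section family

variable {E A Γ ι : Type} [Finite E] [Group Γ] [MulAction Γ E] [MulAction Γ ι]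

omit [Finite E] in
theorem basePolytope_subset_permute {X Y : MatroidOn E} (γ : Γ)
    (h : ∀ B, Y.toMatroid.IsBase B → X.toMatroid.IsBase (γ⁻¹ • B)) :
    basePolytope Y ⊆ permute (MulAction.toPerm γ) '' basePolytope X := by
  rw [basePolytope, basePolytope, LinearMap.image_convexHull]
  refine convexHull_mono ?_
  rintro _ ⟨B, hB, rfl⟩
  refine ⟨(γ⁻¹ • B).indicator 1, ⟨γ⁻¹ • B, h B hB, rfl⟩, ?_⟩
  funext x
  change (γ⁻¹ • B).indicator 1 (γ⁻¹ • x) = B.indicator 1 x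
  by_cases hx : x ∈ B
  · rw [Set.indicator_of_mem hx, Set.indicator_of_mem (Set.smul_mem_smul_set hx)]
    rfl
  · rw [Set.indicator_of_notMem hx, Set.indicator_of_notMem]
    rwa [Set.smul_mem_smul_set_iff]

/-- The morphism `(E, X) → (E, Y)` given by a group element. -/
def translate {X Y : MatroidOn E} (γ : Γ)
    (h : ∀ B, Y.toMatroid.IsBase B → X.toMatroid.IsBase (γ⁻¹ • B)) :
    MatroidCat.mk E X ⟶ MatroidCat.mk E Y :=
  ⟨MulAction.toPerm γ, basePolytope_subset_permute γ h⟩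

variable (Γ) in
/-- A family of matroids permuted by `Γ`. -/
def IsEquivariantFamily (N : ι → MatroidOn E) : Prop :=
  ∀ (γ : Γ) (i j : ι), γ • i = j →
    ∀ B, (N j).toMatroid.IsBase B → (N i).toMatroid.IsBase (γ⁻¹ • B)

/-- The pieces of a family of matroids permuted by `Γ`. -/
def IsEquivariantFamily.pieces {N : ι → MatroidOn E} (hN : IsEquivariantFamily Γ N)
    (Φ : MatroidCat ⥤ GrVect A) (a : A) :
    EquivariantFamily Γ ι fun i => piece Φ a ⟨E, N i⟩ where
  trans γ i j h := pieceMap Φ a (translate γ (hN γ i j h))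
  trans_one i h v := by
    have : translate 1 (hN 1 i i h) = 𝟙 (MatroidCat.mk E (N i)) :=
      MatroidCat.Hom.ext (Equiv.ext fun x => one_smul Γ x)
    rw [this, pieceMap_id]
    rfl
  trans_mul γ δ i j k hij hjk hik v := by
    have : translate (γ * δ) (hN _ i k hik) =
        translate δ (hN _ i j hij) ≫ translate γ (hN _ j k hjk) :=
      MatroidCat.Hom.ext (Equiv.ext fun x => mul_smul γ δ x)
    rw [this, pieceMap_comp]

/-- Once the products are identified with induced representations, only equivariance remains. It
holds because a group element followed by the identity of `E` is the identity followed by the group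
element, as morphisms of matroids, and Φ is a functor. -/
theorem mk_add_mk_of_equivariantFamily [Finite Γ] [Fintype ι] [DecidableEq ι]
    [MulAction.IsPretransitive Γ ι] (Φ : MatroidCat ⥤ GrVect A) {M M' : MatroidOn E}
    (hM : IsInvariant Γ M) (hM' : IsInvariant Γ M') {L P : ι → MatroidOn E}
    (hL : IsEquivariantFamily Γ L) (hP : IsEquivariantFamily Γ P) {H : Subgroup Γ} {i₀ : ι}
    (hH : ∀ γ ∈ H, γ • i₀ = i₀) (hH' : ∀ γ : Γ, γ • i₀ = i₀ → γ ∈ H)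
    (hLH : IsInvariant H (L i₀)) (hPH : IsInvariant H (P i₀))
    (h₁ : basePolytope M ⊆ basePolytope M') (h₂ : ∀ i, basePolytope (L i) ⊆ basePolytope M')
    (h₃ : ∀ i, basePolytope (P i) ⊆ basePolytope M)
    (h₄ : ∀ i, basePolytope (P i) ⊆ basePolytope (L i))
    (h : ∀ a, IsBicartesian (pieceMap Φ a (iota h₁))
      (LinearMap.pi fun i => pieceMap Φ a (iota (h₂ i)))
      (LinearMap.pi fun i => pieceMap Φ a (iota (h₃ i)))
      (LinearMap.pi fun i => pieceMap Φ a (iota (h₄ i)) ∘ₗ LinearMap.proj i)) :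
    (SplitK₀.mk (repOf Φ hM') + SplitK₀.mk (indGr H (repOf Φ hPH)) : VirtualGrRep A Γ) =
      SplitK₀.mk (repOf Φ hM) + SplitK₀.mk (indGr H (repOf Φ hLH)) := by
  choose e hsymm he using fun a => (hL.pieces Φ a).exists_indV_equiv hH hH'
    (ρ := ((repOf Φ hLH).obj a).ρ) fun _ _ => rfl
  choose e' hsymm' he' using fun a => (hP.pieces Φ a).exists_indV_equiv hH hH'
    (ρ := ((repOf Φ hPH).obj a).ρ) fun _ _ => rfl
  have hnat : ∀ a {X Y X' Y' : MatroidCat} (f : X ⟶ Y) (g : Y ⟶ Y') (f' : X ⟶ X') (g' : X' ⟶ Y')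
      (_ : f ≫ g = f' ≫ g') (x : piece Φ a X),
      pieceMap Φ a g (pieceMap Φ a f x) = pieceMap Φ a g' (pieceMap Φ a f' x) := by
    intro a X Y X' Y' f g f' g' hfg x
    rw [← pieceMap_comp, hfg, pieceMap_comp]
  refine mk_add_mk_of_isBicartesian (X := repOf Φ hM') (Y := repOf Φ hM)
    (Z := indGr H (repOf Φ hLH)) (W := indGr H (repOf Φ hPH))
    (fun a => pieceMap Φ a (iota h₁))
    (fun a => (e a).toLinearMap ∘ₗ LinearMap.pi fun i => pieceMap Φ a (iota (h₂ i)))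
    (fun a => (e' a).toLinearMap ∘ₗ LinearMap.pi fun i => pieceMap Φ a (iota (h₃ i)))
    (fun a => (e' a).toLinearMap ∘ₗ
      (LinearMap.pi fun i => pieceMap Φ a (iota (h₄ i)) ∘ₗ LinearMap.proj i) ∘ₗ (e a).symm.toLinearMap)
    ?_ ?_ ?_ ?_ ?_ fun a => ?_
  · intro a γ x
    exact hnat a (hM'.aut γ) (iota h₁) (iota h₁) (hM.aut γ) (MatroidCat.Hom.ext rfl) x
  · intro a γ x
    refine Eq.trans (congrArg (e a) ?_) (hsymm a γ _)
    funext j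
    rw [EquivariantFamily.piRep_apply _ γ _ (smul_inv_smul γ j)]
    exact hnat a (hM'.aut γ) (iota (h₂ j)) (iota (h₂ _))
      (translate γ (hL γ _ j (smul_inv_smul γ j))) (MatroidCat.Hom.ext rfl) x
  · intro a γ x
    refine Eq.trans (congrArg (e' a) ?_) (hsymm' a γ _)
    funext j
    rw [EquivariantFamily.piRep_apply _ γ _ (smul_inv_smul γ j)]
    exact hnat a (hM.aut γ) (iota (h₃ j)) (iota (h₃ _))
      (translate γ (hP γ _ j (smul_inv_smul γ j))) (MatroidCat.Hom.ext rfl) x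
  · intro a γ x
    refine Eq.trans (congrArg (e' a) ?_) (hsymm' a γ _)
    refine (congrArg (LinearMap.pi fun i => pieceMap Φ a (iota (h₄ i)) ∘ₗ LinearMap.proj i)
      (he a γ x)).trans ?_
    funext j
    rw [EquivariantFamily.piRep_apply _ γ _ (smul_inv_smul γ j)]
    refine (congrArg (pieceMap Φ a (iota (h₄ j)))
      ((hL.pieces Φ a).piRep_apply γ ((e a).symm x) (smul_inv_smul γ j))).trans ?_
    exact hnat a (translate γ (hL γ _ j (smul_inv_smul γ j))) (iota (h₄ j)) (iota (h₄ _))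
      (translate γ (hP γ _ j (smul_inv_smul γ j))) (MatroidCat.Hom.ext rfl) _
  · intro a x
    refine congrArg (e' a) ?_
    refine Eq.trans ?_ (congrArg (LinearMap.pi fun i =>
      pieceMap Φ a (iota (h₄ i)) ∘ₗ LinearMap.proj i) ((e a).symm_apply_apply _)).symm
    funext j
    exact hnat a (iota h₁) (iota (h₃ j)) (iota (h₂ j)) (iota (h₄ j)) rfl x
  · exact (h a).congr (e a) (e' a)

end family

theorem ncard_inv_smul_inter {E Γ : Type} [Group Γ] [MulAction Γ E] (γ : Γ) (B F : Set E) :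
    (γ⁻¹ • B ∩ F).ncard = (B ∩ γ • F).ncard := by
  rw [← Set.ncard_smul_set γ (γ⁻¹ • B ∩ F), Set.smul_set_inter, smul_inv_smul]

end RelaxValuative

end

/-! ### Relaxation at the whole orbit of a stressed flat. -/

open RelaxValuative in
theorem proposition9p4 {E Γ A : Type} [Finite E] [Group Γ] [Finite Γ] [MulAction Γ E]
    [AddCommGroup A]
    (M : RelaxValuative.MatroidOn E) (hM : RelaxValuative.IsInvariant Γ M)
    (F : Set E) (hF : RelaxValuative.IsStressedFlat M F) (r k : ℕ)
    (hr : M.toMatroid.eRk F = r) (hk : M.toMatroid.eRank = k)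
    (Φ : RelaxValuative.MatroidCat ⥤ RelaxValuative.GrVect A)
    (hΦ : RelaxValuative.IsValuative Φ) :
    (RelaxValuative.SplitK₀.mk
        (RelaxValuative.repOf Φ (RelaxValuative.isInvariant_relaxOrbit hM hF)) :
      RelaxValuative.VirtualGrRep A Γ) =
    RelaxValuative.SplitK₀.mk (RelaxValuative.repOf Φ hM)
    + RelaxValuative.SplitK₀.mk (RelaxValuative.indGr (MulAction.stabilizer Γ F)
        (RelaxValuative.repOf Φ
          (RelaxValuative.isInvariant_lambdaMatroid (Γ := Γ) (hF.piMatroid hr hk))))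
    - RelaxValuative.SplitK₀.mk (RelaxValuative.indGr (MulAction.stabilizer Γ F)
        (RelaxValuative.repOf Φ (RelaxValuative.isInvariant_piMatroid (Γ := Γ) r k F))) := by
  classical
  have : Fintype (MulAction.orbit Γ F) := Fintype.ofFinite _
  have hst : ∀ i : MulAction.orbit Γ F, IsStressedFlat M i.1 := by
    rintro ⟨_, γ, rfl⟩
    exact hF.smul hM γ
  have hrk : ∀ i : MulAction.orbit Γ F, M.toMatroid.eRk i.1 = r := by
    rintro ⟨_, γ, rfl⟩
    exact (hM.eRk_smul γ F).trans hr
  -- Partial relaxations at arbitrary subsets of the orbit; only the two extreme ones need be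
  -- Γ-invariant.
  let R : Finset (MulAction.orbit Γ F) → MatroidOn E := fun s =>
    relax M (Subtype.val '' (s : Set (MulAction.orbit Γ F))) (by rintro _ ⟨i, -, rfl⟩; exact hst i)
  let L : MulAction.orbit Γ F → MatroidOn E := fun i =>
    lambdaMatroid r k i.1 ((hst i).piMatroid (hrk i) hk)
  let P : MulAction.orbit Γ F → MatroidOn E := fun i => piMatroid r k i.1
  have hsq : ∀ s i, i ∉ s → IsRelaxationSquare r k i.1 (R s) (R (insert i s)) (L i) (P i) := by
    intro s i hi
    refine isRelaxationSquare_relax _ _ (hst i) ?_ ?_ (hrk i) hk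
    · rintro ⟨j, hj, hji⟩
      exact hi (Subtype.ext hji ▸ hj)
    · rw [Finset.coe_insert, Set.image_insert_eq]
  have hR₀ : M = R ∅ := MatroidOn.ext_isBase fun B => by
    refine Iff.trans ?_ (relax_isBase_iff _).symm
    simp
  have hR₁ : relaxOrbit hM hF = R Finset.univ := MatroidOn.ext_isBase fun B => by
    refine (relax_isBase_iff _).trans (Iff.trans ?_ (relax_isBase_iff _).symm)
    simp
  have hL : IsEquivariantFamily Γ L := by
    rintro γ i _ rfl B hB
    have h := (lambdaMatroid_isBase_iff (hrk _) hk _).1 hB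
    refine (lambdaMatroid_isBase_iff (hrk i) hk _).2 ?_
    rwa [Set.ncard_smul_set, ncard_inv_smul_inter]
  have hP : IsEquivariantFamily Γ P := by
    rintro γ i _ rfl B hB
    have h := (piMatroid_isBase_iff (hrk _) hk).1 hB
    refine (piMatroid_isBase_iff (hrk i) hk).2 ?_
    rwa [Set.ncard_smul_set, ncard_inv_smul_inter]
  have h₁ : basePolytope M ⊆ basePolytope (relaxOrbit hM hF) :=
    basePolytope_mono fun B hB => Or.inl hB
  have h₂ : ∀ i, basePolytope (L i) ⊆ basePolytope (relaxOrbit hM hF) := fun i => by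
    have h := (hsq (Finset.univ.erase i) i (Finset.notMem_erase _ _)).upper_subset
    rwa [Finset.insert_erase (Finset.mem_univ i), ← hR₁] at h
  have h₃ : ∀ i, basePolytope (P i) ⊆ basePolytope M := fun i => by
    have h := (hsq ∅ i (Finset.notMem_empty i)).wall_subset_lower
    rwa [← hR₀] at h
  have h₄ : ∀ i, basePolytope (P i) ⊆ basePolytope (L i) := fun i =>
    (hsq ∅ i (Finset.notMem_empty i)).wall_subset_upper
  exact eq_sub_iff_add_eq.2 (mk_add_mk_of_equivariantFamily Φ hM (isInvariant_relaxOrbit hM hF)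
    hL hP (H := MulAction.stabilizer Γ F) (i₀ := ⟨F, MulAction.mem_orbit_self F⟩)
    (fun γ hγ => Subtype.ext hγ) (fun γ hγ => congrArg Subtype.val hγ) _ _ h₁ h₂ h₃ h₄ fun a =>
    isBicartesian_of_isRelaxationSquare a hΦ hsq hR₀ hR₁ h₁ h₂ h₃ h₄)
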